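/- Let $\Gamma$ be an analytic Lie pseudogroup acting in an open neighbourhood $U$ of $0\in\mathbb{R}^\nu$: a pseudogroup of analytic local diffeomorphisms of $U$ whose elements are exactly the analytic local diffeomorphisms of $U$ that are solutions of an analytic system of partial differential equations $R\subset J^k(\mathbb{R}^\nu,\mathbb{R}^\nu)$ that is involutive, i.e. $R$ is an analytic submanifold fibred over the source space, its first prolongation projects onto $R$ and has constant rank (the prolonged symbol $g_{k+1}$ has locally constant dimension on $R$), and its symbol $g_k$ satisfies Cartan's test at every point of $R$. Let $\mathcal{L}^\omega(\Gamma)$ be the Lie algebra of germs at $0$ of analytic vector fields that satisfy near $0$ the linearization of $R$ along the identity; these germs are identified with their Taylor series $V=\sum_{k\ge 0}V_k$, with $V_k$ homogeneous of degree $k$. For $q\ge 0$ let $\mathcal{L}_q^\omega(\Gamma)$ be the subspace of those $V\in\mathcal{L}^\omega(\Gamma)$ with $V_k=0$ for all $k\le q$. For $V_k=\sum_{i,\,|\alpha|=k}V^i_{k,\alpha}\frac{|\alpha|!}{\alpha!}x^\alpha\partial_i$ put $\|V_k\|_k=\max_{\alpha,i}|V^i_{k,\alpha}|$. For $\rho>0$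 let $\mathcal{L}^\omega_\rho(\Gamma)$ be the space of those $V\in\mathcal{L}^\omega(\Gamma)$ with $\limsup_k\|V_k\|_k/\rho^k<\infty$, with the norm $\|V\|_\rho=\sup_k\|V_k\|_k/\rho^{k-1}$. For $q\ge 1$ the quotient $\mathcal{L}_{q-1}^\omega(\Gamma)/\mathcal{L}_q^\omega(\Gamma)$ carries the norm $\|[V]\|_q=\|V_q\|_q$. Then there exist $\rho_0>0$, a constant $C$ and, for every integer $q\ge 1$, a linear section $$\Sigma_q:\mathcal{L}_{q-1}^\omega(\Gamma)/\mathcal{L}_q^\omega(\Gamma)\to\mathcal{L}_{q-1}^\omega(\Gamma)$$ of the natural projection, such that every $\Sigma_q$ takes values in the one space $\mathcal{L}^\omega_{\rho_0}(\Gamma)$ and $$\|\Sigma_q(w)\|_{\rho_0}\le C\,\|w\|_q\qquad\text{for all } q\ge 1 \text{ and all } w\in\mathcal{L}_{q-1}^\omega(\Gamma)/\mathcal{L}_q^\omega(\Gamma).$$ -/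

import Mathlib

open Filter Topology

namespace LiePG

/-! ### Partial derivatives, jets, formal vector fields -/

/-- The space `ℝⁿ` with its standard coordinates. -/
abbrev Sp (n : ℕ) : Type := Fin n → ℝ

/-- The partial derivative `∂ᵢ f`. -/
noncomputable def pd1 {n : ℕ} (i : Fin n) (f : Sp n → Sp n) : Sp n → Sp n :=
  fun x => fderiv ℝ f x (Pi.single i 1)

/-- Iterated partial derivatives along a list of directions. -/
noncomputable def pdList {n : ℕ} (l : List (Fin n)) (f : Sp n → Sp n) : Sp n → Sp n :=
  l.foldr pd1 f

/-- The partial derivative `∂^α f`, for a multi-index `α`. -/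
noncomputable def pd {n : ℕ} (α : Fin n →₀ ℕ) (f : Sp n → Sp n) : Sp n → Sp n :=
  pdList ((List.finRange n).flatMap fun i => List.replicate (α i) i) f

/-- `α! = α₁! ⋯ αₙ!`. -/
def mfact {n : ℕ} (α : Fin n →₀ ℕ) : ℕ := ∏ i, (α i).factorial

/-- The multi-indices of length `m`. -/
def idxEq (n m : ℕ) : Finset (Fin n →₀ ℕ) := Finset.finsuppAntidiag Finset.univ m

/-- The multi-indices of length at most `k`. -/
def idxLE (n k : ℕ) : Finset (Fin n →₀ ℕ) := (Finset.range (k + 1)).biUnion (idxEq n)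

/-- Vertical part of the jet space: values for all `∂^α y^i`, `|α| ≤ k`. -/
abbrev JetFib (n k : ℕ) : Type := ↥(idxLE n k) → Fin n → ℝ

/-- The space `J^k(ℝⁿ, ℝⁿ)` of `k`-jets of maps from `ℝⁿ` to `ℝⁿ`, in its standard coordinates
`(x, (y^i_α)_{|α| ≤ k})`. -/
abbrev Jet (n k : ℕ) : Type := Sp n × JetFib n k

/-- The `k`-jet of `f` at `x`. -/
noncomputable def jet {n : ℕ} (k : ℕ) (f : Sp n → Sp n) (x : Sp n) : Jet n k :=
  (x, fun α => pd α.1 f x)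

/-- Formal vector fields at the origin of `ℝⁿ`, by their components. -/
abbrev FormalVF (n : ℕ) : Type := Fin n → MvPowerSeries (Fin n) ℝ

/-- The Taylor series at the origin. -/
noncomputable def taylor {n : ℕ} (f : Sp n → Sp n) : FormalVF n :=
  fun i => (fun α => pd α f 0 i / (mfact α : ℝ) : (Fin n →₀ ℕ) → ℝ)

/-! ### Nonlinear systems of partial differential equations and involutivity -/

/-- `Φ = 0` is, on the open set `W` of the jet space, a regular analytic system of local equations
of `R`: the derivative of `Φ` along the fibres of the source projection `(x, y) ↦ x` is onto at the
points of `R`. -/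
structure IsLocalEq {n k : ℕ} (R : Set (Jet n k)) {r : ℕ} (W : Set (Jet n k))
    (Φ : Jet n k → (Fin r → ℝ)) : Prop where
  isOpen : IsOpen W
  analytic : AnalyticOnNhd ℝ Φ W
  eq_zero : ∀ p ∈ W, p ∈ R ↔ Φ p = 0
  onto : ∀ p ∈ W, p ∈ R → Function.Surjective fun u : JetFib n k => fderiv ℝ Φ p (0, u)

/-- `R` is an analytic submanifold of the jet space, fibred over the space of sources. -/
def IsFibredSubmanifold {n k : ℕ} (R : Set (Jet n k)) : Prop :=
  ∀ p ∈ R, ∃ (r : ℕ) (W : Set (Jet n k)) (Φ : Jet n k → (Fin r → ℝ)), p ∈ W ∧ IsLocalEq R W Φ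

/-- The vertical tangent space of `R` at `p`: the kernel of the vertical derivative of local
equations of `R` (it does not depend on their choice). -/
def vertTangent {n k : ℕ} (R : Set (Jet n k)) (p : Jet n k) : Submodule ℝ (JetFib n k) where
  carrier := {u | ∀ (r : ℕ) (W : Set (Jet n k)) (Φ : Jet n k → (Fin r → ℝ)),
    p ∈ W → IsLocalEq R W Φ → fderiv ℝ Φ p (0, u) = 0}
  add_mem' := by
    intro a b ha hb r W Φ hp h
    have := map_add (fderiv ℝ Φ p) ((0, a) : Jet n k) (0, b)
    rw [Prod.mk_add_mk, add_zero, ha r W Φ hp h, hb r W Φ hp h, add_zero] at this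
    exact this
  zero_mem' := by
    intro r W Φ _ _
    exact map_zero (fderiv ℝ Φ p)
  smul_mem' := by
    intro c a ha r W Φ hp h
    have := map_smul (fderiv ℝ Φ p) c ((0, a) : Jet n k)
    rw [Prod.smul_mk, smul_zero, ha r W Φ hp h, smul_zero] at this
    exact this

/-- The `(k+1)`-jet of `f` at `x` lies in the first prolongation of `R`: the `k`-jet of `f` at `x`
lies in `R`, and the equations of `R`, applied to `f`, vanish to first order at `x`. -/
def InProlongation {n k : ℕ} (R : Set (Jet n k)) (f : Sp n → Sp n) (x : Sp n) : Prop :=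
  jet k f x ∈ R ∧ ∀ (r : ℕ) (W : Set (Jet n k)) (Φ : Jet n k → (Fin r → ℝ)),
    jet k f x ∈ W → IsLocalEq R W Φ → fderiv ℝ (fun y => Φ (jet k f y)) x = 0

/-- Homogeneous polynomial vector fields of degree `m`, i.e. `V ⊗ S^m(V^*)` for `V = ℝⁿ`. -/
noncomputable def HomVF (n m : ℕ) : Submodule ℝ (Fin n → MvPolynomial (Fin n) ℝ) :=
  Submodule.pi Set.univ fun _ => MvPolynomial.homogeneousSubmodule (Fin n) ℝ m

/-- The vertical jet at the origin of a polynomial vector field. -/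
noncomputable def polyJet {n : ℕ} (k : ℕ) :
    (Fin n → MvPolynomial (Fin n) ℝ) →ₗ[ℝ] JetFib n k where
  toFun w := fun α i => (mfact α.1 : ℝ) * MvPolynomial.coeff α.1 (w i)
  map_add' := by
    intro a b
    funext α i
    simp [mul_add]
  map_smul' := by
    intro c a
    funext α i
    simp only [Pi.smul_apply, MvPolynomial.coeff_smul, smul_eq_mul, RingHom.id_apply]
    ring

/-- The derivative of a polynomial vector field along a constant vector `v`. -/
noncomputable def dirDeriv {n : ℕ} (v : Sp n) :
    (Fin n → MvPolynomial (Fin n) ℝ) →ₗ[ℝ] (Fin n → MvPolynomial (Fin n) ℝ) :=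
  LinearMap.pi fun i =>
    (∑ j, v j • (MvPolynomial.pderiv j).toLinearMap) ∘ₗ LinearMap.proj i

/-- The symbol `g_k` of `R` at `p`: the homogeneous polynomial vector fields of degree `k` which,
seen as vertical tangent vectors, are tangent to `R`. -/
noncomputable def symb {n k : ℕ} (R : Set (Jet n k)) (p : Jet n k) :
    Submodule ℝ (Fin n → MvPolynomial (Fin n) ℝ) :=
  HomVF n k ⊓ (vertTangent R p).comap (polyJet k)

/-- The first prolongation `g_{k+1}` of the symbol. -/
noncomputable def symbProl {n k : ℕ} (R : Set (Jet n k)) (p : Jet n k) :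
    Submodule ℝ (Fin n → MvPolynomial (Fin n) ℝ) :=
  HomVF n (k + 1) ⊓ ⨅ v : Sp n, (symb R p).comap (dirDeriv v)

/-- The subspace of the symbol of the elements that are killed by the derivatives along
`b j`, `j < i`. -/
noncomputable def symbSub {n k : ℕ} (R : Set (Jet n k)) (p : Jet n k)
    (b : Module.Basis (Fin n) ℝ (Sp n)) (i : Fin n) :
    Submodule ℝ (Fin n → MvPolynomial (Fin n) ℝ) :=
  symb R p ⊓ ⨅ j : {j : Fin n // j < i}, LinearMap.ker (dirDeriv (b j.1))

/-- Cartan's test: in a suitable basis (a quasi-regular one), the dimension of the prolonged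
symbol is the sum of the dimensions of the subspaces `symbSub`. -/
def SymbInvolutive {n k : ℕ} (R : Set (Jet n k)) (p : Jet n k) : Prop :=
  ∃ b : Module.Basis (Fin n) ℝ (Sp n),
    Module.finrank ℝ (symbProl R p) = ∑ i : Fin n, Module.finrank ℝ (symbSub R p b i)

/-- `R` is an involutive analytic system of partial differential equations of order `k`. -/
structure IsInvolutive {n k : ℕ} (R : Set (Jet n k)) : Prop where
  fibred : IsFibredSubmanifold R
  /-- The first prolongation projects onto `R`. -/
  surj : ∀ p ∈ R, ∃ f : Sp n → Sp n, AnalyticAt ℝ f p.1 ∧ jet k f p.1 = p ∧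
    InProlongation R f p.1
  /-- The first prolongation has constant rank over `R`. -/
  rank_const : ∀ p ∈ R, ∀ᶠ q in 𝓝[R] p,
    Module.finrank ℝ (symbProl R q) = Module.finrank ℝ (symbProl R p)
  /-- The symbol is involutive at every point of `R`. -/
  symb_involutive : ∀ p ∈ R, SymbInvolutive R p

/-! ### Lie pseudogroups -/

/-- Analytic local diffeomorphisms between open subsets of `U`. -/
def IsAnalyticLocalDiffeo {n : ℕ} (U : Set (Sp n)) (e : OpenPartialHomeomorph (Sp n) (Sp n)) :
    Prop :=
  e.source ⊆ U ∧ e.target ⊆ U ∧ AnalyticOnNhd ℝ e e.source ∧ AnalyticOnNhd ℝ e.symm e.target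

/-- A pseudogroup of analytic local diffeomorphisms of an open neighbourhood `dom` of the origin
of `ℝⁿ`. -/
structure AnalyticPseudogroup (n : ℕ) where
  dom : Set (Sp n)
  isOpen_dom : IsOpen dom
  zero_mem_dom : (0 : Sp n) ∈ dom
  elems : Set (OpenPartialHomeomorph (Sp n) (Sp n))
  analytic : ∀ e ∈ elems, IsAnalyticLocalDiffeo dom e
  id_mem : OpenPartialHomeomorph.ofSet dom isOpen_dom ∈ elems
  symm_mem : ∀ e ∈ elems, e.symm ∈ elems
  trans_mem : ∀ e ∈ elems, ∀ e' ∈ elems, e.trans e' ∈ elems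
  restr_mem : ∀ e ∈ elems, ∀ s : Set (Sp n), IsOpen s → e.restr s ∈ elems
  glue_mem : ∀ e : OpenPartialHomeomorph (Sp n) (Sp n),
    (∀ x ∈ e.source, ∃ s : Set (Sp n), IsOpen s ∧ x ∈ s ∧ e.restr s ∈ elems) → e ∈ elems

/-- An analytic Lie pseudogroup: the elements are the analytic local diffeomorphisms that are
solutions of an involutive system of partial differential equations. -/
structure LiePseudogroup (n : ℕ) extends AnalyticPseudogroup n where
  order : ℕ
  system : Set (Jet n order)
  involutive : IsInvolutive system
  mem_iff : ∀ e : OpenPartialHomeomorph (Sp n) (Sp n), IsAnalyticLocalDiffeo dom e →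
    (e ∈ elems ↔ ∀ x ∈ e.source, jet order e x ∈ system)

/-! ### Helper facts on partial derivatives -/

theorem pd1_congr {n : ℕ} (i : Fin n) {f g : Sp n → Sp n} {x : Sp n} (h : f =ᶠ[𝓝 x] g) :
    pd1 i f =ᶠ[𝓝 x] pd1 i g := by
  filter_upwards [h.fderiv (𝕜 := ℝ)] with y hy
  simp only [pd1, hy]

theorem pd1_analytic {n : ℕ} (i : Fin n) {f : Sp n → Sp n} {x : Sp n} (h : AnalyticAt ℝ f x) :
    AnalyticAt ℝ (pd1 i f) x :=
  ((ContinuousLinearMap.apply ℝ (Sp n) (Pi.single i 1 : Sp n)).analyticAt _).comp h.fderiv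

theorem pdList_analytic {n : ℕ} (l : List (Fin n)) {f : Sp n → Sp n} {x : Sp n}
    (h : AnalyticAt ℝ f x) : AnalyticAt ℝ (pdList l f) x := by
  induction l with
  | nil => exact h
  | cons i l ih => exact pd1_analytic i ih

theorem pdList_add {n : ℕ} (l : List (Fin n)) {f g : Sp n → Sp n} {x : Sp n}
    (hf : AnalyticAt ℝ f x) (hg : AnalyticAt ℝ g x) :
    pdList l (f + g) =ᶠ[𝓝 x] pdList l f + pdList l g := by
  induction l with
  | nil => exact EventuallyEq.rfl
  | cons i l ih =>
    refine (pd1_congr i ih).trans ?_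
    filter_upwards [(pdList_analytic l hf).eventually_analyticAt,
      (pdList_analytic l hg).eventually_analyticAt] with y h1 h2
    change fderiv ℝ (pdList l f + pdList l g) y (Pi.single i 1) = _
    rw [fderiv_add h1.differentiableAt h2.differentiableAt]
    rfl

theorem pdList_smul {n : ℕ} (l : List (Fin n)) (c : ℝ) {f : Sp n → Sp n} {x : Sp n}
    (hf : AnalyticAt ℝ f x) : pdList l (c • f) =ᶠ[𝓝 x] c • pdList l f := by
  induction l with
  | nil => exact EventuallyEq.rfl
  | cons i l ih =>
    refine (pd1_congr i ih).trans ?_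
    filter_upwards [(pdList_analytic l hf).eventually_analyticAt] with y h1
    change fderiv ℝ (c • pdList l f) y (Pi.single i 1) = _
    rw [fderiv_const_smul h1.differentiableAt]
    rfl

theorem pdList_zero {n : ℕ} (l : List (Fin n)) : pdList l (0 : Sp n → Sp n) = 0 := by
  induction l with
  | nil => rfl
  | cons i l ih =>
    change pd1 i (pdList l 0) = 0
    rw [ih]
    funext x
    simp [pd1]

/-! ### The Lie algebra of a Lie pseudogroup and its norms -/

/-- The Lie algebra `𝓛^ω(Γ)` of analytic vector fields at the origin (identified with their Taylor
series) that satisfy, near the origin, the linearization along the identity of the defining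
system of `Γ`. -/
noncomputable def lieAlg {n : ℕ} (Γ : LiePseudogroup n) : Submodule ℝ (FormalVF n) where
  carrier := {V | ∃ f : Sp n → Sp n, AnalyticAt ℝ f 0 ∧ V = taylor f ∧
    ∀ᶠ x in 𝓝 0, (jet Γ.order f x).2 ∈ vertTangent Γ.system (jet Γ.order id x)}
  add_mem' := by
    rintro _ _ ⟨f, hf, rfl, hf'⟩ ⟨g, hg, rfl, hg'⟩
    refine ⟨f + g, hf.add hg, ?_, ?_⟩
    · funext i
      ext α
      have h : pd α (f + g) 0 i = pd α f 0 i + pd α g 0 i :=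
        congrFun (pdList_add _ hf hg).self_of_nhds i
      change pd α f 0 i / (mfact α : ℝ) + pd α g 0 i / (mfact α : ℝ)
        = pd α (f + g) 0 i / (mfact α : ℝ)
      rw [h, add_div]
    · filter_upwards [hf', hg', hf.eventually_analyticAt, hg.eventually_analyticAt]
        with x h1 h2 h3 h4
      have h : (jet Γ.order (f + g) x).2 = (jet Γ.order f x).2 + (jet Γ.order g x).2 := by
        funext α
        exact (pdList_add _ h3 h4).self_of_nhds
      rw [h]
      exact Submodule.add_mem _ h1 h2
  zero_mem' := by
    refine ⟨0, analyticAt_const, ?_, ?_⟩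
    · funext i
      ext α
      have h : pd α (0 : Sp n → Sp n) 0 i = 0 := by
        rw [pd, pdList_zero]
        rfl
      change (0 : ℝ) = pd α (0 : Sp n → Sp n) 0 i / (mfact α : ℝ)
      rw [h, zero_div]
    · refine Eventually.of_forall fun x => ?_
      have h : (jet Γ.order (0 : Sp n → Sp n) x).2 = 0 := by
        funext α
        change pd α.1 (0 : Sp n → Sp n) x = 0
        rw [pd, pdList_zero]
        rfl
      rw [h]
      exact Submodule.zero_mem _
  smul_mem' := by
    rintro c _ ⟨f, hf, rfl, hf'⟩
    refine ⟨c • f, hf.const_smul, ?_, ?_⟩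
    · funext i
      ext α
      have h : pd α (c • f) 0 i = c * pd α f 0 i :=
        congrFun (pdList_smul _ c hf).self_of_nhds i
      change c * (pd α f 0 i / (mfact α : ℝ)) = pd α (c • f) 0 i / (mfact α : ℝ)
      rw [h, mul_div_assoc]
    · filter_upwards [hf', hf.eventually_analyticAt] with x h1 h3
      have h : (jet Γ.order (c • f) x).2 = c • (jet Γ.order f x).2 := by
        funext α
        exact (pdList_smul _ c h3).self_of_nhds
      rw [h]
      exact Submodule.smul_mem _ c h1

/-- The formal vector fields `χ_q` tangent up to order `q` to the zero vector field. -/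
def chi (n q : ℕ) : Submodule ℝ (FormalVF n) where
  carrier := {V | ∀ i, ∀ α : Fin n →₀ ℕ, α.degree ≤ q → MvPowerSeries.coeff α (V i) = 0}
  add_mem' := by
    intro a b ha hb i α h
    rw [Pi.add_apply, map_add, ha i α h, hb i α h, add_zero]
  zero_mem' := by
    intro i α _
    simp
  smul_mem' := by
    intro c a ha i α h
    rw [Pi.smul_apply, map_smul, ha i α h, smul_zero]

/-- `𝓛_q^ω(Γ) = 𝓛^ω(Γ) ∩ χ_q`. -/
noncomputable def filt {n : ℕ} (Γ : LiePseudogroup n) (q : ℕ) : Submodule ℝ (FormalVF n) :=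
  lieAlg Γ ⊓ chi n q

/-- The quotient `𝓛_q^ω(Γ) / 𝓛_{q+1}^ω(Γ)`. -/
abbrev Gr {n : ℕ} (Γ : LiePseudogroup n) (q : ℕ) : Type :=
  filt Γ q ⧸ (filt Γ (q + 1)).submoduleOf (filt Γ q)

/-- The norm `‖V_k‖_k` of the homogeneous part `V_k` of degree `k` of `V`: the maximum of the
absolute values of its coefficients in the basis `(|α|! / α!) x^α ∂_i`, `|α| = k`. -/
noncomputable def homNorm {n : ℕ} (k : ℕ) (V : FormalVF n) : ℝ :=
  ((idxEq n k ×ˢ (Finset.univ : Finset (Fin n))).sup fun p =>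
    ‖(mfact p.1 : ℝ) / (k.factorial : ℝ) * MvPowerSeries.coeff p.1 (V p.2)‖₊ : NNReal)

/-- The norm `‖V‖_ρ = sup_k ‖V_k‖_k / ρ^{k-1}`. -/
noncomputable def rhoNorm {n : ℕ} (ρ : ℝ) (V : FormalVF n) : ℝ :=
  ⨆ k : ℕ, homNorm k V / ρ ^ ((k : ℤ) - 1)

theorem homNorm_nonneg {n : ℕ} (k : ℕ) (V : FormalVF n) : 0 ≤ homNorm k V := NNReal.coe_nonneg _

theorem homNorm_add {n : ℕ} (k : ℕ) (V W : FormalVF n) :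
    homNorm k (V + W) ≤ homNorm k V + homNorm k W := by
  unfold homNorm
  rw [← NNReal.coe_add, NNReal.coe_le_coe]
  refine Finset.sup_le fun p hp => ?_
  rw [Pi.add_apply, map_add, mul_add]
  exact (nnnorm_add_le _ _).trans (add_le_add
    (Finset.le_sup (f := fun p : (Fin n →₀ ℕ) × Fin n =>
      ‖(mfact p.1 : ℝ) / (k.factorial : ℝ) * MvPowerSeries.coeff p.1 (V p.2)‖₊) hp)
    (Finset.le_sup (f := fun p : (Fin n →₀ ℕ) × Fin n =>
      ‖(mfact p.1 : ℝ) / (k.factorial : ℝ) * MvPowerSeries.coeff p.1 (W p.2)‖₊) hp))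

theorem homNorm_smul_le {n : ℕ} (k : ℕ) (c : ℝ) (V : FormalVF n) :
    homNorm k (c • V) ≤ |c| * homNorm k V := by
  have hc : |c| = ((‖c‖₊ : NNReal) : ℝ) := by simp
  unfold homNorm
  rw [hc, ← NNReal.coe_mul, NNReal.coe_le_coe]
  refine Finset.sup_le fun p hp => ?_
  rw [Pi.smul_apply, map_smul, smul_eq_mul, mul_left_comm, nnnorm_mul]
  exact mul_le_mul_right (Finset.le_sup (f := fun p : (Fin n →₀ ℕ) × Fin n =>
      ‖(mfact p.1 : ℝ) / (k.factorial : ℝ) * MvPowerSeries.coeff p.1 (V p.2)‖₊) hp) _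

/-- The Banach subspace `𝓛_ρ^ω(Γ)`: the elements `V` of `𝓛^ω(Γ)` for which `‖V_k‖_k / ρ^k` is
bounded, i.e. has a finite upper limit. -/
noncomputable def banachSub {n : ℕ} (Γ : LiePseudogroup n) (ρ : ℝ) :
    Submodule ℝ (FormalVF n) where
  carrier := {V | V ∈ lieAlg Γ ∧ ∃ M : ℝ, ∀ k : ℕ, homNorm k V ≤ M * ρ ^ k}
  add_mem' := by
    rintro a b ⟨ha, M, hM⟩ ⟨hb, N, hN⟩
    refine ⟨Submodule.add_mem _ ha hb, M + N, fun k => ?_⟩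
    rw [add_mul]
    exact (homNorm_add k a b).trans (add_le_add (hM k) (hN k))
  zero_mem' := by
    refine ⟨Submodule.zero_mem _, 0, fun k => ?_⟩
    have := homNorm_smul_le k 0 (0 : FormalVF n)
    simpa using this
  smul_mem' := by
    rintro c a ⟨ha, M, hM⟩
    refine ⟨Submodule.smul_mem _ c ha, |c| * M, fun k => ?_⟩
    rw [mul_assoc]
    exact (homNorm_smul_le k c a).trans (mul_le_mul_of_nonneg_left (hM k) (abs_nonneg c))

end LiePG

/-! The infinitesimal equations of Γ form, near 0, a linear system of order k with analytic
coefficients whose symbol passes Cartan's test. The sections come from a Riquier–Janet solution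
operator: fix the parametric derivatives of order N = q+1, set all other parametric derivatives to
zero, and let the equations determine the rest. The point is that the resulting bounds do not depend
on N.

Derivatives (α, i) receive weights in ℕ that respect order and class (`exists_isWeight`). An echelon
form at 0 with respect to the weight solves each equation for a principal derivative in terms of
parametric derivatives of smaller weight (`exists_normal_system`). Every derivative is a
multiplicative derivative of a principal one in at most one way (`IsDec.unique`), so differentiating
the equations gives a recursion triangular in the weight, with a unique solution for given
parametric data.

Growth is measured by |c|!·s^μ(c). Each term of the recursion has strictly smaller weight, with an
extra drop of at least the number of derivatives that fall on a coefficient (`gap_of_coef_ne_zero`).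
For large s the recursion therefore at least halves the bound (`exists_recAll_bound`), whatever N
is; since weights are bounded linearly in the order, the series converges.

The series solves the system because of involutivity. Cartan's test counts the parametric
derivatives of order k paired with their multiplicative variables (`card_multPair`), and a dimension
count shows that the equations with their multiplicative derivatives already define the prolongation
(`eventually_ker_of_finrank`). Hence a nonmultiplicative derivative of an equation is an analytic
combination of these (`exists_relation`). The residuals of the series inherit the relations and
vanish to infinite order (`residual_vanish`).

Two reductions lead to this situation. A linear change of coordinates carries the standard basis to
a quasi-regular one and costs only geometric factors (`exists_solution_operator_of_cartan`). Also,
the prolongation of the linearized system must project onto that system, whereas the hypothesis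
concerns the nonlinear one. `IsInvolutive.exists_prolongation` transfers it: where the rank is
constant, membership in the range of the prolongation map is expressed by differentiable equations,
which vanish on R and so have zero derivative along tangent vectors.

Finally, if f is a solution vanishing below order N, the operator applied to f agrees with f through
order N and depends only on the derivatives of order N. So it descends to the quotient and is a
section of the projection. -/

namespace LiePG

/-! ### Iterated partial derivatives of functions with values in a normed space -/

section Calculus

variable {n : ℕ} {F : Type*} [NormedAddCommGroup F] [NormedSpace ℝ F]

/-- The partial derivative `∂ᵢ f` of a function with values in a normed space. -/
noncomputable def dd1 (i : Fin n) (f : Sp n → F) : Sp n → F :=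
  fun x => fderiv ℝ f x (Pi.single i 1)

/-- Iterated partial derivatives along a list of directions. -/
noncomputable def ddList (l : List (Fin n)) (f : Sp n → F) : Sp n → F :=
  l.foldr dd1 f

/-- The list of directions of a multi-index. -/
def idxList (α : Fin n →₀ ℕ) : List (Fin n) :=
  (List.finRange n).flatMap fun i => List.replicate (α i) i

/-- The partial derivative `∂^α f`. -/
noncomputable def dd (α : Fin n →₀ ℕ) (f : Sp n → F) : Sp n → F := ddList (idxList α) f

theorem dd1_congr (i : Fin n) {f g : Sp n → F} {x : Sp n} (h : f =ᶠ[𝓝 x] g) :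
    dd1 i f =ᶠ[𝓝 x] dd1 i g := by
  filter_upwards [h.fderiv (𝕜 := ℝ)] with y hy
  simp only [dd1, hy]

theorem ddList_congr (l : List (Fin n)) {f g : Sp n → F} {x : Sp n} (h : f =ᶠ[𝓝 x] g) :
    ddList l f =ᶠ[𝓝 x] ddList l g := by
  induction l with
  | nil => exact h
  | cons i l ih => exact dd1_congr i ih

theorem dd_congr (α : Fin n →₀ ℕ) {f g : Sp n → F} {x : Sp n} (h : f =ᶠ[𝓝 x] g) :
    dd α f =ᶠ[𝓝 x] dd α g := ddList_congr _ h

theorem ddList_cons (i : Fin n) (l : List (Fin n)) (f : Sp n → F) :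
    ddList (i :: l) f = dd1 i (ddList l f) := rfl

theorem ddList_append (l l' : List (Fin n)) (f : Sp n → F) :
    ddList (l ++ l') f = ddList l (ddList l' f) := by
  simp [ddList, List.foldr_append]

theorem count_idxList (α : Fin n →₀ ℕ) (j : Fin n) : (idxList α).count j = α j := by
  classical
  unfold idxList
  rw [List.count_flatMap]
  have : (List.map (List.count j ∘ fun i => List.replicate (α i) i) (List.finRange n)).sum
      = ∑ i : Fin n, if i = j then α i else 0 := by
    rw [← List.ofFn_eq_map, List.sum_ofFn]
    refine Finset.sum_congr rfl fun i _ => ?_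
    simp [List.count_replicate]
  rw [this]
  simp

theorem idxList_perm_of_count {α : Fin n →₀ ℕ} {l : List (Fin n)} (h : ∀ j, l.count j = α j) :
    l.Perm (idxList α) := by
  classical
  rw [List.perm_iff_count]
  intro j
  rw [h, count_idxList]

theorem length_idxList (α : Fin n →₀ ℕ) : (idxList α).length = α.degree := by
  unfold idxList
  rw [List.length_flatMap]
  have : (List.map (fun i => (List.replicate (α i) i).length) (List.finRange n)).sum
      = ∑ i : Fin n, α i := by
    rw [← List.ofFn_eq_map, List.sum_ofFn]
    simp
  rw [this, Finsupp.degree_eq_sum]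

theorem dd_zero (f : Sp n → F) : dd 0 f = f := by
  have : idxList (0 : Fin n →₀ ℕ) = [] := by
    rw [← List.length_eq_zero_iff, length_idxList]
    simp
  simp [dd, this, ddList]

theorem dd_fun_zero (α : Fin n →₀ ℕ) : dd α (fun _ : Sp n => (0 : F)) = fun _ => 0 := by
  suffices ∀ l : List (Fin n), ddList l (fun _ : Sp n => (0 : F)) = fun _ => 0 from this _
  intro l
  induction l with
  | nil => rfl
  | cons i l ih =>
    rw [ddList_cons, ih]
    funext x
    simp [dd1]

variable [CompleteSpace F]

theorem dd1_analytic (i : Fin n) {f : Sp n → F} {x : Sp n} (h : AnalyticAt ℝ f x) :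
    AnalyticAt ℝ (dd1 i f) x :=
  ((ContinuousLinearMap.apply ℝ F (Pi.single i 1 : Sp n)).analyticAt _).comp h.fderiv

theorem ddList_analytic (l : List (Fin n)) {f : Sp n → F} {x : Sp n}
    (h : AnalyticAt ℝ f x) : AnalyticAt ℝ (ddList l f) x := by
  induction l with
  | nil => exact h
  | cons i l ih => exact dd1_analytic i ih

theorem dd_analytic (α : Fin n →₀ ℕ) {f : Sp n → F} {x : Sp n}
    (h : AnalyticAt ℝ f x) : AnalyticAt ℝ (dd α f) x := ddList_analytic _ h

theorem dd1_comm (i j : Fin n) {f : Sp n → F} {x : Sp n} (h : AnalyticAt ℝ f x) :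
    dd1 i (dd1 j f) x = dd1 j (dd1 i f) x := by
  have key : ∀ i j : Fin n, dd1 i (dd1 j f) x =
      fderiv ℝ (fderiv ℝ f) x (Pi.single i 1) (Pi.single j 1) := by
    intro i j
    have hd : DifferentiableAt ℝ (fderiv ℝ f) x := h.fderiv.differentiableAt
    unfold dd1
    rw [fderiv_clm_apply hd (differentiableAt_const _)]
    simp
  rw [key, key]
  exact (ContDiffAt.isSymmSndFDerivAt_of_omega h.contDiffAt).eq _ _

/-- Swaps of neighbours generate all permutations, and each swap is the symmetry of second
derivatives. Equality is needed on a neighbourhood because further derivatives may be applied in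
front. -/
theorem ddList_perm {l l' : List (Fin n)} (hl : l.Perm l') {f : Sp n → F} {x : Sp n}
    (h : AnalyticAt ℝ f x) : ddList l f =ᶠ[𝓝 x] ddList l' f := by
  induction hl with
  | nil => exact EventuallyEq.rfl
  | cons i _ ih => exact dd1_congr i ih
  | swap i j l =>
    filter_upwards [(ddList_analytic l h).eventually_analyticAt] with y hy
    exact dd1_comm j i hy
  | trans _ _ ih1 ih2 => exact ih1.trans ih2

theorem ddList_eq_dd {α : Fin n →₀ ℕ} {l : List (Fin n)} (hl : ∀ j, l.count j = α j)
    {f : Sp n → F} {x : Sp n} (h : AnalyticAt ℝ f x) : ddList l f =ᶠ[𝓝 x] dd α f :=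
  ddList_perm (idxList_perm_of_count hl) h

theorem dd_add (α β : Fin n →₀ ℕ) {f : Sp n → F} {x : Sp n} (h : AnalyticAt ℝ f x) :
    dd (α + β) f =ᶠ[𝓝 x] dd α (dd β f) := by
  have : dd α (dd β f) = ddList (idxList α ++ idxList β) f := (ddList_append _ _ _).symm
  rw [this]
  refine (ddList_eq_dd (fun j => ?_) h).symm
  rw [List.count_append, count_idxList, count_idxList, Finsupp.add_apply]

theorem dd_single (j : Fin n) {f : Sp n → F} {x : Sp n} (h : AnalyticAt ℝ f x) :
    dd (Finsupp.single j 1) f =ᶠ[𝓝 x] dd1 j f := by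
  classical
  refine (ddList_eq_dd (l := [j]) (fun i => ?_) h).symm
  simp [List.count_singleton, Finsupp.single_apply]

theorem dd_add_single (α : Fin n →₀ ℕ) (j : Fin n) {f : Sp n → F} {x : Sp n}
    (h : AnalyticAt ℝ f x) : dd (α + Finsupp.single j 1) f =ᶠ[𝓝 x] dd1 j (dd α f) := by
  rw [add_comm]
  exact (dd_add _ _ h).trans (dd_single j (dd_analytic α h))

theorem dd_add_single' (α : Fin n →₀ ℕ) (j : Fin n) {f : Sp n → F} {x : Sp n}
    (h : AnalyticAt ℝ f x) : dd (α + Finsupp.single j 1) f =ᶠ[𝓝 x] dd α (dd1 j f) :=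
  (dd_add _ _ h).trans (dd_congr α (dd_single j h))

theorem ddList_fun_add (l : List (Fin n)) {f g : Sp n → F} {x : Sp n}
    (hf : AnalyticAt ℝ f x) (hg : AnalyticAt ℝ g x) :
    ddList l (fun y => f y + g y) =ᶠ[𝓝 x] fun y => ddList l f y + ddList l g y := by
  induction l with
  | nil => exact EventuallyEq.rfl
  | cons i l ih =>
    refine (dd1_congr i ih).trans ?_
    filter_upwards [(ddList_analytic l hf).eventually_analyticAt,
      (ddList_analytic l hg).eventually_analyticAt] with y h1 h2
    simp only [dd1, ddList_cons]
    rw [fderiv_fun_add h1.differentiableAt h2.differentiableAt]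
    rfl

theorem dd_fun_add (α : Fin n →₀ ℕ) {f g : Sp n → F} {x : Sp n}
    (hf : AnalyticAt ℝ f x) (hg : AnalyticAt ℝ g x) :
    dd α (fun y => f y + g y) =ᶠ[𝓝 x] fun y => dd α f y + dd α g y :=
  ddList_fun_add _ hf hg

theorem dd_fun_sum {ι : Type*} (s : Finset ι) (α : Fin n →₀ ℕ) {f : ι → Sp n → F} {x : Sp n}
    (hf : ∀ i ∈ s, AnalyticAt ℝ (f i) x) :
    dd α (fun y => ∑ i ∈ s, f i y) =ᶠ[𝓝 x] fun y => ∑ i ∈ s, dd α (f i) y := by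
  classical
  induction s using Finset.induction_on with
  | empty => simp [dd_fun_zero]
  | insert a s ha ih =>
    simp only [Finset.sum_insert ha]
    have h1 := hf a (Finset.mem_insert_self a s)
    have h2 : ∀ i ∈ s, AnalyticAt ℝ (f i) x := fun i hi => hf i (Finset.mem_insert_of_mem hi)
    refine (dd_fun_add α h1 (Finset.analyticAt_fun_sum s h2)).trans ?_
    filter_upwards [ih h2] with y hy
    rw [hy]

/-- Partial derivatives commute with continuous linear maps of the values. -/
theorem dd_clm_comp {F' : Type*} [NormedAddCommGroup F'] [NormedSpace ℝ F']
    (α : Fin n →₀ ℕ) (L : F →L[ℝ] F') {f : Sp n → F} {x : Sp n} (hf : AnalyticAt ℝ f x) :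
    dd α (fun y => L (f y)) =ᶠ[𝓝 x] fun y => L (dd α f y) := by
  suffices ∀ l : List (Fin n), ddList l (fun y => L (f y)) =ᶠ[𝓝 x] fun y => L (ddList l f y)
    from this _
  intro l
  induction l with
  | nil => exact EventuallyEq.rfl
  | cons i l ih =>
    refine (dd1_congr i ih).trans ?_
    filter_upwards [(ddList_analytic l hf).eventually_analyticAt] with y h1
    simp only [dd1, ddList_cons]
    have := fderiv_comp y L.differentiableAt h1.differentiableAt
    rw [ContinuousLinearMap.fderiv] at this
    change fderiv ℝ (L ∘ ddList l f) y _ = _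
    rw [this]
    rfl

theorem dd_apply (α : Fin n →₀ ℕ) {f : Sp n → Sp n} {x : Sp n} (hf : AnalyticAt ℝ f x)
    (i : Fin n) : dd α (fun y => f y i) =ᶠ[𝓝 x] fun y => dd α f y i :=
  dd_clm_comp α (ContinuousLinearMap.proj (R := ℝ) (φ := fun _ : Fin n => ℝ) i) hf

theorem dd_const_mul (α : Fin n →₀ ℕ) (c : ℝ) {f : Sp n → ℝ} {x : Sp n}
    (hf : AnalyticAt ℝ f x) : dd α (fun y => c * f y) =ᶠ[𝓝 x] fun y => c * dd α f y :=
  dd_clm_comp α (c • ContinuousLinearMap.id ℝ ℝ) hf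

end Calculus

/-! ### Taylor series of products and Leibniz' rule -/

section Leibniz

variable {n : ℕ}

theorem mfact_ne_zero (α : Fin n →₀ ℕ) : (mfact α : ℝ) ≠ 0 := by
  rw [mfact]
  push_cast
  exact Finset.prod_ne_zero_iff.mpr fun i _ => by positivity

theorem mfact_add_single (α : Fin n →₀ ℕ) (j : Fin n) :
    mfact (α + Finsupp.single j 1) = mfact α * (α j + 1) := by
  classical
  unfold mfact
  rw [← Finset.mul_prod_erase _ _ (Finset.mem_univ j),
    ← Finset.mul_prod_erase _ (fun i => (α i).factorial) (Finset.mem_univ j)]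
  have : ∏ x ∈ Finset.univ.erase j, ((α + Finsupp.single j 1 : Fin n →₀ ℕ) x).factorial
      = ∏ x ∈ Finset.univ.erase j, (α x).factorial := by
    refine Finset.prod_congr rfl fun i hi => ?_
    rw [Finsupp.add_apply, Finsupp.single_eq_of_ne (Finset.ne_of_mem_erase hi), add_zero]
  rw [this, Finsupp.add_apply, Finsupp.single_eq_same, Nat.factorial_succ]
  ring

/-- The Taylor series of a scalar function at `x`. -/
noncomputable def taylorAt (f : Sp n → ℝ) (x : Sp n) : MvPowerSeries (Fin n) ℝ :=
  (fun α => dd α f x / (mfact α : ℝ) : (Fin n →₀ ℕ) → ℝ)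

theorem coeff_taylorAt (f : Sp n → ℝ) (x : Sp n) (α : Fin n →₀ ℕ) :
    MvPowerSeries.coeff α (taylorAt f x) = dd α f x / (mfact α : ℝ) := rfl

theorem pderiv_taylorAt (j : Fin n) {f : Sp n → ℝ} {x : Sp n} (hf : AnalyticAt ℝ f x) :
    MvPowerSeries.pderiv ℝ j (taylorAt f x) = taylorAt (dd1 j f) x := by
  ext α
  rw [MvPowerSeries.coeff_pderiv, coeff_taylorAt, coeff_taylorAt, mfact_add_single,
    (dd_add_single' α j hf).self_of_nhds]
  have := mfact_ne_zero α
  have h2 : ((α j : ℝ) + 1) ≠ 0 := by positivity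
  push_cast
  field_simp

theorem dd1_mul (j : Fin n) {f g : Sp n → ℝ} {x : Sp n} (hf : AnalyticAt ℝ f x)
    (hg : AnalyticAt ℝ g x) :
    dd1 j (fun y => f y * g y) =ᶠ[𝓝 x] fun y => f y * dd1 j g y + g y * dd1 j f y := by
  filter_upwards [hf.eventually_analyticAt, hg.eventually_analyticAt] with y h1 h2
  simp only [dd1]
  rw [fderiv_fun_mul h1.differentiableAt h2.differentiableAt]
  rfl

theorem exists_eq_add_single {α : Fin n →₀ ℕ} (h : α ≠ 0) :
    ∃ (β : Fin n →₀ ℕ) (j : Fin n), α = β + Finsupp.single j 1 := by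
  classical
  obtain ⟨j, hj⟩ := Finsupp.ne_iff.mp h
  refine ⟨α - Finsupp.single j 1, j, ?_⟩
  rw [tsub_add_cancel_of_le]
  rw [Finsupp.single_le_iff]
  exact Nat.one_le_iff_ne_zero.mpr hj

theorem degree_add_single (α : Fin n →₀ ℕ) (j : Fin n) :
    (α + Finsupp.single j 1).degree = α.degree + 1 := by
  rw [map_add, Finsupp.degree_single]

/-- Taylor series are multiplicative. -/
theorem taylorAt_mul {f g : Sp n → ℝ} {x : Sp n} (hf : AnalyticAt ℝ f x)
    (hg : AnalyticAt ℝ g x) :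
    taylorAt (fun y => f y * g y) x = taylorAt f x * taylorAt g x := by
  suffices ∀ (m : ℕ) (α : Fin n →₀ ℕ) (f g : Sp n → ℝ), AnalyticAt ℝ f x → AnalyticAt ℝ g x →
      α.degree = m → MvPowerSeries.coeff α (taylorAt (fun y => f y * g y) x)
        = MvPowerSeries.coeff α (taylorAt f x * taylorAt g x) by
    ext α
    exact this _ α f g hf hg rfl
  intro m
  induction m with
  | zero =>
    intro α f g hf hg h
    have h0 : α = 0 := (Finsupp.degree_eq_zero_iff α).mp h
    subst h0
    classical
    rw [MvPowerSeries.coeff_mul]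
    simp [coeff_taylorAt, dd_zero, mfact]
  | succ m ih =>
    intro α f g hf hg h
    have h0 : α ≠ 0 := by
      rintro rfl
      simp at h
    obtain ⟨β, j, rfl⟩ := exists_eq_add_single h0
    have hβ : β.degree = m := by
      rw [degree_add_single] at h
      omega
    have h2 : ((β j : ℝ) + 1) ≠ 0 := by positivity
    -- Multiplication by `β j + 1` turns the coefficient at `β + e_j` into the coefficient at `β` of
    -- the formal derivative along `j`; the product rule then lowers the degree.
    refine mul_right_cancel₀ h2 ?_
    rw [← MvPowerSeries.coeff_pderiv, ← MvPowerSeries.coeff_pderiv,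
      pderiv_taylorAt j (f := fun y => f y * g y) (hf.mul hg), Derivation.leibniz, pderiv_taylorAt j hf,
      pderiv_taylorAt j hg, smul_eq_mul, smul_eq_mul, map_add,
      ← ih β f _ hf (dd1_analytic j hg) hβ, ← ih β g _ hg (dd1_analytic j hf) hβ]
    simp only [coeff_taylorAt]
    rw [((dd_congr β (dd1_mul j hf hg)).trans (dd_fun_add β (hf.mul (dd1_analytic j hg))
      (hg.mul (dd1_analytic j hf)))).self_of_nhds, add_div]

/-- The multinomial coefficient in Leibniz' rule. -/
noncomputable def leibCoef (δ ε : Fin n →₀ ℕ) : ℝ := (mfact (δ + ε) : ℝ) / (mfact δ * mfact ε)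

/-- Leibniz' rule. -/
theorem dd_mul (γ : Fin n →₀ ℕ) {f g : Sp n → ℝ} {x : Sp n} (hf : AnalyticAt ℝ f x)
    (hg : AnalyticAt ℝ g x) :
    dd γ (fun y => f y * g y) x
      = ∑ p ∈ Finset.HasAntidiagonal.antidiagonal γ, leibCoef p.1 p.2 * dd p.1 f x * dd p.2 g x := by
  classical
  have h := congrArg (MvPowerSeries.coeff γ) (taylorAt_mul hf hg)
  rw [MvPowerSeries.coeff_mul, coeff_taylorAt, div_eq_iff (mfact_ne_zero γ), Finset.sum_mul] at h
  rw [h]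
  refine Finset.sum_congr rfl fun p hp => ?_
  rw [coeff_taylorAt, coeff_taylorAt, leibCoef, Finset.HasAntidiagonal.mem_antidiagonal.mp hp]
  have := mfact_ne_zero p.1
  have := mfact_ne_zero p.2
  field_simp

end Leibniz

/-! ### Partial derivatives and convergent power series -/

section PowerSeries

variable {n : ℕ}

/-- The multi-index of a sequence of directions. -/
noncomputable def seqIdx {m : ℕ} (j : Fin m → Fin n) : Fin n →₀ ℕ := ∑ i, Finsupp.single (j i) 1

theorem seqIdx_degree {m : ℕ} (j : Fin m → Fin n) : (seqIdx j).degree = m := by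
  simp [seqIdx, map_sum]

theorem count_ofFn {m : ℕ} (j : Fin m → Fin n) (i : Fin n) :
    (List.ofFn j).count i = seqIdx j i := by
  classical
  rw [seqIdx, Finsupp.finsetSum_apply]
  induction m with
  | zero => simp
  | succ m ih =>
    rw [List.ofFn_succ, List.count_cons, ih, Fin.sum_univ_succ, add_comm]
    simp [Finsupp.single_apply]

theorem seqIdx_comp_perm {m : ℕ} (j : Fin m → Fin n) (σ : Equiv.Perm (Fin m)) :
    seqIdx (j ∘ σ) = seqIdx j :=
  Equiv.sum_comp σ fun i => Finsupp.single (j i) 1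

theorem exists_seqIdx (α : Fin n →₀ ℕ) : ∃ j : Fin α.degree → Fin n, seqIdx j = α := by
  classical
  refine ⟨fun i => (idxList α).get (i.cast (length_idxList α).symm), ?_⟩
  ext i
  rw [← count_ofFn, ← count_idxList α i]
  congr 1
  refine List.ext_get ?_ ?_
  · simp [length_idxList]
  · intro p h1 h2
    simp

variable {F : Type*} [NormedAddCommGroup F] [NormedSpace ℝ F] [CompleteSpace F]

theorem ddList_ofFn_eq {m : ℕ} (j : Fin m → Fin n) {f : Sp n → F} {x : Sp n}
    (hf : AnalyticAt ℝ f x) :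
    ddList (List.ofFn j) f =ᶠ[𝓝 x] fun y =>
      iteratedFDeriv ℝ m f y fun i => Pi.single (j i) (1 : ℝ) := by
  induction m with
  | zero =>
    refine Eventually.of_forall fun y => ?_
    simp [ddList]
  | succ m ih =>
    rw [List.ofFn_succ, ddList_cons]
    refine (dd1_congr _ (ih fun i => j i.succ)).trans ?_
    filter_upwards [hf.eventually_analyticAt] with y hy
    rw [iteratedFDeriv_succ_apply_left]
    have hd : DifferentiableAt ℝ (iteratedFDeriv ℝ m f) y :=
      (hy.contDiffAt (n := ⊤)).differentiableAt_iteratedFDeriv (by simp)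
    simp only [dd1]
    set v : Fin m → Sp n := fun i => Pi.single (j i.succ) (1 : ℝ) with hv
    have h1 := ((ContinuousMultilinearMap.apply ℝ (fun _ : Fin m => Sp n) F v).hasFDerivAt.comp y
      hd.hasFDerivAt).fderiv
    have h2 : fderiv ℝ (fun y => iteratedFDeriv ℝ m f y v) y = _ := h1
    rw [h2]
    rfl

/-- The bridge to Fréchet derivatives, through which results on convergent power series apply to
partial derivatives. -/
theorem dd_seqIdx {m : ℕ} (j : Fin m → Fin n) {f : Sp n → F} {x : Sp n}
    (hf : AnalyticAt ℝ f x) :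
    dd (seqIdx j) f x = iteratedFDeriv ℝ m f x fun i => Pi.single (j i) (1 : ℝ) := by
  refine Eq.trans ?_ (ddList_ofFn_eq j hf).self_of_nhds
  exact (ddList_eq_dd (count_ofFn j) hf).symm.self_of_nhds

/-- Cauchy's estimates. -/
theorem exists_dd_bound {f : Sp n → F} {x : Sp n} (hf : AnalyticAt ℝ f x) :
    ∃ C σ : ℝ, 0 < C ∧ 0 < σ ∧
      ∀ α : Fin n →₀ ℕ, ‖dd α f x‖ ≤ C * σ ^ α.degree * (α.degree.factorial : ℝ) := by
  obtain ⟨p, r, hp⟩ := hf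
  obtain ⟨C, σ, hC, hσ, hb⟩ := p.le_mul_pow_of_radius_pos hp.radius_pos
  refine ⟨C, σ, hC, hσ, fun α => ?_⟩
  obtain ⟨j, hj⟩ := exists_seqIdx α
  rw [← hj, seqIdx_degree, dd_seqIdx j hp.analyticAt,
    hp.iteratedFDeriv_eq_sum_of_completeSpace]
  -- The derivative of order m is the sum of the m-th term of the series over all permutations of
  -- the arguments; these m! summands produce the factorial.
  refine (norm_sum_le _ _).trans ?_
  have : ∀ τ ∈ (Finset.univ : Finset (Equiv.Perm (Fin α.degree))),
      ‖p α.degree fun i => (Pi.single (j (τ i)) (1 : ℝ) : Sp n)‖ ≤ C * σ ^ α.degree := by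
    intro τ _
    refine ((p α.degree).le_opNorm _).trans ?_
    have h1 : ∏ i, ‖(Pi.single (j (τ i)) (1 : ℝ) : Sp n)‖ = 1 := by
      refine Finset.prod_eq_one fun i _ => ?_
      rw [Pi.norm_single, norm_one]
    rw [h1, mul_one]
    exact hb _
  refine (Finset.sum_le_sum this).trans ?_
  rw [Finset.sum_const, Finset.card_univ, Fintype.card_perm, Fintype.card_fin, nsmul_eq_mul]
  linarith

/-- The iterated derivatives vanish on basis vectors, hence identically; so every term of the power
series vanishes on the diagonal. -/
theorem eventually_eq_zero_of_dd {f : Sp n → F} {x : Sp n} (hf : AnalyticAt ℝ f x)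
    (h : ∀ α, dd α f x = 0) : ∀ᶠ y in 𝓝 x, f y = 0 := by
  have hz : ∀ m, iteratedFDeriv ℝ m f x = 0 := by
    intro m
    apply ContinuousMultilinearMap.toMultilinearMap_injective
    refine Module.Basis.ext_multilinear (fun _ => Pi.basisFun ℝ (Fin n)) fun j => ?_
    have := dd_seqIdx j hf
    rw [h] at this
    simpa [Pi.basisFun_apply] using this.symm
  obtain ⟨p, r, hp⟩ := hf
  have h2 : ∀ y : Sp n, ∀ m, (p m fun _ => y) = 0 := by
    intro y m
    have := hp.factorial_smul y m
    rw [hz] at this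
    have h3 : (m.factorial : ℝ) • (p m fun _ => y) = 0 := by
      rw [Nat.cast_smul_eq_nsmul]
      exact this
    exact (smul_eq_zero.mp h3).resolve_left (by positivity)
  have hb := Metric.eball_mem_nhds x hp.r_pos
  filter_upwards [hb] with y hy
  have h4 : y - x ∈ Metric.eball (0 : Sp n) r := by
    simpa [edist_eq_enorm_sub] using hy
  have := hp.hasSum h4
  simp only [h2] at this
  rw [add_sub_cancel] at this
  exact this.unique hasSum_zero

/-- The homogeneous parts of a power series with given partial derivatives at the origin. -/
noncomputable def seriesOf (U : (Fin n →₀ ℕ) → ℝ) : FormalMultilinearSeries ℝ (Sp n) ℝ :=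
  fun m => ((m.factorial : ℝ)⁻¹) • ∑ j : Fin m → Fin n, U (seqIdx j) •
    (ContinuousMultilinearMap.mkPiAlgebra ℝ (Fin m) ℝ).compContinuousLinearMap
      fun i => ContinuousLinearMap.proj (R := ℝ) (φ := fun _ : Fin n => ℝ) (j i)

theorem seriesOf_apply (U : (Fin n →₀ ℕ) → ℝ) (m : ℕ) (v : Fin m → Sp n) :
    seriesOf U m v = ((m.factorial : ℝ)⁻¹) * ∑ j : Fin m → Fin n, U (seqIdx j) * ∏ i, v i (j i) := by
  simp [seriesOf]

theorem seriesOf_single (U : (Fin n →₀ ℕ) → ℝ) {m : ℕ} (l : Fin m → Fin n) :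
    (seriesOf U m fun i => Pi.single (l i) (1 : ℝ)) = ((m.factorial : ℝ)⁻¹) * U (seqIdx l) := by
  classical
  rw [seriesOf_apply, Finset.sum_eq_single l]
  · simp
  · intro j _ hj
    obtain ⟨i, hi⟩ := Function.ne_iff.mp hj
    rw [Finset.prod_eq_zero (Finset.mem_univ i), mul_zero]
    rw [Pi.single_apply, if_neg hi]
  · simp

/-- The n^m sequences of directions account for the rate `n * s`; the factorial in the hypothesis
cancels the one in `seriesOf`. -/
theorem norm_seriesOf_le {U : (Fin n →₀ ℕ) → ℝ} {C s : ℝ} (hC : 0 ≤ C) (hs : 0 ≤ s)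
    (hU : ∀ α, |U α| ≤ C * s ^ α.degree * (α.degree.factorial : ℝ)) (m : ℕ) :
    ‖seriesOf U m‖ ≤ C * (n * s) ^ m := by
  refine ContinuousMultilinearMap.opNorm_le_bound (by positivity) fun v => ?_
  rw [seriesOf_apply, norm_mul, norm_inv, Real.norm_natCast]
  have h1 : ‖∑ j : Fin m → Fin n, U (seqIdx j) * ∏ i, v i (j i)‖
      ≤ ∑ _j : Fin m → Fin n, C * s ^ m * (m.factorial : ℝ) * ∏ i, ‖v i‖ := by
    refine (norm_sum_le _ _).trans (Finset.sum_le_sum fun j _ => ?_)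
    rw [norm_mul, norm_prod]
    have := hU (seqIdx j)
    rw [seqIdx_degree] at this
    refine mul_le_mul this (Finset.prod_le_prod (fun i _ => norm_nonneg _) fun i _ =>
      norm_le_pi_norm _ _) (Finset.prod_nonneg fun i _ => norm_nonneg _) (by positivity)
  rw [Finset.sum_const, Finset.card_univ, Fintype.card_fun, Fintype.card_fin, Fintype.card_fin,
    nsmul_eq_mul] at h1
  have h2 : (0 : ℝ) < m.factorial := by positivity
  calc (m.factorial : ℝ)⁻¹ * ‖∑ j : Fin m → Fin n, U (seqIdx j) * ∏ i, v i (j i)‖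
      ≤ (m.factorial : ℝ)⁻¹ * (((n ^ m : ℕ) : ℝ) * (C * s ^ m * (m.factorial : ℝ) * ∏ i, ‖v i‖)) := by
        gcongr
    _ = C * (n * s) ^ m * ∏ i, ‖v i‖ := by
        push_cast
        rw [mul_pow]
        field_simp

/-- Numbers of at most geometric growth are the partial derivatives at the origin of an analytic
function. -/
theorem exists_analytic_dd_eq {U : (Fin n →₀ ℕ) → ℝ} {C s : ℝ}
    (hU : ∀ α, |U α| ≤ C * s ^ α.degree * (α.degree.factorial : ℝ)) (hC : 0 ≤ C) (hs : 0 ≤ s) :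
    ∃ f : Sp n → ℝ, AnalyticAt ℝ f 0 ∧ ∀ α, dd α f 0 = U α := by
  have hr : 0 < (seriesOf U).radius := by
    have hpos : (0 : ℝ) < (n * s + 1)⁻¹ := by positivity
    obtain ⟨t, ht⟩ : ∃ t : NNReal, (t : ℝ) = (n * s + 1)⁻¹ := ⟨_, Real.coe_toNNReal _ hpos.le⟩
    refine lt_of_lt_of_le (b := (t : ENNReal)) ?_ ((seriesOf U).le_radius_of_bound C fun m => ?_)
    · rw [ENNReal.coe_pos, ← NNReal.coe_pos, ht]
      exact hpos
    · refine (mul_le_mul_of_nonneg_right (norm_seriesOf_le hC hs hU m) (by positivity)).trans ?_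
      rw [ht]
      rw [mul_assoc, ← mul_pow]
      refine mul_le_of_le_one_right hC (pow_le_one₀ (by positivity) ?_)
      rw [← div_eq_mul_inv, div_le_one (by positivity)]
      linarith
  have hp := (seriesOf U).hasFPowerSeriesOnBall hr
  refine ⟨_, hp.analyticAt, fun α => ?_⟩
  obtain ⟨j, hj⟩ := exists_seqIdx α
  have h1 := dd_seqIdx j hp.analyticAt
  rw [hj] at h1
  rw [h1, hp.iteratedFDeriv_eq_sum_of_completeSpace]
  have : ∀ τ ∈ (Finset.univ : Finset (Equiv.Perm (Fin α.degree))),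
      (seriesOf U α.degree fun i => (Pi.single (j (τ i)) (1 : ℝ) : Sp n))
        = ((α.degree.factorial : ℝ)⁻¹) * U α := by
    intro τ _
    rw [seriesOf_single U fun i => j (τ i)]
    have := seqIdx_comp_perm j τ
    rw [hj] at this
    have h2 : (seqIdx fun i => j (τ i)) = α := this
    rw [h2]
  rw [Finset.sum_congr rfl this, Finset.sum_const, Finset.card_univ, Fintype.card_perm,
    Fintype.card_fin, nsmul_eq_mul, ← mul_assoc, mul_inv_cancel₀ (by positivity), one_mul]

end PowerSeries

/-! ### Orderly weights on derivatives -/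

/-- The position `(α, i)` stands for the derivative `∂^α` of the `i`-th component. -/
abbrev Pos (n : ℕ) : Type := (Fin n →₀ ℕ) × Fin n

/-- The variable `l` is multiplicative for `α`: no variable before `l` occurs in `α`. -/
def Mult {n : ℕ} (α : Fin n →₀ ℕ) (l : Fin n) : Prop := ∀ j, j < l → α j = 0

section Weights

variable {n : ℕ}

/-- Weights of derivatives, compatible with order and class. -/
structure IsWeight (k : ℕ) (ν : (Fin n →₀ ℕ) →+ ℕ) (μ : Pos n → ℕ) : Prop where
  add : ∀ (α γ : Fin n →₀ ℕ) (i : Fin n), μ (α + γ, i) = μ (α, i) + ν γ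
  inj : ∀ a b : Pos n, a.1.degree ≤ k → b.1.degree ≤ k → μ a = μ b → a = b
  lt_of_degree_lt : ∀ a b : Pos n, b.1.degree < a.1.degree → a.1.degree ≤ k + 1 → μ b < μ a
  lt_of_mult : ∀ (a b : Pos n) (l : Fin n), a.1.degree = k → b.1.degree = k → Mult a.1 l →
    ¬ Mult b.1 l → μ b < μ a
  gap : ∀ (a b : Pos n) (δ : Fin n →₀ ℕ), a.1.degree = k → b.1.degree ≤ k → δ ≠ 0 →
    μ b + δ.degree + 1 ≤ μ a + ν δ

/-- The value in base `B` of a multi-index. -/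
noncomputable def baseVal (n B : ℕ) : (Fin n →₀ ℕ) →+ ℕ where
  toFun α := ∑ l, B ^ (n - 1 - l.val) * α l
  map_zero' := by simp
  map_add' := by
    intro α β
    simp [mul_add, Finset.sum_add_distrib]

theorem baseVal_apply (B : ℕ) (α : Fin n →₀ ℕ) :
    baseVal n B α = ∑ l, B ^ (n - 1 - l.val) * α l := rfl

/-- Comparison in base B is lexicographic with the first variable most significant: the digits of α
after `j` add up to at most k < B, so they cannot make up for one unit at `j`. -/
theorem baseVal_lt {k B : ℕ} (hB : k < B) {α β : Fin n →₀ ℕ} (hα : α.degree ≤ k) {j : Fin n}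
    (h1 : ∀ l, l < j → α l = β l) (h2 : α j < β j) : baseVal n B α < baseVal n B β := by
  classical
  have split : ∀ γ : Fin n →₀ ℕ, baseVal n B γ
      = ∑ l ∈ Finset.univ.filter (· < j), B ^ (n - 1 - l.val) * γ l
        + (B ^ (n - 1 - j.val) * γ j
        + ∑ l ∈ Finset.univ.filter (j < ·), B ^ (n - 1 - l.val) * γ l) := by
    intro γ
    rw [baseVal_apply, ← Finset.sum_filter_add_sum_filter_not Finset.univ (· < j)]
    congr 1
    have : Finset.univ.filter (fun l : Fin n => ¬ l < j)
        = insert j (Finset.univ.filter (j < ·)) := by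
      ext l
      simp only [Finset.mem_filter, Finset.mem_univ, true_and, Finset.mem_insert, not_lt]
      rw [le_iff_eq_or_lt]
      exact ⟨fun h => h.imp Eq.symm id, fun h => h.imp Eq.symm id⟩
    rw [this, Finset.sum_insert (by simp)]
  rw [split α, split β]
  have e1 : ∑ l ∈ Finset.univ.filter (· < j), B ^ (n - 1 - l.val) * α l
      = ∑ l ∈ Finset.univ.filter (· < j), B ^ (n - 1 - l.val) * β l :=
    Finset.sum_congr rfl fun l hl => by rw [h1 l (Finset.mem_filter.mp hl).2]
  have e2 : B * ∑ l ∈ Finset.univ.filter (j < ·), B ^ (n - 1 - l.val) * α l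
      ≤ B ^ (n - 1 - j.val) * k := by
    rw [Finset.mul_sum]
    calc ∑ l ∈ Finset.univ.filter (j < ·), B * (B ^ (n - 1 - l.val) * α l)
        ≤ ∑ l ∈ Finset.univ.filter (j < ·), B ^ (n - 1 - j.val) * α l := by
          refine Finset.sum_le_sum fun l hl => ?_
          rw [← mul_assoc, ← pow_succ']
          have hl' : j.val < l.val := (Finset.mem_filter.mp hl).2
          have := l.isLt
          exact Nat.mul_le_mul_right _ (Nat.pow_le_pow_right (by omega) (by omega))
      _ ≤ B ^ (n - 1 - j.val) * k := by
          rw [← Finset.mul_sum]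
          refine Nat.mul_le_mul_left _ (le_trans ?_ hα)
          rw [Finsupp.degree_eq_sum]
          exact Finset.sum_le_sum_of_subset (Finset.filter_subset _ _)
  have e3 : ∑ l ∈ Finset.univ.filter (j < ·), B ^ (n - 1 - l.val) * α l < B ^ (n - 1 - j.val) := by
    have hp : 0 < B ^ (n - 1 - j.val) := Nat.pow_pos (by omega)
    by_contra hcon
    push Not at hcon
    have : B * B ^ (n - 1 - j.val) ≤ B ^ (n - 1 - j.val) * k :=
      (Nat.mul_le_mul_left B hcon).trans e2
    rw [mul_comm] at this
    have := Nat.le_of_mul_le_mul_left this hp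
    omega
  have e4 : B ^ (n - 1 - j.val) * α j + B ^ (n - 1 - j.val) ≤ B ^ (n - 1 - j.val) * β j := by
    rw [← Nat.mul_succ]
    exact Nat.mul_le_mul_left _ h2
  omega

theorem baseVal_le {B : ℕ} (hB : 0 < B) (α : Fin n →₀ ℕ) :
    baseVal n B α ≤ B ^ n * α.degree := by
  rw [baseVal_apply, Finsupp.degree_eq_sum, Finset.mul_sum]
  refine Finset.sum_le_sum fun l _ => Nat.mul_le_mul_right _ (Nat.pow_le_pow_right hB ?_)
  omega

theorem exists_min_ne {α β : Fin n →₀ ℕ} (h : ∃ j, α j ≠ β j) :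
    ∃ j, α j ≠ β j ∧ ∀ l, l < j → α l = β l := by
  classical
  obtain ⟨j, hj⟩ := h
  have hne : (Finset.univ.filter fun j => α j ≠ β j).Nonempty := ⟨j, by simpa using hj⟩
  refine ⟨_, (Finset.mem_filter.mp (Finset.min'_mem _ hne)).2, fun l hl => ?_⟩
  by_contra hcon
  exact absurd (Finset.min'_le _ l (by simpa using hcon)) (not_le.mpr hl)

/-- The weight is `H * |α| - n * e α + i`: order dominates, then reverse lexicographic comparison
through the base value `e`, then the component. A factor before the variable `l` raises `e` and so
lowers the weight, which gives compatibility with class. -/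
theorem exists_isWeight (n k : ℕ) :
    ∃ (ν : (Fin n →₀ ℕ) →+ ℕ) (μ : Pos n → ℕ), IsWeight k ν μ := by
  classical
  set B := k + 2 with hB
  set E := B ^ n with hE
  -- `H` exceeds the variation of the lower terms up to order k+1, and the surplus also leaves room
  -- for the summand `δ.degree + 1` of the gap condition.
  set H := n * E * (1 + k) + n + 2 with hH
  set e := baseVal n B with he
  let ν : (Fin n →₀ ℕ) →+ ℕ :=
    { toFun := fun γ => ∑ l, (H - n * B ^ (n - 1 - l.val)) * γ l
      map_zero' := by simp
      map_add' := by
        intro α β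
        simp [mul_add, Finset.sum_add_distrib] }
  have hν : ∀ γ, ν γ + n * e γ = H * γ.degree := by
    intro γ
    change (∑ l, (H - n * B ^ (n - 1 - l.val)) * γ l) + n * e γ = _
    rw [he, baseVal_apply, Finset.mul_sum, ← Finset.sum_add_distrib, Finsupp.degree_eq_sum,
      Finset.mul_sum]
    refine Finset.sum_congr rfl fun l _ => ?_
    rw [← mul_assoc, ← add_mul, Nat.sub_add_cancel]
    have h1 : B ^ (n - 1 - l.val) ≤ E := Nat.pow_le_pow_right (by omega) (by omega)
    calc n * B ^ (n - 1 - l.val) ≤ n * E := Nat.mul_le_mul_left _ h1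
      _ ≤ H := by rw [hH]; nlinarith
  have heE : ∀ γ, n * e γ ≤ n * E * γ.degree := by
    intro γ
    rw [mul_assoc]
    exact Nat.mul_le_mul_left _ (baseVal_le (by omega) γ)
  have hord : ∀ a b : Pos n, b.1.degree < a.1.degree → a.1.degree ≤ k + 1 →
      ν b.1 + b.2.val < ν a.1 + a.2.val := by
    intro a b h1 h2
    have ha := hν a.1
    have hb := hν b.1
    have ha' := heE a.1
    have h3 : H * b.1.degree + H ≤ H * a.1.degree := by
      rw [← Nat.mul_succ]
      exact Nat.mul_le_mul_left _ h1
    have h4 : n * E * a.1.degree ≤ n * E * (1 + k) := Nat.mul_le_mul_left _ (by omega)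
    have := b.2.isLt
    omega
  have hlex : ∀ a b : Pos n, a.1.degree = b.1.degree → e a.1 < e b.1 →
      ν b.1 + b.2.val < ν a.1 + a.2.val := by
    intro a b h1 h2
    have ha := hν a.1
    have hb := hν b.1
    rw [h1] at ha
    have h3 : n * e a.1 + n ≤ n * e b.1 := by
      rw [← Nat.mul_succ]
      exact Nat.mul_le_mul_left _ h2
    have := b.2.isLt
    omega
  refine ⟨ν, fun a => ν a.1 + a.2.val, ?_, ?_, hord, ?_, ?_⟩
  · intro α γ i
    simp only [map_add]
    omega
  · intro a b ha hb h
    by_cases hd : a.1.degree = b.1.degree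
    · have h1 : a.1 = b.1 := by
        by_contra hne
        obtain ⟨j, hj, hj'⟩ := exists_min_ne (Finsupp.ne_iff.mp hne)
        rcases lt_or_gt_of_ne hj with hlt | hlt
        · have := hlex a b hd (baseVal_lt (by omega) ha hj' hlt)
          omega
        · have := hlex b a hd.symm (baseVal_lt (by omega) hb (fun l hl => (hj' l hl).symm) hlt)
          omega
      refine Prod.ext h1 (Fin.ext ?_)
      simp only [h1] at h
      omega
    · rcases lt_or_gt_of_ne hd with hlt | hlt
      · have := hord b a hlt (by omega)
        omega
      · have := hord a b hlt (by omega)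
        omega
  · intro a b l ha hb h1 h2
    refine hlex a b (ha.trans hb.symm) ?_
    unfold Mult at h2
    push Not at h2
    obtain ⟨j0, hj0, hb0⟩ := h2
    have hex : ∃ j, b.1 j ≠ (0 : Fin n →₀ ℕ) j := ⟨j0, by simpa using hb0⟩
    obtain ⟨j, hj, hj'⟩ := exists_min_ne hex
    have hjl : j < l := by
      by_contra hcon
      push Not at hcon
      exact hb0 (by simpa using hj' j0 (lt_of_lt_of_le hj0 hcon))
    have h3 : b.1 j ≠ 0 := by simpa using hj
    refine baseVal_lt (k := k) (by omega) ha.le (j := j) (fun i hi => ?_) ?_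
    · rw [h1 i (hi.trans hjl)]
      simpa using (hj' i hi).symm
    · rw [h1 j hjl]
      exact Nat.pos_of_ne_zero h3
  · intro a b δ ha hb hδ
    have h1 : 0 < δ.degree := by
      rw [Nat.pos_iff_ne_zero, Ne, Finsupp.degree_eq_zero_iff]
      exact hδ
    have ea := hν a.1
    have eb := hν b.1
    have ed := hν δ
    have ea' := heE a.1
    have ed' := heE δ
    rw [ha] at ea ea'
    have h2 : H * b.1.degree ≤ H * k := Nat.mul_le_mul_left _ hb
    have h3 : n * E * δ.degree + n * E * k + n + δ.degree + 1 ≤ H * δ.degree := by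
      rw [hH]
      have : n * E * k ≤ n * E * k * δ.degree := Nat.le_mul_of_pos_right _ h1
      have : n ≤ n * δ.degree := Nat.le_mul_of_pos_right _ h1
      nlinarith
    have := b.2.isLt
    omega

end Weights

/-! ### Echelon forms with respect to a weight -/

section Echelon

variable {I : Type*}

/-- The pivots of a space of functions: the positions of the first nonzero values. -/
def pivots (μ : I → ℕ) (E : Submodule ℝ (I → ℝ)) : Set I :=
  {a | ∃ u ∈ E, u a ≠ 0 ∧ ∀ b, μ b < μ a → u b = 0}

/-- The functions that vanish on a given set. -/
def vanishOn (Z : Set I) : Submodule ℝ (I → ℝ) where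
  carrier := {u | ∀ z ∈ Z, u z = 0}
  add_mem' := by
    intro u v hu hv z hz
    rw [Pi.add_apply, hu z hz, hv z hz, add_zero]
  zero_mem' := fun _ _ => rfl
  smul_mem' := by
    intro c u hu z hz
    rw [Pi.smul_apply, hu z hz, smul_zero]

theorem linearIndependent_of_triangular {J : Type*} [Fintype J] {μ : I → ℕ} {w : J → I → ℝ}
    {pos : J → I} (hinj : ∀ a b, μ (pos a) = μ (pos b) → a = b) (h1 : ∀ a, w a (pos a) ≠ 0)
    (h2 : ∀ a i, μ i < μ (pos a) → w a i = 0) : LinearIndependent ℝ w := by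
  classical
  rw [Fintype.linearIndependent_iff]
  intro c hc
  by_contra hcon
  push Not at hcon
  obtain ⟨a0, ha0⟩ := hcon
  obtain ⟨a, ha, hmin⟩ := Finset.exists_min_image (Finset.univ.filter fun a => c a ≠ 0)
    (fun a => μ (pos a)) ⟨a0, by simpa using ha0⟩
  have ha' : c a ≠ 0 := (Finset.mem_filter.mp ha).2
  have := congrFun hc (pos a)
  rw [Finset.sum_apply, Finset.sum_eq_single a] at this
  · rcases mul_eq_zero.mp this with h | h
    · exact ha' h
    · exact h1 a h
  · intro b _ hb
    rw [Pi.smul_apply, smul_eq_mul]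
    by_cases hcb : c b = 0
    · rw [hcb, zero_mul]
    · rw [h2 b (pos a), mul_zero]
      refine lt_of_le_of_ne (hmin b (by simpa using hcb)) fun h => hb (hinj b a h.symm)
  · intro h
    exact absurd (Finset.mem_univ a) h

variable [Fintype I]

theorem exists_pivot {μ : I → ℕ} {E : Submodule ℝ (I → ℝ)} {u : I → ℝ} (hu : u ∈ E)
    (h0 : u ≠ 0) : ∃ a ∈ pivots μ E, u a ≠ 0 ∧ ∀ b, μ b < μ a → u b = 0 := by
  classical
  obtain ⟨a0, ha0⟩ := Function.ne_iff.mp h0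
  obtain ⟨a, ha, hmin⟩ := Finset.exists_min_image (Finset.univ.filter fun a => u a ≠ 0) μ
    ⟨a0, by simpa using ha0⟩
  have ha' : u a ≠ 0 := (Finset.mem_filter.mp ha).2
  have hlt : ∀ b, μ b < μ a → u b = 0 := by
    intro b hb
    by_contra hcon
    exact absurd (hmin b (by simpa using hcon)) (not_le.mpr hb)
  exact ⟨a, ⟨u, hu, ha', hlt⟩, ha', hlt⟩

/-- Since `Z` is a lower set for the weight, a vector whose pivot is outside `Z` vanishes on all of
`Z`. Conversely, a vector of `E` vanishing on `Z` is determined by its values at the pivots outside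
`Z`. -/
theorem finrank_inf_vanishOn {μ : I → ℕ} (hμ : Function.Injective μ) (E : Submodule ℝ (I → ℝ))
    (Z : Set I) (hZ : ∀ a ∈ Z, ∀ b, μ b < μ a → b ∈ Z) :
    Module.finrank ℝ (E ⊓ vanishOn Z : Submodule ℝ (I → ℝ))
      = Nat.card {a : I // a ∈ pivots μ E ∧ a ∉ Z} := by
  classical
  have hfin : Fintype {a : I // a ∈ pivots μ E ∧ a ∉ Z} := Fintype.ofFinite _
  rw [Nat.card_eq_fintype_card]
  refine le_antisymm ?_ ?_
  · let f : (E ⊓ vanishOn Z : Submodule ℝ (I → ℝ)) →ₗ[ℝ]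
        ({a : I // a ∈ pivots μ E ∧ a ∉ Z} → ℝ) :=
      (LinearMap.funLeft ℝ ℝ Subtype.val) ∘ₗ (E ⊓ vanishOn Z).subtype
    have hf : Function.Injective f := by
      rw [← LinearMap.ker_eq_bot, LinearMap.ker_eq_bot']
      intro u hu
      by_contra hne
      have hne' : (u : I → ℝ) ≠ 0 := fun h => hne (Subtype.ext h)
      obtain ⟨a, ha, hua, -⟩ := exists_pivot (μ := μ) u.2.1 hne'
      by_cases haZ : a ∈ Z
      · exact hua (u.2.2 a haZ)
      · exact hua (congrFun hu ⟨a, ha, haZ⟩)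
    have := LinearMap.finrank_le_finrank_of_injective hf
    rwa [Module.finrank_fintype_fun_eq_card] at this
  · choose w hwE hw1 hw2 using fun a : {a : I // a ∈ pivots μ E ∧ a ∉ Z} => a.2.1
    have hli : LinearIndependent ℝ w :=
      linearIndependent_of_triangular (μ := μ) (pos := Subtype.val)
        (fun a b h => Subtype.ext (hμ h)) hw1 hw2
    have hmem : ∀ a, w a ∈ (E ⊓ vanishOn Z : Submodule ℝ (I → ℝ)) := by
      refine fun a => ⟨hwE a, fun z hz => ?_⟩
      rcases lt_trichotomy (μ z) (μ a.1) with h | h | h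
      · exact hw2 a z h
      · exact absurd (hμ h ▸ hz) a.2.2
      · exact absurd (hZ z hz a.1 h) a.2.2
    have hli' : LinearIndependent ℝ fun a =>
        (⟨w a, hmem a⟩ : (E ⊓ vanishOn Z : Submodule ℝ (I → ℝ))) :=
      LinearIndependent.of_comp (E ⊓ vanishOn Z).subtype hli
    exact hli'.fintype_card_le_finrank

theorem eq_zero_of_pivots {μ : I → ℕ} {E : Submodule ℝ (I → ℝ)} {u : I → ℝ} (hu : u ∈ E)
    (h : ∀ a ∈ pivots μ E, u a = 0) : u = 0 := by
  by_contra hne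
  obtain ⟨a, ha, hua, -⟩ := exists_pivot (μ := μ) hu hne
  exact hua (h a ha)

theorem finrank_eq_card_pivots {μ : I → ℕ} (hμ : Function.Injective μ)
    (E : Submodule ℝ (I → ℝ)) :
    Module.finrank ℝ E = Nat.card (pivots μ E) := by
  have h := finrank_inf_vanishOn hμ E ∅ (by simp)
  have h1 : (vanishOn (∅ : Set I)) = ⊤ := by
    rw [eq_top_iff]
    intro u _ z hz
    exact absurd hz (Set.notMem_empty z)
  rw [h1, inf_top_eq] at h
  rw [h]
  exact Nat.card_congr (Equiv.subtypeEquivRight fun a => by simp)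

/-- Evaluation at the pivots is an isomorphism on `E`, so there is a vector dual to `b`. Its first
nonzero value sits at a pivot, which can only be `b`, so nothing of smaller weight is in its
support. -/
theorem exists_dual_vector {μ : I → ℕ} (hμ : Function.Injective μ) (E : Submodule ℝ (I → ℝ))
    {b : I} (hb : b ∈ pivots μ E) :
    ∃ u ∈ E, u b = 1 ∧ (∀ a ∈ pivots μ E, a ≠ b → u a = 0) ∧ ∀ a, u a ≠ 0 → μ b ≤ μ a := by
  classical
  have hfin : Fintype (pivots μ E) := Fintype.ofFinite _
  let f : E →ₗ[ℝ] (pivots μ E → ℝ) := (LinearMap.funLeft ℝ ℝ Subtype.val) ∘ₗ E.subtype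
  have hf : Function.Injective f := by
    rw [← LinearMap.ker_eq_bot, LinearMap.ker_eq_bot']
    intro u hu
    exact Subtype.ext (eq_zero_of_pivots (μ := μ) u.2 fun a ha => congrFun hu ⟨a, ha⟩)
  have hd : Module.finrank ℝ E = Module.finrank ℝ (pivots μ E → ℝ) := by
    rw [Module.finrank_fintype_fun_eq_card, finrank_eq_card_pivots hμ, Nat.card_eq_fintype_card]
  obtain ⟨u, hu⟩ := (LinearMap.injective_iff_surjective_of_finrank_eq_finrank hd).mp hf
    (Pi.single ⟨b, hb⟩ 1)
  have h1 : ∀ a (ha : a ∈ pivots μ E), u.1 a = (Pi.single ⟨b, hb⟩ 1 : pivots μ E → ℝ) ⟨a, ha⟩ :=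
    fun a ha => congrFun hu ⟨a, ha⟩
  have hb1 : u.1 b = 1 := by rw [h1 b hb, Pi.single_eq_same]
  have h2 : ∀ a ∈ pivots μ E, a ≠ b → u.1 a = 0 := by
    intro a ha hab
    rw [h1 a ha, Pi.single_eq_of_ne]
    exact fun h => hab (congrArg Subtype.val h)
  refine ⟨u.1, u.2, hb1, h2, fun a ha => ?_⟩
  have hne : u.1 ≠ 0 := fun h => by
    rw [h] at hb1
    simp at hb1
  obtain ⟨c, hc, huc, hlt⟩ := exists_pivot (μ := μ) u.2 hne
  have hcb : c = b := by
    by_contra hcb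
    exact huc (h2 c hc hcb)
  subst hcb
  by_contra hcon
  exact ha (hlt a (not_le.mp hcon))

/-- A surjective linear map, normalized so that the equations that define its kernel are solved
for the coordinates that are not pivots. -/
theorem exists_echelon [DecidableEq I] {μ : I → ℕ} (hμ : Function.Injective μ) {W : Type*}
    [AddCommGroup W] [Module ℝ W] [FiniteDimensional ℝ W] (A : (I → ℝ) →ₗ[ℝ] W)
    (hA : Function.Surjective A) :
    ∃ N : W ≃ₗ[ℝ] ({a : I // a ∉ pivots μ (LinearMap.ker A)} → ℝ),
      (∀ a b : {a : I // a ∉ pivots μ (LinearMap.ker A)},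
        N (A (Pi.single b.1 1)) a = if a = b then 1 else 0) ∧
      ∀ (a : {a : I // a ∉ pivots μ (LinearMap.ker A)}) (b : I),
        b ∈ pivots μ (LinearMap.ker A) → N (A (Pi.single b 1)) a ≠ 0 → μ b < μ a.1 := by
  classical
  set E := LinearMap.ker A with hE
  have hfin : Fintype (pivots μ E) := Fintype.ofFinite _
  let ext : ({a : I // a ∉ pivots μ E} → ℝ) →ₗ[ℝ] (I → ℝ) :=
    { toFun := fun q i => if h : i ∉ pivots μ E then q ⟨i, h⟩ else 0
      map_add' := by
        intro p q
        funext i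
        by_cases h : i ∈ pivots μ E <;> simp [h]
      map_smul' := by
        intro c q
        funext i
        by_cases h : i ∈ pivots μ E <;> simp [h] }
  have hext : ∀ q (a : {a : I // a ∉ pivots μ E}), ext q a.1 = q a := by
    intro q a
    change (if h : a.1 ∉ pivots μ E then q ⟨a.1, h⟩ else 0) = _
    rw [dif_pos a.2]
  have hext0 : ∀ q, ∀ a ∈ pivots μ E, ext q a = 0 := by
    intro q a ha
    change (if h : a ∉ pivots μ E then q ⟨a, h⟩ else 0) = _
    rw [dif_neg (not_not.mpr ha)]
  have hinj : Function.Injective (A ∘ₗ ext) := by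
    rw [← LinearMap.ker_eq_bot, LinearMap.ker_eq_bot']
    intro q hq
    have h0 : ext q = 0 := eq_zero_of_pivots (μ := μ) (E := E) hq (hext0 q)
    funext a
    rw [← hext q a, h0]
    rfl
  have hd : Module.finrank ℝ ({a : I // a ∉ pivots μ E} → ℝ) = Module.finrank ℝ W := by
    have h1 := LinearMap.finrank_range_add_finrank_ker A
    rw [LinearMap.range_eq_top.mpr hA, finrank_top, finrank_eq_card_pivots hμ,
      Module.finrank_fintype_fun_eq_card, Nat.card_eq_fintype_card] at h1
    have h2 := Fintype.card_subtype_compl (fun a => a ∈ pivots μ E)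
    have h3 := Fintype.card_subtype_le (fun a => a ∈ pivots μ E)
    rw [Module.finrank_fintype_fun_eq_card]
    have h4 : Fintype.card (pivots μ E) = Fintype.card {a // a ∈ pivots μ E} :=
      Fintype.card_congr (Equiv.refl _)
    change _ + Fintype.card (pivots μ E) = _ at h1
    omega
  let N := (LinearEquiv.ofInjectiveOfFinrankEq (A ∘ₗ ext) hinj hd).symm
  have hN : ∀ q, N (A (ext q)) = q := by
    intro q
    rw [LinearEquiv.symm_apply_eq]
    rfl
  have hsingle : ∀ b : {a : I // a ∉ pivots μ E}, ext (Pi.single b 1) = Pi.single b.1 1 := by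
    intro b
    funext i
    by_cases h : i ∈ pivots μ E
    · rw [hext0 _ _ h, Pi.single_eq_of_ne]
      rintro rfl
      exact b.2 h
    · rw [hext _ ⟨i, h⟩]
      simp only [Pi.single_apply, Subtype.ext_iff]
  refine ⟨N, fun a b => ?_, fun a b hb hne => ?_⟩
  · rw [← hsingle, hN, Pi.single_apply]
  -- The vector dual to the pivot `b` lies in the kernel, so the entry in question is `-u a`; the
  -- support of `u` has no weight below that of `b`.
  · obtain ⟨u, huE, hub, hu0, hle⟩ := exists_dual_vector hμ E hb
    have hdec : u = Pi.single b 1 + ext (fun a => u a.1) := by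
      funext i
      by_cases h : i ∈ pivots μ E
      · rw [Pi.add_apply, hext0 _ _ h, add_zero]
        by_cases hib : i = b
        · subst hib
          rw [hub, Pi.single_eq_same]
        · rw [hu0 i h hib, Pi.single_eq_of_ne hib]
      · rw [Pi.add_apply, hext _ ⟨i, h⟩, Pi.single_eq_of_ne, zero_add]
        rintro rfl
        exact h hb
    have h1 : A u = 0 := huE
    rw [hdec, map_add] at h1
    have h2 := congrArg N h1
    rw [map_add, hN, map_zero] at h2
    have h3 := congrFun h2 a
    rw [Pi.add_apply, Pi.zero_apply] at h3
    have h4 : u a.1 ≠ 0 := fun h => hne (by rw [h, add_zero] at h3; exact h3)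
    refine lt_of_le_of_ne (hle _ h4) fun h => ?_
    exact a.2 (hμ h ▸ hb)

end Echelon

/-! ### Estimates of multinomial coefficients -/

section Multinomial

variable {n : ℕ}

/-- One summand of Vandermonde's identity. -/
theorem choose_mul_choose_le (p q p' q' : ℕ) :
    (p + q).choose p * (p' + q').choose p' ≤ (p + p' + (q + q')).choose (p + p') := by
  have h : p + p' + (q + q') = (p + q) + (p' + q') := by ring
  rw [h, Nat.add_choose_eq (p + q) (p' + q') (p + p')]
  exact Finset.single_le_sum (f := fun ij : ℕ × ℕ => (p + q).choose ij.1 * (p' + q').choose ij.2)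
    (fun _ _ => Nat.zero_le _) 
    (Finset.HasAntidiagonal.mem_antidiagonal.mpr (rfl : (p, p').1 + (p, p').2 = p + p'))

theorem prod_choose_le {ι : Type*} (s : Finset ι) (x y : ι → ℕ) :
    ∏ i ∈ s, (x i + y i).choose (x i) ≤ (∑ i ∈ s, x i + ∑ i ∈ s, y i).choose (∑ i ∈ s, x i) := by
  classical
  induction s using Finset.induction_on with
  | empty => simp
  | insert a s ha ih =>
    rw [Finset.prod_insert ha, Finset.sum_insert ha, Finset.sum_insert ha]
    exact (Nat.mul_le_mul_left _ ih).trans (choose_mul_choose_le _ _ _ _)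

theorem choose_mul_factorials (p q : ℕ) :
    (p + q).choose p * (p.factorial * q.factorial) = (p + q).factorial := by
  rw [← mul_assoc]
  have := Nat.choose_mul_factorial_mul_factorial (Nat.le_add_right p q)
  rwa [Nat.add_sub_cancel_left] at this

theorem leibCoef_nonneg (δ ε : Fin n →₀ ℕ) : 0 ≤ leibCoef δ ε := by
  unfold leibCoef
  positivity

theorem leibCoef_zero_left (ε : Fin n →₀ ℕ) : leibCoef 0 ε = 1 := by
  have := mfact_ne_zero ε
  have h0 : mfact (0 : Fin n →₀ ℕ) = 1 := by simp [mfact]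
  rw [leibCoef, zero_add, h0]
  field_simp
  simp

/-- The Leibniz coefficient is a product of binomials, one per variable, which Vandermonde bounds by
the single binomial of the total degrees. -/
theorem leibCoef_mul_le (δ ε : Fin n →₀ ℕ) :
    leibCoef δ ε * (δ.degree.factorial : ℝ) * (ε.degree.factorial : ℝ)
      ≤ ((δ.degree + ε.degree).factorial : ℝ) := by
  have h1 : mfact (δ + ε) = (∏ i, (δ i + ε i).choose (δ i)) * (mfact δ * mfact ε) := by
    unfold mfact
    rw [← Finset.prod_mul_distrib, ← Finset.prod_mul_distrib]
    refine Finset.prod_congr rfl fun i _ => ?_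
    rw [Finsupp.add_apply, choose_mul_factorials]
  have h2 : leibCoef δ ε = ((∏ i, (δ i + ε i).choose (δ i) : ℕ) : ℝ) := by
    have := mfact_ne_zero δ
    have := mfact_ne_zero ε
    rw [leibCoef, h1]
    push_cast
    field_simp
  rw [h2, mul_assoc]
  have h3 := prod_choose_le Finset.univ (fun i => δ i) (fun i => ε i)
  rw [← Finsupp.degree_eq_sum, ← Finsupp.degree_eq_sum] at h3
  have h4 := Nat.mul_le_mul_right (δ.degree.factorial * ε.degree.factorial) h3
  rw [choose_mul_factorials] at h4
  exact_mod_cast h4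

theorem factorial_mul_factorial_le {p q a b : ℕ} (hqp : q ≤ p) (hba : b ≤ a) :
    p.factorial * (b + q).factorial ≤ (a + p).factorial * q.factorial := by
  have h1 : q.factorial * (q + 1).ascFactorial b = (q + b).factorial :=
    Nat.factorial_mul_ascFactorial q b
  have h2 : p.factorial * (p + 1).ascFactorial b = (p + b).factorial :=
    Nat.factorial_mul_ascFactorial p b
  have h3 : (q + 1).ascFactorial b ≤ (p + 1).ascFactorial b := by
    clear h1 h2 hba
    induction b with
    | zero => simp
    | succ b ih =>
      rw [Nat.ascFactorial_succ, Nat.ascFactorial_succ]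
      exact Nat.mul_le_mul (by omega) ih
  have h4 : (p + b).factorial ≤ (a + p).factorial := Nat.factorial_le (by omega)
  calc p.factorial * (b + q).factorial
      = p.factorial * (q.factorial * (q + 1).ascFactorial b) := by rw [h1, add_comm b q]
    _ ≤ p.factorial * (q.factorial * (p + 1).ascFactorial b) := by gcongr
    _ = (p + b).factorial * q.factorial := by rw [← h2]; ring
    _ ≤ (a + p).factorial * q.factorial := by gcongr

/-- For a term of Leibniz' rule, the factorials from Cauchy's estimate of the coefficient and from
the bound on the unknown are absorbed by the factorial of the order on the left. This is why the
factorial belongs in the majorant. -/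
theorem leibCoef_factorial_le {δ ε : Fin n →₀ ℕ} {a b : ℕ} (hba : b ≤ a) :
    leibCoef δ ε * (δ.degree.factorial : ℝ) * ((b + ε.degree).factorial : ℝ)
      ≤ ((a + (δ.degree + ε.degree)).factorial : ℝ) := by
  have h1 := leibCoef_mul_le δ ε
  have h2 : ((δ.degree + ε.degree).factorial : ℝ) * ((b + ε.degree).factorial : ℝ)
      ≤ ((a + (δ.degree + ε.degree)).factorial : ℝ) * (ε.degree.factorial : ℝ) := by
    exact_mod_cast factorial_mul_factorial_le (Nat.le_add_left _ _) hba
  have h3 : (0 : ℝ) < (ε.degree.factorial : ℝ) := by positivity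
  refine le_of_mul_le_mul_right (le_trans ?_ h2) h3
  calc leibCoef δ ε * (δ.degree.factorial : ℝ) * ((b + ε.degree).factorial : ℝ)
        * (ε.degree.factorial : ℝ)
      = (leibCoef δ ε * (δ.degree.factorial : ℝ) * (ε.degree.factorial : ℝ))
        * ((b + ε.degree).factorial : ℝ) := by ring
    _ ≤ _ := by gcongr

/-- The sum is dominated by a product of geometric sums, one per variable, each at most 2. The bound
does not depend on γ. -/
theorem sum_antidiagonal_half_pow_le (γ : Fin n →₀ ℕ) :
    ∑ p ∈ Finset.HasAntidiagonal.antidiagonal γ, (1 / 2 : ℝ) ^ p.1.degree ≤ 2 ^ n := by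
  classical
  have h1 : ∑ p ∈ Finset.HasAntidiagonal.antidiagonal γ, (1 / 2 : ℝ) ^ p.1.degree
      ≤ ∑ q ∈ Fintype.piFinset fun i : Fin n => Finset.range (γ i + 1),
          ∏ i, (1 / 2 : ℝ) ^ q i := by
    have hinj : Set.InjOn (fun p : (Fin n →₀ ℕ) × (Fin n →₀ ℕ) => (p.1 : Fin n → ℕ))
        (Finset.HasAntidiagonal.antidiagonal γ : Finset _) := by
      intro p hp q hq h
      have hp' := Finset.HasAntidiagonal.mem_antidiagonal.mp (Finset.mem_coe.mp hp)
      have hq' := Finset.HasAntidiagonal.mem_antidiagonal.mp (Finset.mem_coe.mp hq)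
      have h1 : p.1 = q.1 := DFunLike.coe_injective h
      refine Prod.ext h1 ?_
      rw [h1, ← hq'] at hp'
      exact add_left_cancel hp'
    have h2 : ∑ p ∈ Finset.HasAntidiagonal.antidiagonal γ, (1 / 2 : ℝ) ^ p.1.degree
        = ∑ q ∈ (Finset.HasAntidiagonal.antidiagonal γ).image
            (fun p : (Fin n →₀ ℕ) × (Fin n →₀ ℕ) => (p.1 : Fin n → ℕ)),
            ∏ i, (1 / 2 : ℝ) ^ q i := by
      rw [Finset.sum_image hinj]
      refine Finset.sum_congr rfl fun p _ => ?_
      rw [Finset.prod_pow_eq_pow_sum, Finsupp.degree_eq_sum]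
    rw [h2]
    refine Finset.sum_le_sum_of_subset_of_nonneg ?_ fun q _ _ =>
      Finset.prod_nonneg fun i _ => by positivity
    intro q hq
    obtain ⟨p, hp, rfl⟩ := Finset.mem_image.mp hq
    rw [Fintype.mem_piFinset]
    intro i
    have := congrArg (fun f : Fin n →₀ ℕ => f i) (Finset.HasAntidiagonal.mem_antidiagonal.mp hp)
    simp only [Finsupp.add_apply] at this
    rw [Finset.mem_range]
    omega
  refine h1.trans ?_
  rw [← Finset.prod_univ_sum]
  calc ∏ i : Fin n, ∑ d ∈ Finset.range (γ i + 1), (1 / 2 : ℝ) ^ d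
      ≤ ∏ _i : Fin n, (2 : ℝ) := by
        refine Finset.prod_le_prod (fun i _ => Finset.sum_nonneg fun d _ => by positivity)
          fun i _ => sum_geometric_two_le _
    _ = 2 ^ n := by simp

end Multinomial

/-! ### Triangular recursions -/

section Triangular

variable {X : Type*}

theorem triangular_unique {μ : X → ℕ} {T : X → (X → ℝ) →ₗ[ℝ] ℝ}
    (hT : ∀ c U, (∀ c', μ c' < μ c → U c' = 0) → T c U = 0) {U U' d : X → ℝ}
    (h : ∀ c, U c = d c + T c U) (h' : ∀ c, U' c = d c + T c U') : U = U' := by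
  suffices ∀ m c, μ c = m → U c = U' c by
    funext c
    exact this _ c rfl
  intro m
  induction m using Nat.strong_induction_on with
  | _ m ih =>
    rintro c rfl
    have : T c (U - U') = 0 := hT c _ fun c' hc' => sub_eq_zero.mpr (ih _ hc' c' rfl)
    rw [map_sub, sub_eq_zero] at this
    rw [h, h', this]

/-- Triangular systems of linear equations have unique solutions. -/
theorem exists_triangular_solution {μ : X → ℕ} {T : X → (X → ℝ) →ₗ[ℝ] ℝ}
    (hT : ∀ c U, (∀ c', μ c' < μ c → U c' = 0) → T c U = 0) :
    ∃ S : (X → ℝ) →ₗ[ℝ] (X → ℝ), ∀ d c, S d c = d c + T c (S d) := by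
  classical
  have hex : ∀ d : X → ℝ, ∃ U : X → ℝ, ∀ c, U c = d c + T c U := by
    intro d
    have hwf : WellFounded fun c c' : X => μ c < μ c' := (measure μ).wf
    let F : ∀ c : X, (∀ c', μ c' < μ c → ℝ) → ℝ := fun c rec =>
      d c + T c fun c' => if h : μ c' < μ c then rec c' h else 0
    refine ⟨hwf.fix F, fun c => ?_⟩
    rw [hwf.fix_eq]
    change d c + T c _ = _
    congr 1
    -- The recursion sees `U` cut off at the weight of `c`; the cut-off part is invisible to `T c`.
    rw [← sub_eq_zero, ← map_sub]
    refine hT c _ fun c' hc' => ?_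
    rw [Pi.sub_apply, dif_pos hc', sub_self]
  choose S hS using hex
  -- Linearity of the solution in the data follows from uniqueness.
  refine ⟨{ toFun := S, map_add' := fun d d' => ?_, map_smul' := fun r d => ?_ }, hS⟩
  · refine triangular_unique hT (hS _) fun c => ?_
    rw [Pi.add_apply, hS d c, hS d' c, map_add, Pi.add_apply]
    ring
  · refine triangular_unique hT (hS _) fun c => ?_
    simp only [RingHom.id_apply]
    rw [Pi.smul_apply, hS d c, map_smul, Pi.smul_apply]
    simp only [smul_eq_mul]
    ring

end Triangular

/-! ### Positions of bounded order -/

section Positions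

variable {n k : ℕ}

theorem mem_idxEq {m : ℕ} {α : Fin n →₀ ℕ} : α ∈ idxEq n m ↔ α.degree = m := by
  rw [idxEq, Finset.mem_finsuppAntidiag, Finsupp.degree_eq_sum]
  simp

theorem mem_idxLE {α : Fin n →₀ ℕ} : α ∈ idxLE n k ↔ α.degree ≤ k := by
  rw [idxLE, Finset.mem_biUnion]
  constructor
  · rintro ⟨m, hm, h⟩
    rw [mem_idxEq] at h
    have := Finset.mem_range.mp hm
    omega
  · intro h
    exact ⟨_, Finset.mem_range.mpr (by omega), mem_idxEq.mpr rfl⟩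

/-- The derivatives of order at most `k`. -/
abbrev Ix (n k : ℕ) : Type := ↥(idxLE n k) × Fin n

/-- The position of a derivative of order at most `k`. -/
def Ix.pos (b : Ix n k) : Pos n := (b.1.1, b.2)

/-- The order of a derivative. -/
noncomputable def Ix.deg (b : Ix n k) : ℕ := b.1.1.degree

theorem Ix.deg_le (b : Ix n k) : b.deg ≤ k := mem_idxLE.mp b.1.2

theorem Ix.pos_injective : Function.Injective (Ix.pos : Ix n k → Pos n) := by
  intro a b h
  exact Prod.ext (Subtype.ext (congrArg Prod.fst h)) (congrArg Prod.snd h :)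

/-- A derivative of order at most `k`, seen as one of order at most `k + 1`. -/
noncomputable def Ix.inc (b : Ix n k) : Ix n (k + 1) :=
  (⟨b.1.1, mem_idxLE.mpr (b.deg_le.trans (Nat.le_succ k))⟩, b.2)

/-- The derivative along `j` of a derivative. -/
noncomputable def Ix.shift (b : Ix n k) (j : Fin n) : Ix n (k + 1) :=
  (⟨b.1.1 + Finsupp.single j 1, mem_idxLE.mpr (by
    rw [degree_add_single]
    exact Nat.succ_le_succ b.deg_le)⟩, b.2)

/-- The position `(α, i)` with `|α| ≤ k`. -/
noncomputable def Ix.ofPos (c : Pos n) (h : c.1.degree ≤ k) : Ix n k := (⟨c.1, mem_idxLE.mpr h⟩, c.2)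

theorem Ix.inc_injective : Function.Injective (Ix.inc : Ix n k → Ix n (k + 1)) := by
  intro a b h
  apply Ix.pos_injective
  exact congrArg (fun c : Ix n (k + 1) => ((c.1.1, c.2) : Pos n)) h

theorem Ix.deg_inc (b : Ix n k) : b.inc.deg = b.deg := rfl

theorem Ix.deg_shift (b : Ix n k) (j : Fin n) : (b.shift j).deg = b.deg + 1 :=
  degree_add_single _ _

/-- `c = a + γ`, where `γ` is multiplicative for the principal derivative `a`. -/
def IsDec (Q : Set (Ix n k)) (c : Pos n) (a : Ix n k) (γ : Fin n →₀ ℕ) : Prop :=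
  a ∈ Q ∧ c = (a.1.1 + γ, a.2) ∧ (γ = 0 ∨ a.deg = k) ∧ ∀ j, γ j ≠ 0 → Mult a.1.1 j

/-- At the first index `j` where γ and δ differ, say δ_j < γ_j, the multi-index β must involve `j`.
Multiplicativity then forbids variables after `j` in δ, so γ dominates δ strictly, although both
have the same degree. -/
theorem mult_add_unique {α β γ δ : Fin n →₀ ℕ} (hd : α.degree = β.degree) (h : α + γ = β + δ)
    (hγ : ∀ j, γ j ≠ 0 → Mult α j) (hδ : ∀ j, δ j ≠ 0 → Mult β j) : γ = δ := by
  classical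
  have key : ∀ {α β γ δ : Fin n →₀ ℕ} (_ : α.degree = β.degree) (_ : α + γ = β + δ)
      (_ : ∀ j, δ j ≠ 0 → Mult β j) (j : Fin n) (_ : ∀ l, l < j → γ l = δ l), ¬ δ j < γ j := by
    intro α β γ δ hd h hδ j hlt hj
    have hdeg : γ.degree = δ.degree := by
      have := congrArg Finsupp.degree h
      rw [map_add, map_add] at this
      omega
    have hat : ∀ l, α l + γ l = β l + δ l := fun l => by
      have := congrArg (fun f : Fin n →₀ ℕ => f l) h
      simpa using this
    have hβ : β j ≠ 0 := by
      have := hat j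
      omega
    have hz : ∀ l, j < l → δ l = 0 := by
      intro l hl
      by_contra hne
      exact hβ (hδ l hne j hl)
    rw [Finsupp.degree_eq_sum, Finsupp.degree_eq_sum] at hdeg
    refine absurd hdeg (ne_of_gt (Finset.sum_lt_sum (fun l _ => ?_) ⟨j, Finset.mem_univ j, hj⟩))
    rcases lt_trichotomy l j with hl | hl | hl
    · exact (hlt l hl).ge
    · rw [hl]
      exact hj.le
    · rw [hz l hl]
      exact Nat.zero_le _
  by_contra hne
  obtain ⟨j, hj, hlt⟩ := exists_min_ne (Finsupp.ne_iff.mp hne)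
  rcases lt_or_gt_of_ne hj with h1 | h1
  · exact key hd.symm h.symm hγ j (fun l hl => (hlt l hl).symm) h1
  · exact key hd h hδ j hlt h1

/-- This makes the recursion unambiguous: a derivative is prescribed by at most one multiplicative
derivative of one equation. -/
theorem IsDec.unique {Q : Set (Ix n k)} {c : Pos n} {a a' : Ix n k} {γ γ' : Fin n →₀ ℕ}
    (h : IsDec Q c a γ) (h' : IsDec Q c a' γ') : a = a' ∧ γ = γ' := by
  obtain ⟨-, h1, h2, h3⟩ := h
  obtain ⟨-, h1', h2', h3'⟩ := h'
  have e := h1.symm.trans h1'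
  have e1 : a.1.1 + γ = a'.1.1 + γ' := (Prod.mk.inj e).1
  have e2 : a.2 = a'.2 := (Prod.mk.inj e).2
  have hdeg := congrArg Finsupp.degree e1
  rw [map_add, map_add] at hdeg
  have l1 := a.deg_le
  have l2 := a'.deg_le
  unfold Ix.deg at h2 h2' l1 l2
  have hγ : γ = γ' := by
    rcases h2 with h2 | h2 <;> rcases h2' with h2' | h2'
    · rw [h2, h2']
    · rw [h2] at hdeg ⊢
      rw [map_zero, add_zero] at hdeg
      exact ((Finsupp.degree_eq_zero_iff γ').mp (by omega)).symm
    · rw [h2'] at hdeg ⊢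
      rw [map_zero, add_zero] at hdeg
      exact (Finsupp.degree_eq_zero_iff γ).mp (by omega)
    · exact mult_add_unique (h2.trans h2'.symm) e1 h3 h3'
  subst hγ
  exact ⟨Prod.ext (Subtype.ext (add_right_cancel e1)) e2, rfl⟩

/-- Every multi-index of positive order is uniquely `α + e_l` with `l` multiplicative for `α`. -/
theorem exists_mult_add_single {α : Fin n →₀ ℕ} (h : α ≠ 0) :
    ∃ (β : Fin n →₀ ℕ) (l : Fin n), α = β + Finsupp.single l 1 ∧ Mult β l := by
  classical
  obtain ⟨l, hl, hlt⟩ := exists_min_ne (Finsupp.ne_iff.mp h)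
  refine ⟨α - Finsupp.single l 1, l, ?_, fun j hj => ?_⟩
  · rw [tsub_add_cancel_of_le]
    rw [Finsupp.single_le_iff]
    exact Nat.one_le_iff_ne_zero.mpr hl
  · rw [Finsupp.tsub_apply, hlt j hj]
    simp

theorem shift_unique {a a' : Ix n k} {l l' : Fin n} (hd : a.deg = k) (hd' : a'.deg = k)
    (hl : Mult a.1.1 l) (hl' : Mult a'.1.1 l') (h : a.shift l = a'.shift l') :
    a = a' ∧ l = l' := by
  classical
  have e1 : a.1.1 + Finsupp.single l 1 = a'.1.1 + Finsupp.single l' 1 :=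
    congrArg (fun c : Ix n (k + 1) => c.1.1) h
  have e2 : a.2 = a'.2 := congrArg (fun c : Ix n (k + 1) => c.2) h
  have h1 : ∀ {l : Fin n} {α : Fin n →₀ ℕ}, Mult α l →
      ∀ j, Finsupp.single l 1 j ≠ 0 → Mult α j := by
    intro l α hl j hj
    rw [Finsupp.single_apply_ne_zero] at hj
    rw [hj.1]
    exact hl
  have e3 := mult_add_unique (hd.trans hd'.symm) e1 (h1 hl) (h1 hl')
  have e4 : l = l' := Finsupp.single_left_injective one_ne_zero e3
  subst e4
  exact ⟨Prod.ext (Subtype.ext (add_right_cancel e1)) e2, rfl⟩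

end Positions

/-! ### Linear equations on jets -/

section Equations

variable {n k : ℕ}

/-- The partial derivatives at the origin of all components. -/
noncomputable def arr (f : Sp n → Sp n) : Pos n → ℝ := fun c => dd c.1 f 0 c.2

/-- The derivatives of order at most `k` at `x`. -/
noncomputable def jetIx (k : ℕ) (f : Sp n → Sp n) (x : Sp n) : Ix n k → ℝ :=
  fun b => dd b.1.1 f x b.2

/-- The linear equation on jets at `x` with coefficients `c`. -/
noncomputable def eqnL (c : Ix n k → Sp n → ℝ) (x : Sp n) : (Ix n k → ℝ) →ₗ[ℝ] ℝ :=
  ∑ b, c b x • LinearMap.proj b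

/-- The derivative along `j` of a linear equation, as an equation on jets of order `k + 1`. -/
noncomputable def eqnD (c : Ix n k → Sp n → ℝ) (j : Fin n) (x : Sp n) :
    (Ix n (k + 1) → ℝ) →ₗ[ℝ] ℝ :=
  ∑ b : Ix n k, (dd1 j (c b) x • LinearMap.proj b.inc + c b x • LinearMap.proj (b.shift j))

theorem eqnL_apply (c : Ix n k → Sp n → ℝ) (x : Sp n) (u : Ix n k → ℝ) :
    eqnL c x u = ∑ b, c b x * u b := by
  simp [eqnL]

theorem eqnD_apply (c : Ix n k → Sp n → ℝ) (j : Fin n) (x : Sp n) (v : Ix n (k + 1) → ℝ) :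
    eqnD c j x v = ∑ b : Ix n k, (dd1 j (c b) x * v b.inc + c b x * v (b.shift j)) := by
  simp [eqnD]

theorem analyticAt_jetIx {f : Sp n → Sp n} {x : Sp n} (hf : AnalyticAt ℝ f x) (b : Ix n k) :
    AnalyticAt ℝ (fun y => jetIx k f y b) x :=
  ((ContinuousLinearMap.proj (R := ℝ) (φ := fun _ : Fin n => ℝ) b.2).analyticAt _).comp
    (dd_analytic b.1.1 hf)

theorem dd_jetIx (γ : Fin n →₀ ℕ) {f : Sp n → Sp n} {x : Sp n} (hf : AnalyticAt ℝ f x)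
    (b : Ix n k) : dd γ (fun y => jetIx k f y b) x = dd (b.1.1 + γ) f x b.2 := by
  have h1 := (dd_apply γ (dd_analytic b.1.1 hf) b.2).self_of_nhds
  refine h1.trans ?_
  rw [add_comm b.1.1, (dd_add γ b.1.1 hf).self_of_nhds]

theorem dd1_jetIx (j : Fin n) {f : Sp n → Sp n} {x : Sp n} (hf : AnalyticAt ℝ f x)
    (b : Ix n k) : dd1 j (fun y => jetIx k f y b) x = jetIx (k + 1) f x (b.shift j) := by
  rw [← (dd_single j (analyticAt_jetIx hf b)).self_of_nhds, dd_jetIx _ hf b]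
  rfl

theorem analyticAt_eqnL {c : Ix n k → Sp n → ℝ} {f : Sp n → Sp n} {x : Sp n}
    (hc : ∀ b, AnalyticAt ℝ (c b) x) (hf : AnalyticAt ℝ f x) :
    AnalyticAt ℝ (fun y => eqnL c y (jetIx k f y)) x := by
  simp only [eqnL_apply]
  exact Finset.analyticAt_fun_sum _ fun b _ => (hc b).mul (analyticAt_jetIx hf b)

/-- `eqnD` is the total derivative of the equation: the product rule differentiates either the
coefficient or the jet. -/
theorem dd1_eqnL (j : Fin n) {c : Ix n k → Sp n → ℝ} {f : Sp n → Sp n} {x : Sp n}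
    (hc : ∀ b, AnalyticAt ℝ (c b) x) (hf : AnalyticAt ℝ f x) :
    dd1 j (fun y => eqnL c y (jetIx k f y)) x = eqnD c j x (jetIx (k + 1) f x) := by
  simp only [eqnL_apply, eqnD_apply]
  have h1 : ∀ b ∈ (Finset.univ : Finset (Ix n k)),
      AnalyticAt ℝ (fun y => c b y * jetIx k f y b) x :=
    fun b _ => (hc b).mul (analyticAt_jetIx hf b)
  rw [← (dd_single j (Finset.analyticAt_fun_sum _ h1)).self_of_nhds,
    (dd_fun_sum _ _ h1).self_of_nhds]
  refine Finset.sum_congr rfl fun b hb => ?_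
  rw [(dd_single j (h1 b hb)).self_of_nhds,
    (dd1_mul j (hc b) (analyticAt_jetIx hf b)).self_of_nhds]
  beta_reduce
  rw [dd1_jetIx j hf b]
  change _ = dd1 j (c b) x * jetIx k f x b + _
  ring

end Equations

/-! ### The recursion for the Taylor coefficients of solutions -/

section Recursion

variable {n k : ℕ}

/-- The coefficients of an equation, without the leading term. -/
noncomputable def tailCoef (G : Ix n k → Ix n k → Sp n → ℝ) (a b : Ix n k) : Sp n → ℝ := by
  classical
  exact fun x => G a b x - if a = b then 1 else 0

theorem analyticAt_tailCoef {G : Ix n k → Ix n k → Sp n → ℝ} {x : Sp n}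
    (hG : ∀ a b, AnalyticAt ℝ (G a b) x) (a b : Ix n k) : AnalyticAt ℝ (tailCoef G a b) x :=
  (hG a b).sub analyticAt_const

/-- The value for the derivative `a + γ` prescribed by the `γ`-th derivative of the equation with
leading term `a`. -/
noncomputable def recTerm (G : Ix n k → Ix n k → Sp n → ℝ) (a : Ix n k) (γ : Fin n →₀ ℕ) :
    (Pos n → ℝ) →ₗ[ℝ] ℝ :=
  -∑ b : Ix n k, ∑ p ∈ Finset.HasAntidiagonal.antidiagonal γ,
    (leibCoef p.1 p.2 * dd p.1 (tailCoef G a b) 0) • LinearMap.proj ((b.1.1 + p.2, b.2) : Pos n)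

theorem recTerm_apply (G : Ix n k → Ix n k → Sp n → ℝ) (a : Ix n k) (γ : Fin n →₀ ℕ)
    (U : Pos n → ℝ) :
    recTerm G a γ U = -∑ b : Ix n k, ∑ p ∈ Finset.HasAntidiagonal.antidiagonal γ,
      leibCoef p.1 p.2 * dd p.1 (tailCoef G a b) 0 * U (b.1.1 + p.2, b.2) := by
  simp [recTerm]

/-- Leibniz' rule after splitting off the leading derivative. The γ-th derivative of the residual
vanishes at 0 exactly when the array satisfies the recursion at `a + γ`. -/
theorem dd_eqnL {G : Ix n k → Ix n k → Sp n → ℝ} (hG : ∀ a b, AnalyticAt ℝ (G a b) 0)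
    (a : Ix n k) (γ : Fin n →₀ ℕ) {f : Sp n → Sp n} (hf : AnalyticAt ℝ f 0) :
    dd γ (fun x => eqnL (G a) x (jetIx k f x)) 0
      = arr f (a.1.1 + γ, a.2) - recTerm G a γ (arr f) := by
  classical
  have h1 : (fun x => eqnL (G a) x (jetIx k f x))
      = fun x => jetIx k f x a + ∑ b, tailCoef G a b x * jetIx k f x b := by
    funext x
    rw [eqnL_apply]
    have : ∀ b, tailCoef G a b x * jetIx k f x b
        = G a b x * jetIx k f x b - if a = b then jetIx k f x b else 0 := by
      intro b
      change (G a b x - if a = b then 1 else 0) * _ = _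
      rw [sub_mul, ite_mul, one_mul, zero_mul]
    simp only [this, Finset.sum_sub_distrib, Finset.sum_ite_eq, Finset.mem_univ, if_true]
    ring
  have h2 : ∀ b ∈ (Finset.univ : Finset (Ix n k)),
      AnalyticAt ℝ (fun y => tailCoef G a b y * jetIx k f y b) 0 :=
    fun b _ => (analyticAt_tailCoef hG a b).mul (analyticAt_jetIx hf b)
  rw [h1, (dd_fun_add γ (analyticAt_jetIx hf a) (Finset.analyticAt_fun_sum _ h2)).self_of_nhds]
  beta_reduce
  rw [(dd_fun_sum _ _ h2).self_of_nhds, dd_jetIx γ hf a, recTerm_apply, sub_neg_eq_add]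
  congr 1
  refine Finset.sum_congr rfl fun b _ => ?_
  rw [dd_mul γ (analyticAt_tailCoef hG a b) (analyticAt_jetIx hf b)]
  refine Finset.sum_congr rfl fun p _ => ?_
  rw [dd_jetIx p.2 hf b]
  rfl

/-- The recursion for all derivatives. -/
noncomputable def recAll (Q : Set (Ix n k)) (G : Ix n k → Ix n k → Sp n → ℝ) (c : Pos n) :
    (Pos n → ℝ) →ₗ[ℝ] ℝ := by
  classical
  exact if h : ∃ (a : Ix n k) (γ : Fin n →₀ ℕ), IsDec Q c a γ then
    recTerm G h.choose h.choose_spec.choose else 0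

theorem recAll_of_isDec {Q : Set (Ix n k)} {G : Ix n k → Ix n k → Sp n → ℝ} {c : Pos n}
    {a : Ix n k} {γ : Fin n →₀ ℕ} (h : IsDec Q c a γ) : recAll Q G c = recTerm G a γ := by
  have hex : ∃ (a : Ix n k) (γ : Fin n →₀ ℕ), IsDec Q c a γ := ⟨a, γ, h⟩
  have h1 := IsDec.unique hex.choose_spec.choose_spec h
  rw [recAll, dif_pos hex]
  exact congrArg₂ (recTerm G) h1.1 h1.2

theorem recAll_of_not {Q : Set (Ix n k)} {G : Ix n k → Ix n k → Sp n → ℝ} {c : Pos n}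
    (h : ¬ ∃ (a : Ix n k) (γ : Fin n →₀ ℕ), IsDec Q c a γ) : recAll Q G c = 0 := by
  rw [recAll, dif_neg h]

/-- The parametric derivatives of order `N`. -/
noncomputable def paramData (Q : Set (Ix n k)) (N : ℕ) : (Pos n → ℝ) →ₗ[ℝ] (Pos n → ℝ) := by
  classical
  exact
  { toFun := fun U c =>
      if (∃ (a : Ix n k) (γ : Fin n →₀ ℕ), IsDec Q c a γ) ∨ c.1.degree ≠ N then 0 else U c
    map_add' := by
      intro U V
      funext c
      simp only [Pi.add_apply]
      split_ifs <;> simp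
    map_smul' := by
      intro r U
      funext c
      simp only [Pi.smul_apply, RingHom.id_apply]
      split_ifs <;> simp }

theorem paramData_zero_of {Q : Set (Ix n k)} {N : ℕ} {U : Pos n → ℝ} {c : Pos n}
    (h : (∃ (a : Ix n k) (γ : Fin n →₀ ℕ), IsDec Q c a γ) ∨ c.1.degree ≠ N) :
    paramData Q N U c = 0 := if_pos h

theorem paramData_of {Q : Set (Ix n k)} {N : ℕ} {U : Pos n → ℝ} {c : Pos n}
    (h : ¬ ((∃ (a : Ix n k) (γ : Fin n →₀ ℕ), IsDec Q c a γ) ∨ c.1.degree ≠ N)) :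
    paramData Q N U c = U c := if_neg h

variable {ν : (Fin n →₀ ℕ) →+ ℕ} {μ : Pos n → ℕ}

theorem IsWeight.add_pos (hw : IsWeight k ν μ) (b : Ix n k) (γ : Fin n →₀ ℕ) :
    μ (b.1.1 + γ, b.2) = μ b.pos + ν γ := hw.add _ _ _

/-- Linear growth of the weight turns bounds by powers `s ^ μ c` into geometric bounds in the order.
-/
theorem IsWeight.exists_linear_bound (hw : IsWeight k ν μ) :
    ∃ D : ℕ, ∀ c : Pos n, μ c ≤ D * (c.1.degree + 1) := by
  have h1 : ∀ (m : ℕ) (γ : Fin n →₀ ℕ), γ.degree = m →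
      ν γ ≤ (∑ j, ν (Finsupp.single j 1)) * m := by
    intro m
    induction m with
    | zero =>
      intro γ hγ
      rw [(Finsupp.degree_eq_zero_iff γ).mp hγ, map_zero]
      exact Nat.zero_le _
    | succ m ih =>
      intro γ hγ
      have h0 : γ ≠ 0 := by
        rintro rfl
        simp at hγ
      obtain ⟨β, j, rfl⟩ := exists_eq_add_single h0
      rw [degree_add_single] at hγ
      rw [map_add, Nat.mul_succ]
      refine Nat.add_le_add (ih β (by omega)) ?_
      exact Finset.single_le_sum (f := fun j => ν (Finsupp.single j 1))
        (fun _ _ => Nat.zero_le _) (Finset.mem_univ j)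
  refine ⟨(∑ j, ν (Finsupp.single j 1)) + ∑ i, μ (0, i), fun c => ?_⟩
  have h2 := hw.add 0 c.1 c.2
  rw [zero_add] at h2
  have h3 : μ (0, c.2) ≤ ∑ i, μ (0, i) :=
    Finset.single_le_sum (f := fun i => μ ((0 : Fin n →₀ ℕ), i))
      (fun _ _ => Nat.zero_le _) (Finset.mem_univ c.2)
  have h4 := h1 _ c.1 rfl
  have h5 : μ c = μ (0, c.2) + ν c.1 := h2
  rw [h5, add_mul, Nat.mul_succ, Nat.mul_succ]
  have h6 := Nat.zero_le ((∑ i, μ (0, i)) * c.1.degree)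
  have h7 := Nat.zero_le (∑ j, ν (Finsupp.single j 1))
  linarith

/-- The coefficients of the tails of the equations only involve smaller derivatives. -/
theorem gap_of_coef_ne_zero (hw : IsWeight k ν μ) {G : Ix n k → Ix n k → Sp n → ℝ}
    {a b : Ix n k} (hG0 : tailCoef G a b 0 ≠ 0 → μ b.pos < μ a.pos) {γ : Fin n →₀ ℕ}
    (hγ : γ = 0 ∨ a.deg = k) {p : (Fin n →₀ ℕ) × (Fin n →₀ ℕ)} (hp : p.1 + p.2 = γ)
    (h : dd p.1 (tailCoef G a b) 0 ≠ 0) :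
    μ (b.1.1 + p.2, b.2) + p.1.degree + 1 ≤ μ (a.1.1 + γ, a.2) ∧ b.deg ≤ a.deg := by
  rw [hw.add_pos, hw.add_pos]
  by_cases h0 : p.1 = 0
  · rw [h0, dd_zero] at h
    have hlt := hG0 h
    rw [h0, zero_add] at hp
    rw [hp, h0, map_zero]
    refine ⟨by omega, ?_⟩
    by_contra hcon
    push Not at hcon
    have h2 : b.deg ≤ k + 1 := b.deg_le.trans (Nat.le_succ k)
    exact absurd (hw.lt_of_degree_lt b.pos a.pos hcon h2) (by omega)
  · have hk : a.deg = k := by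
      rcases hγ with hγ | hγ
      · rw [hγ] at hp
        exact absurd (add_eq_zero.mp hp).1 h0
      · exact hγ
    have h1 := hw.gap a.pos b.pos p.1 hk b.deg_le h0
    have h2 : ν γ = ν p.1 + ν p.2 := by rw [← hp, map_add]
    exact ⟨by omega, b.deg_le.trans hk.ge⟩

/-- By `gap_of_coef_ne_zero` the recursion only reads positions of smaller weight and no larger
order. The restriction on order later lets solutions be compared through order N only. -/
theorem recAll_triangular (hw : IsWeight k ν μ) {Q : Set (Ix n k)}
    {G : Ix n k → Ix n k → Sp n → ℝ}
    (hG0 : ∀ a ∈ Q, ∀ b, tailCoef G a b 0 ≠ 0 → μ b.pos < μ a.pos) (c : Pos n) (U : Pos n → ℝ)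
    (hU : ∀ c', μ c' < μ c → c'.1.degree ≤ c.1.degree → U c' = 0) : recAll Q G c U = 0 := by
  by_cases h : ∃ (a : Ix n k) (γ : Fin n →₀ ℕ), IsDec Q c a γ
  · obtain ⟨a, γ, h⟩ := h
    rw [recAll_of_isDec h, recTerm_apply, neg_eq_zero]
    obtain ⟨haQ, rfl, hγ, -⟩ := h
    refine Finset.sum_eq_zero fun b _ => Finset.sum_eq_zero fun p hp => ?_
    have hp' := Finset.HasAntidiagonal.mem_antidiagonal.mp hp
    by_cases h0 : dd p.1 (tailCoef G a b) 0 = 0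
    · rw [h0, mul_zero, zero_mul]
    · obtain ⟨h1, h2⟩ := gap_of_coef_ne_zero hw (hG0 a haQ b) hγ hp' h0
      rw [hU _ (by omega), mul_zero]
      change (b.1.1 + p.2).degree ≤ (a.1.1 + γ).degree
      rw [← hp', map_add, map_add, map_add]
      unfold Ix.deg at h2
      omega
  · rw [recAll_of_not h]
    rfl

/-- The gap `p + m + 1 ≤ q` yields a factor s^{-(m+1)}: one power of 1/s makes the whole sum small,
and the other m beat the Cauchy factor τ^m and leave a summable (1/2)^m. -/
theorem term_bound {l x y K M τ s f g h : ℝ} {m p q : ℕ} (hl : 0 ≤ l) (hM : 0 ≤ M) (hτ : 0 ≤ τ)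
    (hK : 0 ≤ K) (hf : 0 ≤ f) (hh : 0 ≤ h) (hs : 1 ≤ s) (hsτ : τ / s ≤ 1 / 2)
    (hpq : p + m + 1 ≤ q) (hx : |x| ≤ M * τ ^ m * f) (hy : |y| ≤ K * (g * s ^ p))
    (hfg : l * f * g ≤ h) :
    l * |x| * |y| ≤ K * (h * s ^ q) * (M / s) * (1 / 2) ^ m := by
  have hs0 : 0 < s := by linarith
  have h1 : s ^ p ≤ s ^ q / s ^ (m + 1) := by
    rw [le_div_iff₀ (by positivity), ← pow_add]
    exact pow_le_pow_right₀ hs (by omega)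
  calc l * |x| * |y| ≤ l * (M * τ ^ m * f) * (K * (g * s ^ p)) := by gcongr
    _ = (l * f * g) * (K * M * τ ^ m * s ^ p) := by ring
    _ ≤ h * (K * M * τ ^ m * s ^ p) := by gcongr
    _ ≤ h * (K * M * τ ^ m * (s ^ q / s ^ (m + 1))) := by gcongr
    _ = K * (h * s ^ q) * (M / s) * (τ / s) ^ m := by
        rw [div_pow, pow_succ]
        field_simp
    _ ≤ K * (h * s ^ q) * (M / s) * (1 / 2) ^ m := by gcongr

/-- A single `s`, fixed by the coefficients alone, makes the recursion halve every bound of the form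
`|c|! * s ^ μ c`. This is the source of the uniformity in N. -/
theorem exists_recAll_bound (hw : IsWeight k ν μ) {Q : Set (Ix n k)}
    {G : Ix n k → Ix n k → Sp n → ℝ} (hG : ∀ a b, AnalyticAt ℝ (G a b) 0)
    (hG0 : ∀ a ∈ Q, ∀ b, tailCoef G a b 0 ≠ 0 → μ b.pos < μ a.pos) :
    ∃ s : ℝ, 1 ≤ s ∧ ∀ (c : Pos n) (U : Pos n → ℝ) (K : ℝ), 0 ≤ K →
      (∀ c', μ c' < μ c → |U c'| ≤ K * ((c'.1.degree.factorial : ℝ) * s ^ μ c')) →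
      |recAll Q G c U| ≤ K / 2 * ((c.1.degree.factorial : ℝ) * s ^ μ c) := by
  choose C σ hC hσ hb using fun p : Ix n k × Ix n k =>
    exists_dd_bound (analyticAt_tailCoef hG p.1 p.2)
  set M := ∑ p, C p with hM
  set τ := ∑ p, σ p with hτ
  have hM0 : 0 ≤ M := Finset.sum_nonneg fun p _ => (hC p).le
  have hτ0 : 0 ≤ τ := Finset.sum_nonneg fun p _ => (hσ p).le
  have hbd : ∀ (a b : Ix n k) (δ : Fin n →₀ ℕ),
      |dd δ (tailCoef G a b) 0| ≤ M * τ ^ δ.degree * (δ.degree.factorial : ℝ) := by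
    intro a b δ
    have h1 : C (a, b) ≤ M := Finset.single_le_sum (fun p _ => (hC p).le) (Finset.mem_univ (a, b))
    have h2 : σ (a, b) ≤ τ := Finset.single_le_sum (fun p _ => (hσ p).le) (Finset.mem_univ (a, b))
    have h3 := (hσ (a, b)).le
    refine (hb (a, b) δ).trans ?_
    gcongr
  clear_value M τ
  clear hb hC hσ
  set β : ℝ := (Fintype.card (Ix n k) : ℝ) with hβ
  -- The first inequality makes the sum over derivatives of the coefficients geometric; the second
  -- covers the sums over the β unknowns and over the antidiagonal (at most 2^n).
  obtain ⟨s, hs1, hsτ, hsM⟩ : ∃ s : ℝ, 1 ≤ s ∧ τ / s ≤ 1 / 2 ∧ M * β * 2 ^ n / s ≤ 1 / 2 := by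
    have h0 : 0 ≤ M * β * 2 ^ n := by positivity
    have h1 : 0 < 1 + 2 * τ + 2 * (M * β * 2 ^ n) := by linarith
    refine ⟨1 + 2 * τ + 2 * (M * β * 2 ^ n), by linarith, ?_, ?_⟩
    · rw [div_le_div_iff₀ h1 (by norm_num)]
      linarith
    · rw [div_le_div_iff₀ h1 (by norm_num)]
      linarith
  have hs0 : 0 < s := by linarith
  refine ⟨s, hs1, fun c U K hK hU => ?_⟩
  by_cases h : ∃ (a : Ix n k) (γ : Fin n →₀ ℕ), IsDec Q c a γ
  · obtain ⟨a, γ, h⟩ := h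
    rw [recAll_of_isDec h, recTerm_apply, abs_neg]
    obtain ⟨haQ, rfl, hγ, -⟩ := h
    set c : Pos n := (a.1.1 + γ, a.2) with hc
    have hterm : ∀ (b : Ix n k), ∀ p ∈ Finset.HasAntidiagonal.antidiagonal γ,
        |leibCoef p.1 p.2 * dd p.1 (tailCoef G a b) 0 * U (b.1.1 + p.2, b.2)|
          ≤ K * ((c.1.degree.factorial : ℝ) * s ^ μ c) * (M / s) * (1 / 2) ^ p.1.degree := by
      intro b p hp
      have hp' := Finset.HasAntidiagonal.mem_antidiagonal.mp hp
      by_cases h0 : dd p.1 (tailCoef G a b) 0 = 0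
      · rw [h0, mul_zero, zero_mul, abs_zero]
        positivity
      · obtain ⟨h1, h2⟩ := gap_of_coef_ne_zero hw (hG0 a haQ b) hγ hp' h0
        rw [← hc] at h1
        have h3 := hU (b.1.1 + p.2, b.2) (by omega)
        have h4 := leibCoef_factorial_le (δ := p.1) (ε := p.2) h2
        have h5 : c.1.degree = a.deg + (p.1.degree + p.2.degree) := by
          rw [hc, ← hp']
          simp only [map_add]
          rfl
        have h6 : (b.1.1 + p.2).degree = b.deg + p.2.degree := map_add _ _ _
        rw [← h5] at h4
        simp only [h6] at h3
        rw [abs_mul, abs_mul, abs_of_nonneg (leibCoef_nonneg p.1 p.2)]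
        exact term_bound (leibCoef_nonneg p.1 p.2) hM0 hτ0 hK (by positivity)
          (by positivity) hs1 hsτ h1 (hbd a b p.1) h3 h4
    refine (Finset.abs_sum_le_sum_abs _ _).trans ?_
    calc ∑ b : Ix n k, |∑ p ∈ Finset.HasAntidiagonal.antidiagonal γ,
          leibCoef p.1 p.2 * dd p.1 (tailCoef G a b) 0 * U (b.1.1 + p.2, b.2)|
        ≤ ∑ _b : Ix n k, K * ((c.1.degree.factorial : ℝ) * s ^ μ c) * (M / s) * 2 ^ n := by
          refine Finset.sum_le_sum fun b _ => ?_
          refine (Finset.abs_sum_le_sum_abs _ _).trans ((Finset.sum_le_sum (hterm b)).trans ?_)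
          rw [← Finset.mul_sum]
          have := sum_antidiagonal_half_pow_le γ
          gcongr
      _ = K * ((c.1.degree.factorial : ℝ) * s ^ μ c) * (M * β * 2 ^ n / s) := by
          rw [Finset.sum_const, Finset.card_univ, nsmul_eq_mul]
          ring
      _ ≤ K * ((c.1.degree.factorial : ℝ) * s ^ μ c) * (1 / 2) := by gcongr
      _ = K / 2 * ((c.1.degree.factorial : ℝ) * s ^ μ c) := by ring
  · rw [recAll_of_not h]
    simp only [LinearMap.zero_apply, abs_zero]
    positivity

end Recursion

/-! ### Vanishing of residuals -/

section Residuals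

variable {n k : ℕ}

theorem dd_mul_of_vanish {γ : Fin n →₀ ℕ} {f g : Sp n → ℝ} {x : Sp n} (hf : AnalyticAt ℝ f x)
    (hg : AnalyticAt ℝ g x) (h : ∀ ε : Fin n →₀ ℕ, ε.degree < γ.degree → dd ε g x = 0) :
    dd γ (fun y => f y * g y) x = f x * dd γ g x := by
  classical
  rw [dd_mul γ hf hg, Finset.sum_eq_single ((0 : Fin n →₀ ℕ), γ)]
  · rw [leibCoef_zero_left, one_mul, dd_zero]
  · intro p hp hne
    have hp' := Finset.HasAntidiagonal.mem_antidiagonal.mp hp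
    rw [h, mul_zero]
    have h1 : p.1 ≠ 0 := by
      intro h0
      rw [h0, zero_add] at hp'
      exact hne (Prod.ext h0 hp')
    have h2 : 0 < p.1.degree := by
      rw [Nat.pos_iff_ne_zero, Ne, Finsupp.degree_eq_zero_iff]
      exact h1
    rw [← hp', map_add]
    omega
  · intro h1
    exact absurd (Finset.HasAntidiagonal.mem_antidiagonal.mpr (zero_add γ)) h1

variable {ν : (Fin n →₀ ℕ) →+ ℕ} {μ : Pos n → ℕ}

/-- Some variable before `j` occurs in `a`. If `j ≤ l`, it would also occur in `a'` before `l`,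
against multiplicativity. -/
theorem lt_of_shift_eq {a a' : Ix n k} {j l : Fin n} (h : a'.shift l = a.shift j)
    (hl : Mult a'.1.1 l) (hj : ¬ Mult a.1.1 j) : l < j := by
  classical
  unfold Mult at hj
  push Not at hj
  obtain ⟨i, hij, hi⟩ := hj
  by_contra hcon
  push Not at hcon
  have e1 : a'.1.1 + Finsupp.single l 1 = a.1.1 + Finsupp.single j 1 :=
    congrArg (fun c : Ix n (k + 1) => c.1.1) h
  have e2 := congrArg (fun f : Fin n →₀ ℕ => f i) e1
  simp only [Finsupp.add_apply] at e2
  rw [Finsupp.single_eq_of_ne (hij.trans_le hcon).ne, Finsupp.single_eq_of_ne hij.ne,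
    hl i (hij.trans_le hcon)] at e2
  omega

/-- If the residuals of a system satisfy the compatibility relations, then they vanish to infinite
order as soon as their multiplicative derivatives vanish. -/
theorem residual_vanish (hw : IsWeight k ν μ) {Q : Set (Ix n k)} {r : Ix n k → Sp n → ℝ}
    (hr : ∀ a, AnalyticAt ℝ (r a) 0) (hQ : ∀ a, a ∉ Q → r a = fun _ => 0)
    (h0 : ∀ a ∈ Q, ∀ γ : Fin n →₀ ℕ, (γ = 0 ∨ a.deg = k) → (∀ j, γ j ≠ 0 → Mult a.1.1 j) →
      dd γ (r a) 0 = 0)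
    (hrel : ∀ a ∈ Q, ∀ j, ∃ (B : Ix n k → Sp n → ℝ) (A : Ix n k → Fin n → Sp n → ℝ),
      (∀ a', AnalyticAt ℝ (B a') 0) ∧ (∀ a' l, AnalyticAt ℝ (A a' l) 0) ∧
      (dd1 j (r a) =ᶠ[𝓝 0] fun x =>
        ∑ a', B a' x * r a' x + ∑ a', ∑ l, A a' l x * dd1 l (r a') x) ∧
      ∀ a' l, A a' l 0 ≠ 0 → a.deg = k ∧ Mult a'.1.1 l ∧
        (μ (a'.shift l).pos < μ (a.shift j).pos ∨ a'.shift l = a.shift j))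
    (a : Ix n k) (γ : Fin n →₀ ℕ) : dd γ (r a) 0 = 0 := by
  classical
  -- Induction on the number of derivatives, then on the weight of the differentiated leading term,
  -- then on Σ j·γ_j. The third measure handles relations whose leading term is unchanged: there a
  -- nonmultiplicative `j` is replaced by a multiplicative `l < j`.
  suffices ∀ (d w i : ℕ) (a : Ix n k) (γ : Fin n →₀ ℕ), γ.degree = d → μ a.pos + ν γ = w →
      (∑ j, j.val * γ j) = i → dd γ (r a) 0 = 0 from this _ _ _ a γ rfl rfl rfl
  intro d
  induction d using Nat.strong_induction_on with
  | _ d ihd =>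
  intro w
  induction w using Nat.strong_induction_on with
  | _ w ihw =>
  intro i
  induction i using Nat.strong_induction_on with
  | _ i ihi =>
  intro a γ hd hwγ hi
  by_cases haQ : a ∈ Q
  swap
  · rw [hQ a haQ, dd_fun_zero]
  by_cases hm : (γ = 0 ∨ a.deg = k) ∧ ∀ j, γ j ≠ 0 → Mult a.1.1 j
  · exact h0 a haQ γ hm.1 hm.2
  have hγ0 : γ ≠ 0 := by
    rintro rfl
    exact hm ⟨Or.inl rfl, fun j hj => absurd rfl hj⟩
  -- A derivative to which the compatibility relation is applied: a nonmultiplicative one for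
  -- equations of order k, any one for equations of lower order.
  obtain ⟨j, hj, hjm⟩ : ∃ j, γ j ≠ 0 ∧ (a.deg = k → ¬ Mult a.1.1 j) := by
    by_cases hk : a.deg = k
    · by_contra hcon
      push Not at hcon
      exact hm ⟨Or.inr hk, fun j hj => (hcon j hj).2⟩
    · obtain ⟨j, hj⟩ := Finsupp.ne_iff.mp hγ0
      exact ⟨j, hj, fun h => absurd h hk⟩
  obtain ⟨γ', hγ'⟩ : ∃ γ' : Fin n →₀ ℕ, γ = γ' + Finsupp.single j 1 := by
    refine ⟨γ - Finsupp.single j 1, ?_⟩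
    rw [tsub_add_cancel_of_le]
    rw [Finsupp.single_le_iff]
    exact Nat.one_le_iff_ne_zero.mpr hj
  have hd' : γ'.degree + 1 = d := by rw [← hd, hγ', degree_add_single]
  obtain ⟨B, A, hB, hA, hEq, hA0⟩ := hrel a haQ j
  have hterm1 : ∀ a' ∈ (Finset.univ : Finset (Ix n k)),
      AnalyticAt ℝ (fun x => B a' x * r a' x) 0 := fun a' _ => (hB a').mul (hr a')
  have hterm2' : ∀ a', ∀ l ∈ (Finset.univ : Finset (Fin n)),
      AnalyticAt ℝ (fun x => A a' l x * dd1 l (r a') x) 0 :=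
    fun a' l _ => (hA a' l).mul (dd1_analytic l (hr a'))
  have hterm2 : ∀ a' ∈ (Finset.univ : Finset (Ix n k)),
      AnalyticAt ℝ (fun x => ∑ l, A a' l x * dd1 l (r a') x) 0 :=
    fun a' _ => Finset.analyticAt_fun_sum _ (hterm2' a')
  rw [hγ', (dd_add_single' γ' j (hr a)).self_of_nhds, (dd_congr γ' hEq).self_of_nhds,
    (dd_fun_add γ' (Finset.analyticAt_fun_sum _ hterm1)
      (Finset.analyticAt_fun_sum _ hterm2)).self_of_nhds]
  beta_reduce
  rw [(dd_fun_sum _ γ' hterm1).self_of_nhds, (dd_fun_sum _ γ' hterm2).self_of_nhds]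
  beta_reduce
  have z1 : ∀ a' ∈ (Finset.univ : Finset (Ix n k)),
      dd γ' (fun x => B a' x * r a' x) 0 = 0 := by
    intro a' _
    rw [dd_mul_of_vanish (hB a') (hr a') fun ε hε => ihd _ (by omega) _ _ a' ε rfl rfl rfl,
      ihd _ (by omega) _ _ a' γ' rfl rfl rfl, mul_zero]
  rw [Finset.sum_eq_zero z1, zero_add]
  refine Finset.sum_eq_zero fun a' _ => ?_
  rw [(dd_fun_sum _ γ' (hterm2' a')).self_of_nhds]
  beta_reduce
  refine Finset.sum_eq_zero fun l _ => ?_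
  have e1 : ∀ ε : Fin n →₀ ℕ, dd ε (dd1 l (r a')) 0 = dd (ε + Finsupp.single l 1) (r a') 0 :=
    fun ε => (dd_add_single' ε l (hr a')).self_of_nhds.symm
  rw [dd_mul_of_vanish (hA a' l) (dd1_analytic l (hr a')) fun ε hε => by
    rw [e1]
    exact ihd _ (by rw [degree_add_single]; omega) _ _ a' _ rfl rfl rfl, e1]
  by_cases hz : A a' l 0 = 0
  · rw [hz, zero_mul]
  obtain ⟨hk, hl, hlt⟩ := hA0 a' l hz
  have hdl : (γ' + Finsupp.single l 1).degree = d := by rw [degree_add_single]; omega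
  have p1 : μ (a'.shift l).pos = μ a'.pos + ν (Finsupp.single l 1) := hw.add _ _ _
  have p2 : μ (a.shift j).pos = μ a.pos + ν (Finsupp.single j 1) := hw.add _ _ _
  have p3 : ν (γ' + Finsupp.single l 1) = ν γ' + ν (Finsupp.single l 1) := map_add _ _ _
  have p4 : ν γ = ν γ' + ν (Finsupp.single j 1) := by rw [hγ', map_add]
  rcases hlt with hlt | heq
  · rw [ihw _ (by omega) _ a' (γ' + Finsupp.single l 1) hdl rfl rfl, mul_zero]
  · have hlj := lt_of_shift_eq heq hl (hjm hk)
    have hsum : ∀ m : Fin n, ∑ j : Fin n, j.val * (γ' + Finsupp.single m 1 : Fin n →₀ ℕ) j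
        = (∑ j : Fin n, j.val * γ' j) + m.val := by
      intro m
      simp [mul_add, Finset.sum_add_distrib, Finsupp.single_apply]
    have hm1 := hsum l
    have hm2 := hsum j
    rw [← hγ', hi] at hm2
    have hlj' : l.val < j.val := hlj
    rw [heq] at p1
    rw [ihi (∑ j : Fin n, j.val * (γ' + Finsupp.single l 1 : Fin n →₀ ℕ) j) (by omega) a' (γ' + Finsupp.single l 1)
      hdl (by omega) rfl, mul_zero]

end Residuals

/-! ### Analytic dependence of compatibility relations -/

section Relations

open scoped Matrix

variable {n : ℕ} {ι S : Type*} [DecidableEq ι]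

/-- The matrix of a family of functionals in given positions. -/
def posMatrix (φ : S → Sp n → (ι → ℝ) →ₗ[ℝ] ℝ) (lp : S → ι) (x : Sp n) : Matrix S S ℝ :=
  Matrix.of fun s s' => φ s x (Pi.single (lp s') 1)

theorem analyticAt_posMatrix {φ : S → Sp n → (ι → ℝ) →ₗ[ℝ] ℝ} (lp : S → ι)
    (hφ : ∀ s i, AnalyticAt ℝ (fun x => φ s x (Pi.single i 1)) 0) (s s' : S) :
    AnalyticAt ℝ (fun y => posMatrix φ lp y s s') 0 := hφ s (lp s')

variable [Fintype S] [DecidableEq S]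

theorem analyticAt_det {M : Sp n → Matrix S S ℝ} {x : Sp n}
    (hM : ∀ s s', AnalyticAt ℝ (fun y => M y s s') x) : AnalyticAt ℝ (fun y => (M y).det) x := by
  simp only [Matrix.det_apply]
  refine Finset.analyticAt_fun_sum _ fun σ _ => ?_
  exact (Finset.analyticAt_fun_prod _ fun s _ => hM _ _).const_smul

theorem analyticAt_matrix_inv {M : Sp n → Matrix S S ℝ} {x : Sp n}
    (hM : ∀ s s', AnalyticAt ℝ (fun y => M y s s') x) (h0 : (M x).det ≠ 0) (s s' : S) :
    AnalyticAt ℝ (fun y => (M y)⁻¹ s s') x := by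
  simp only [Matrix.inv_def, Ring.inverse_eq_inv', Matrix.smul_apply, smul_eq_mul]
  refine ((analyticAt_det hM).inv h0).mul ?_
  simp only [Matrix.adjugate_apply]
  refine analyticAt_det fun i j => ?_
  by_cases h : i = s'
  · subst h
    simp only [Matrix.updateRow_self]
    exact analyticAt_const
  · simp only [Matrix.updateRow_ne h]
    exact hM i j

/-- Take, among the rows with nonzero coefficient that are `s` or have larger leading weight than
`s`, one of maximal leading weight. By triangularity no other row contributes at its leading
position. -/
theorem exists_vecMul_ne_zero {φ : S → Sp n → (ι → ℝ) →ₗ[ℝ] ℝ} {lp : S → ι} {μ : ι → ℕ}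
    (hlp : Function.Injective lp) (h1 : ∀ s, φ s 0 (Pi.single (lp s) 1) = 1)
    (h2 : ∀ s i, φ s 0 (Pi.single i 1) ≠ 0 → i = lp s ∨ μ i < μ (lp s)) (c : S → ℝ) (s : S)
    (hs : c s ≠ 0) :
    ∃ s', (c ᵥ* posMatrix φ lp 0) s' ≠ 0 ∧ (s' = s ∨ μ (lp s) < μ (lp s')) := by
  obtain ⟨s', hs', hmax⟩ := Finset.exists_max_image
    (Finset.univ.filter fun s' => c s' ≠ 0 ∧ (s' = s ∨ μ (lp s) < μ (lp s'))) (fun s' => μ (lp s'))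
    ⟨s, by simpa using hs⟩
  obtain ⟨hc', hor⟩ := (Finset.mem_filter.mp hs').2
  refine ⟨s', ?_, hor⟩
  have : (c ᵥ* posMatrix φ lp 0) s' = c s' := by
    rw [Matrix.vecMul, dotProduct, Finset.sum_eq_single s']
    · change c s' * φ s' 0 _ = _
      rw [h1, mul_one]
    · intro t _ ht
      by_contra hne
      have hct : c t ≠ 0 := left_ne_zero_of_mul hne
      have hMt : φ t 0 (Pi.single (lp s') 1) ≠ 0 := right_ne_zero_of_mul hne
      rcases h2 t _ hMt with h | h
      · exact ht (hlp h).symm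
      · have hlt : μ (lp s) < μ (lp t) := by
          rcases hor with rfl | hor
          · exact h
          · exact hor.trans h
        exact absurd (hmax t (by simp [hct, hlt])) (not_le.mpr h)
    · intro h
      exact absurd (Finset.mem_univ s') h
  rw [this]
  exact hc'

theorem det_posMatrix_ne_zero {φ : S → Sp n → (ι → ℝ) →ₗ[ℝ] ℝ} {lp : S → ι} {μ : ι → ℕ}
    (hlp : Function.Injective lp) (h1 : ∀ s, φ s 0 (Pi.single (lp s) 1) = 1)
    (h2 : ∀ s i, φ s 0 (Pi.single i 1) ≠ 0 → i = lp s ∨ μ i < μ (lp s)) :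
    (posMatrix φ lp 0).det ≠ 0 := by
  intro h
  obtain ⟨c, hc, hc0⟩ := Matrix.exists_vecMul_eq_zero_iff.mpr h
  obtain ⟨s, hs⟩ := Function.ne_iff.mp hc
  obtain ⟨s', hs', -⟩ := exists_vecMul_ne_zero hlp h1 h2 c s hs
  exact hs' (congrFun hc0 s')

/-- At a point where the matrix is invertible, every vector is, modulo the common kernel of the
functionals, a combination of the basis vectors in the given positions. -/
theorem apply_sub_eq_zero {φ : S → Sp n → (ι → ℝ) →ₗ[ℝ] ℝ} {lp : S → ι} {x : Sp n}
    (hdx : (posMatrix φ lp x).det ≠ 0) (w : S → ℝ) (s : S) :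
    φ s x (∑ s', ((posMatrix φ lp x)⁻¹ *ᵥ w) s' • Pi.single (lp s') 1) = w s := by
  have hMy : posMatrix φ lp x *ᵥ ((posMatrix φ lp x)⁻¹ *ᵥ w) = w := by
    rw [Matrix.mulVec_mulVec, Matrix.mul_nonsing_inv _ (Ne.isUnit hdx), Matrix.one_mulVec]
  have := congrFun hMy s
  rw [Matrix.mulVec, dotProduct] at this
  rw [map_sum]
  refine Eq.trans (Finset.sum_congr rfl fun s' _ => ?_) this
  rw [map_smul, smul_eq_mul, mul_comm]
  rfl

/-- A functional in the span of a triangular family of functionals depends on it through analytic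
coefficients, which are controlled at the base point. -/
theorem exists_analytic_coefficients {φ : S → Sp n → (ι → ℝ) →ₗ[ℝ] ℝ}
    {ψ : Sp n → (ι → ℝ) →ₗ[ℝ] ℝ} {lp : S → ι} {μ : ι → ℕ}
    (hφ : ∀ s i, AnalyticAt ℝ (fun x => φ s x (Pi.single i 1)) 0)
    (hψ : ∀ i, AnalyticAt ℝ (fun x => ψ x (Pi.single i 1)) 0) (hlp : Function.Injective lp)
    (h1 : ∀ s, φ s 0 (Pi.single (lp s) 1) = 1)
    (h2 : ∀ s i, φ s 0 (Pi.single i 1) ≠ 0 → i = lp s ∨ μ i < μ (lp s))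
    (hker : ∀ᶠ x in 𝓝 0, ∀ v, (∀ s, φ s x v = 0) → ψ x v = 0) :
    ∃ C : S → Sp n → ℝ, (∀ s, AnalyticAt ℝ (C s) 0) ∧
      (∀ᶠ x in 𝓝 0, ∀ v, ψ x v = ∑ s, C s x * φ s x v) ∧
      ∀ s, C s 0 ≠ 0 → ∃ i, ψ 0 (Pi.single i 1) ≠ 0 ∧ (i = lp s ∨ μ (lp s) < μ i) := by
  have hMan := analyticAt_posMatrix lp hφ
  have hdet := det_posMatrix_ne_zero hlp h1 h2
  -- Comparing values at the leading positions forces the coefficients to be `p` times the inverse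
  -- matrix, which is analytic by Cramer's rule.
  let p : Sp n → S → ℝ := fun x s => ψ x (Pi.single (lp s) 1)
  refine ⟨fun s x => (p x ᵥ* (posMatrix φ lp x)⁻¹) s, fun s => ?_, ?_, fun s hs => ?_⟩
  · simp only [Matrix.vecMul, dotProduct]
    exact Finset.analyticAt_fun_sum _ fun s' _ =>
      (hψ (lp s')).mul (analyticAt_matrix_inv hMan hdet s' s)
  · have hev : ∀ᶠ x in 𝓝 (0 : Sp n), (posMatrix φ lp x).det ≠ 0 :=
      (analyticAt_det hMan).continuousAt.eventually_ne hdet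
    filter_upwards [hker, hev] with x hx hdx v
    set w : S → ℝ := fun s => φ s x v with hwdef
    -- The correction moves `v` into the common kernel of the functionals, where `ψ` vanishes by
    -- hypothesis.
    have hz : ψ x (v - ∑ s', ((posMatrix φ lp x)⁻¹ *ᵥ w) s' • Pi.single (lp s') 1) = 0 := by
      refine hx _ fun s => ?_
      rw [map_sub, apply_sub_eq_zero hdx w s, sub_self]
    rw [map_sub, map_sum, sub_eq_zero] at hz
    rw [hz]
    have e1 : ∑ s', ψ x (((posMatrix φ lp x)⁻¹ *ᵥ w) s' • Pi.single (lp s') 1)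
        = p x ⬝ᵥ ((posMatrix φ lp x)⁻¹ *ᵥ w) := by
      rw [dotProduct]
      refine Finset.sum_congr rfl fun s' _ => ?_
      rw [map_smul, smul_eq_mul, mul_comm]
    rw [e1, Matrix.dotProduct_mulVec]
    rfl
  · obtain ⟨s', hs', hor⟩ := exists_vecMul_ne_zero hlp h1 h2 _ s hs
    rw [Matrix.vecMul_vecMul, Matrix.nonsing_inv_mul _ (Ne.isUnit hdet), Matrix.vecMul_one] at hs'
    refine ⟨lp s', hs', ?_⟩
    rcases hor with rfl | h
    · exact Or.inl rfl
    · exact Or.inr h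

/-- A triangular family of functionals is linearly independent near the base point. -/
theorem eventually_finrank_iInf_ker [Fintype ι] {φ : S → Sp n → (ι → ℝ) →ₗ[ℝ] ℝ} {lp : S → ι}
    {μ : ι → ℕ} (hφ : ∀ s i, AnalyticAt ℝ (fun x => φ s x (Pi.single i 1)) 0)
    (hlp : Function.Injective lp) (h1 : ∀ s, φ s 0 (Pi.single (lp s) 1) = 1)
    (h2 : ∀ s i, φ s 0 (Pi.single i 1) ≠ 0 → i = lp s ∨ μ i < μ (lp s)) :
    ∀ᶠ x in 𝓝 (0 : Sp n), Module.finrank ℝ (LinearMap.ker (LinearMap.pi fun s => φ s x))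
      + Fintype.card S = Fintype.card ι := by
  have hev : ∀ᶠ x in 𝓝 (0 : Sp n), (posMatrix φ lp x).det ≠ 0 :=
    (analyticAt_det (analyticAt_posMatrix lp hφ)).continuousAt.eventually_ne
      (det_posMatrix_ne_zero hlp h1 h2)
  filter_upwards [hev] with x hdx
  have hsurj : Function.Surjective (LinearMap.pi fun s => φ s x) := fun w =>
    ⟨_, funext fun s => apply_sub_eq_zero hdx w s⟩
  have := LinearMap.finrank_range_add_finrank_ker (LinearMap.pi fun s => φ s x)
  rw [LinearMap.range_eq_top.mpr hsurj, finrank_top, Module.finrank_fintype_fun_eq_card,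
    Module.finrank_fintype_fun_eq_card] at this
  omega

end Relations

/-! ### Compatibility relations of involutive systems -/

section Compatibility

variable {n k : ℕ}

/-- The pairs of a derivative of order `k` and a multiplicative variable. -/
abbrev MultPair (n k : ℕ) : Type := {p : Ix n k × Fin n // p.1.deg = k ∧ Mult p.1.1.1 p.2}

/-- The indices of the equations of a system and of their multiplicative derivatives. -/
abbrev EqIx (Q : Set (Ix n k)) : Type := Q ⊕ {p : MultPair n k // p.1.1 ∈ Q}

/-- The leading derivatives. -/
noncomputable def leadIx (Q : Set (Ix n k)) : EqIx Q → Ix n (k + 1)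
  | Sum.inl a => a.1.inc
  | Sum.inr p => p.1.1.1.shift p.1.1.2

/-- The equations of a system and their multiplicative derivatives, on jets of order `k + 1`. -/
noncomputable def eqFun (Q : Set (Ix n k)) (G : Ix n k → Ix n k → Sp n → ℝ) :
    EqIx Q → Sp n → (Ix n (k + 1) → ℝ) →ₗ[ℝ] ℝ
  | Sum.inl a => fun x => eqnL (G a.1) x ∘ₗ LinearMap.funLeft ℝ ℝ Ix.inc
  | Sum.inr p => fun x => eqnD (G p.1.1.1) p.1.1.2 x

theorem leadIx_injective (Q : Set (Ix n k)) : Function.Injective (leadIx Q) := by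
  rintro (a | p) (a' | p') h
  · exact congrArg Sum.inl (Subtype.ext (Ix.inc_injective h))
  · have h1 := congrArg Ix.deg h
    change a.1.inc.deg = (p'.1.1.1.shift p'.1.1.2).deg at h1
    rw [Ix.deg_inc, Ix.deg_shift, p'.1.2.1] at h1
    have := a.1.deg_le
    omega
  · have h1 := congrArg Ix.deg h
    change (p.1.1.1.shift p.1.1.2).deg = a'.1.inc.deg at h1
    rw [Ix.deg_inc, Ix.deg_shift, p.1.2.1] at h1
    have := a'.1.deg_le
    omega
  · obtain ⟨h1, h2⟩ := shift_unique p.1.2.1 p'.1.2.1 p.1.2.2 p'.1.2.2 h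
    exact congrArg Sum.inr (Subtype.ext (Subtype.ext (Prod.ext h1 h2)))

theorem analyticAt_eqnD_single {c : Ix n k → Sp n → ℝ} (hc : ∀ b, AnalyticAt ℝ (c b) 0)
    (j : Fin n) (v : Ix n (k + 1) → ℝ) : AnalyticAt ℝ (fun x => eqnD c j x v) 0 := by
  simp only [eqnD_apply]
  exact Finset.analyticAt_fun_sum _ fun b _ =>
    ((dd1_analytic j (hc b)).mul analyticAt_const).add ((hc b).mul analyticAt_const)

theorem analyticAt_eqFun {Q : Set (Ix n k)} {G : Ix n k → Ix n k → Sp n → ℝ}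
    (hG : ∀ a b, AnalyticAt ℝ (G a b) 0) (s : EqIx Q) (v : Ix n (k + 1) → ℝ) :
    AnalyticAt ℝ (fun x => eqFun Q G s x v) 0 := by
  rcases s with a | p
  · simp only [eqFun, LinearMap.comp_apply, eqnL_apply]
    exact Finset.analyticAt_fun_sum _ fun b _ => (hG _ b).mul analyticAt_const
  · exact analyticAt_eqnD_single (hG _) _ v

variable {ν : (Fin n →₀ ℕ) →+ ℕ} {μ : Pos n → ℕ}

theorem IsWeight.pos_shift (hw : IsWeight k ν μ) (b : Ix n k) (j : Fin n) :
    μ (b.shift j).pos = μ b.pos + ν (Finsupp.single j 1) := hw.add _ _ _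

theorem coef_self {G : Ix n k → Ix n k → Sp n → ℝ} {a : Ix n k}
    (hG0 : ∀ b, tailCoef G a b 0 ≠ 0 → μ b.pos < μ a.pos) : G a a 0 = 1 := by
  have h : tailCoef G a a 0 = 0 := by
    by_contra h
    exact lt_irrefl _ (hG0 a h)
  have h1 : G a a 0 - (if a = a then 1 else 0) = 0 := by
    have h2 := h
    unfold tailCoef at h2
    simpa using h2
  rw [if_pos rfl] at h1
  linarith

theorem eq_or_lt_of_coef {G : Ix n k → Ix n k → Sp n → ℝ} {a b : Ix n k}
    (hG0 : ∀ b, tailCoef G a b 0 ≠ 0 → μ b.pos < μ a.pos) (h : G a b 0 ≠ 0) :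
    b = a ∨ μ b.pos < μ a.pos := by
  by_cases hab : a = b
  · exact Or.inl hab.symm
  · refine Or.inr (hG0 b ?_)
    unfold tailCoef
    simpa [hab] using h

theorem single_inc_ne {b : Ix n k} {i : Ix n (k + 1)}
    (h : (Pi.single i 1 : Ix n (k + 1) → ℝ) b.inc ≠ 0) : b.inc = i := by
  by_contra hne
  exact h (Pi.single_eq_of_ne hne 1)

theorem eqnD_single_cases {c : Ix n k → Sp n → ℝ} {j : Fin n} {i : Ix n (k + 1)}
    (h : eqnD c j 0 (Pi.single i 1) ≠ 0) :
    ∃ b : Ix n k, b.inc = i ∨ (c b 0 ≠ 0 ∧ b.shift j = i) := by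
  rw [eqnD_apply] at h
  obtain ⟨b, -, hb⟩ := Finset.exists_ne_zero_of_sum_ne_zero h
  refine ⟨b, ?_⟩
  by_contra hcon
  push Not at hcon
  apply hb
  rw [Pi.single_eq_of_ne hcon.1, mul_zero, zero_add]
  by_cases h0 : c b 0 = 0
  · rw [h0, zero_mul]
  · rw [Pi.single_eq_of_ne (hcon.2 h0), mul_zero]

/-- For an equation of full order k, terms with a differentiated coefficient have order at most k,
below the order k+1 of the shifted leading derivative. The other terms are shifted by the same
variable, which preserves comparison of weights. -/
theorem eqnD_single_of_deg_eq (hw : IsWeight k ν μ) {G : Ix n k → Ix n k → Sp n → ℝ}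
    {a : Ix n k} (hG0 : ∀ b, tailCoef G a b 0 ≠ 0 → μ b.pos < μ a.pos) (ha : a.deg = k)
    {j : Fin n} {i : Ix n (k + 1)} (h : eqnD (G a) j 0 (Pi.single i 1) ≠ 0) :
    i = a.shift j ∨ μ i.pos < μ (a.shift j).pos := by
  obtain ⟨b, hb | ⟨hb, hs⟩⟩ := eqnD_single_cases h
  · refine Or.inr (hw.lt_of_degree_lt _ _ ?_ ?_)
    · change i.deg < (a.shift j).deg
      rw [← hb, Ix.deg_inc, Ix.deg_shift, ha]
      exact Nat.lt_succ_of_le b.deg_le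
    · exact (a.shift j).deg_le
  · rcases eq_or_lt_of_coef hG0 hb with rfl | hlt
    · exact Or.inl hs.symm
    · right
      rw [← hs, hw.pos_shift, hw.pos_shift]
      omega

theorem eqFun_single (hw : IsWeight k ν μ) {Q : Set (Ix n k)} {G : Ix n k → Ix n k → Sp n → ℝ}
    (hG0 : ∀ a ∈ Q, ∀ b, tailCoef G a b 0 ≠ 0 → μ b.pos < μ a.pos) (s : EqIx Q)
    (i : Ix n (k + 1)) (h : eqFun Q G s 0 (Pi.single i 1) ≠ 0) :
    i = leadIx Q s ∨ μ i.pos < μ (leadIx Q s).pos := by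
  rcases s with a | p
  · simp only [eqFun, LinearMap.comp_apply, eqnL_apply, LinearMap.funLeft_apply] at h
    obtain ⟨b, -, hb⟩ := Finset.exists_ne_zero_of_sum_ne_zero h
    have hi := single_inc_ne (right_ne_zero_of_mul hb)
    subst hi
    rcases eq_or_lt_of_coef (hG0 a.1 a.2) (left_ne_zero_of_mul hb) with rfl | hlt
    · exact Or.inl rfl
    · exact Or.inr hlt
  · exact eqnD_single_of_deg_eq hw (hG0 _ p.2) p.1.2.1 h

theorem eqFun_lead {Q : Set (Ix n k)} {G : Ix n k → Ix n k → Sp n → ℝ}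
    (hG0 : ∀ a ∈ Q, ∀ b, tailCoef G a b 0 ≠ 0 → μ b.pos < μ a.pos) (s : EqIx Q) :
    eqFun Q G s 0 (Pi.single (leadIx Q s) 1) = 1 := by
  rcases s with a | p
  · simp only [eqFun, LinearMap.comp_apply, eqnL_apply, LinearMap.funLeft_apply, leadIx]
    rw [Finset.sum_eq_single a.1]
    · rw [Pi.single_eq_same, mul_one, coef_self (hG0 a.1 a.2)]
    · intro b _ hb
      rw [Pi.single_eq_of_ne fun h => hb (Ix.inc_injective h), mul_zero]
    · intro h
      exact absurd (Finset.mem_univ _) h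
  · simp only [eqFun, leadIx, eqnD_apply]
    have hne : ∀ b : Ix n k, b.inc ≠ p.1.1.1.shift p.1.1.2 := by
      intro b hb
      have h1 := congrArg Ix.deg hb
      rw [Ix.deg_inc, Ix.deg_shift, p.1.2.1] at h1
      have := b.deg_le
      omega
    rw [Finset.sum_eq_single p.1.1.1]
    · rw [Pi.single_eq_of_ne (hne _), mul_zero, zero_add, Pi.single_eq_same, mul_one,
        coef_self (hG0 _ p.2)]
    · intro b _ hb
      rw [Pi.single_eq_of_ne (hne _), mul_zero, zero_add, Pi.single_eq_of_ne, mul_zero]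
      intro h
      refine hb (Prod.ext (Subtype.ext ?_) ?_)
      · exact add_right_cancel (congrArg (fun c : Ix n (k + 1) => c.1.1) h :)
      · exact congrArg (fun c : Ix n (k + 1) => c.2) h
    · intro h
      exact absurd (Finset.mem_univ _) h

/-- The compatibility relations, for the residuals of a vector field. -/
theorem exists_relation (hw : IsWeight k ν μ) {Q : Set (Ix n k)}
    {G : Ix n k → Ix n k → Sp n → ℝ} (hG : ∀ a b, AnalyticAt ℝ (G a b) 0)
    (hG0 : ∀ a ∈ Q, ∀ b, tailCoef G a b 0 ≠ 0 → μ b.pos < μ a.pos)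
    (hker : ∀ᶠ x in 𝓝 0, ∀ v, (∀ s, eqFun Q G s x v = 0) → ∀ a ∈ Q, ∀ j, eqnD (G a) j x v = 0)
    {f : Sp n → Sp n} (hf : AnalyticAt ℝ f 0) (a : Ix n k) (ha : a ∈ Q) (j : Fin n) :
    ∃ (B : Ix n k → Sp n → ℝ) (A : Ix n k → Fin n → Sp n → ℝ),
      (∀ a', AnalyticAt ℝ (B a') 0) ∧ (∀ a' l, AnalyticAt ℝ (A a' l) 0) ∧
      (dd1 j (fun x => eqnL (G a) x (jetIx k f x)) =ᶠ[𝓝 0] fun x =>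
        ∑ a', B a' x * eqnL (G a') x (jetIx k f x)
          + ∑ a', ∑ l, A a' l x * dd1 l (fun x => eqnL (G a') x (jetIx k f x)) x) ∧
      ∀ a' l, A a' l 0 ≠ 0 → a.deg = k ∧ Mult a'.1.1 l ∧
        (μ (a'.shift l).pos < μ (a.shift j).pos ∨ a'.shift l = a.shift j) := by
  classical
  obtain ⟨C, hC, hCeq, hC0⟩ := exists_analytic_coefficients (φ := eqFun Q G)
    (ψ := eqnD (G a) j) (lp := leadIx Q) (μ := fun i => μ i.pos)
    (fun s i => analyticAt_eqFun hG s _) (fun i => analyticAt_eqnD_single (hG a) j _)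
    (leadIx_injective Q) (eqFun_lead hG0) (eqFun_single hw hG0)
    (hker.mono fun x hx v hv => hx v hv a ha j)
  refine ⟨fun a' => if h : a' ∈ Q then C (Sum.inl ⟨a', h⟩) else fun _ => 0,
    fun a' l => if h : (a'.deg = k ∧ Mult a'.1.1 l) ∧ a' ∈ Q then
      C (Sum.inr ⟨⟨(a', l), h.1⟩, h.2⟩) else fun _ => 0, fun a' => ?_, fun a' l => ?_, ?_, ?_⟩
  · beta_reduce
    split_ifs with h
    · exact hC _
    · exact analyticAt_const
  · beta_reduce
    split_ifs with h
    · exact hC _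
    · exact analyticAt_const
  · have hGev : ∀ᶠ x in 𝓝 (0 : Sp n), ∀ a b, AnalyticAt ℝ (G a b) x := by
      rw [eventually_all]
      intro a
      rw [eventually_all]
      exact fun b => (hG a b).eventually_analyticAt
    filter_upwards [hCeq, hGev, hf.eventually_analyticAt] with x h1 h2 h3
    rw [dd1_eqnL j (h2 a) h3, h1, Fintype.sum_sum_type]
    congr 1
    · rw [← Finset.sum_subset (Finset.subset_univ (Finset.univ.filter fun a' => a' ∈ Q))]
      · rw [Finset.sum_subtype (p := fun a' => a' ∈ Q) _ (by simp)]
        refine Finset.sum_congr rfl fun a' _ => ?_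
        rw [dif_pos a'.2]
        rfl
      · intro a' _ ha'
        have ha'' : a' ∉ Q := fun h => ha' (by simpa using h)
        rw [dif_neg ha'', zero_mul]
    · rw [← Fintype.sum_prod_type']
      have e1 : ∀ p : {p : MultPair n k // p.1.1 ∈ Q},
          C (Sum.inr p) x * eqFun Q G (Sum.inr p) x (jetIx (k + 1) f x)
          = (fun q : Ix n k × Fin n => (if h : (q.1.deg = k ∧ Mult q.1.1.1 q.2) ∧ q.1 ∈ Q then
              C (Sum.inr ⟨⟨(q.1, q.2), h.1⟩, h.2⟩) else fun _ => 0) x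
              * dd1 q.2 (fun x => eqnL (G q.1) x (jetIx k f x)) x) p.1.1 := by
        intro p
        have hp : (p.1.1.1.deg = k ∧ Mult p.1.1.1.1.1 p.1.1.2) ∧ p.1.1.1 ∈ Q := ⟨p.1.2, p.2⟩
        beta_reduce
        rw [dif_pos hp, dd1_eqnL _ (h2 _) h3]
        rfl
      rw [Finset.sum_congr rfl fun p _ => e1 p]
      refine Finset.sum_of_injOn (fun p : {p : MultPair n k // p.1.1 ∈ Q} => p.1.1)
        (fun p _ q _ h => Subtype.ext (Subtype.ext h)) (fun _ _ => Finset.mem_coe.mpr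
          (Finset.mem_univ _)) ?_ fun p _ => rfl
      intro q _ hq
      rw [dif_neg, zero_mul]
      intro h
      exact hq ⟨⟨⟨q, h.1⟩, h.2⟩, by simp, rfl⟩
  · intro a' l hne
    beta_reduce at hne
    split_ifs at hne with h
    swap
    · exact absurd rfl hne
    obtain ⟨i, hi, hor⟩ := hC0 _ hne
    have hor' : i = a'.shift l ∨ μ (a'.shift l).pos < μ i.pos := hor
    have hdl : (a'.shift l).deg = k + 1 := by rw [Ix.deg_shift, h.1.1]
    by_cases hak : a.deg = k
    · refine ⟨hak, h.1.2, ?_⟩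
      rcases eqnD_single_of_deg_eq hw (hG0 a ha) hak hi with h1 | h1 <;> rcases hor' with h2 | h2
      · exact Or.inr (h2.symm.trans h1)
      · exact Or.inl (h1 ▸ h2)
      · exact Or.inl (h2 ▸ h1)
      · exact Or.inl (h2.trans h1)
    -- If the equation has order below k, its derivative at 0 involves orders at most k, too small a
    -- weight for the leading derivative, of order k+1, of a multiplicative derivative.
    · exfalso
      have hak' := lt_of_le_of_ne a.deg_le hak
      have hik : i.deg ≤ k := by
        obtain ⟨b, hb | ⟨hb, hs⟩⟩ := eqnD_single_cases hi
        · rw [← hb, Ix.deg_inc]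
          exact b.deg_le
        · rw [← hs, Ix.deg_shift]
          rcases eq_or_lt_of_coef (hG0 a ha) hb with rfl | hlt
          · exact hak'
          · by_contra hcon
            have := hw.lt_of_degree_lt b.pos a.pos (by
              change a.deg < b.deg
              omega) (b.deg_le.trans (Nat.le_succ k))
            omega
      have hlt : μ i.pos < μ (a'.shift l).pos := hw.lt_of_degree_lt _ _ (by
        change i.deg < (a'.shift l).deg
        omega) (a'.shift l).deg_le
      rcases hor' with h2 | h2
      · rw [h2] at hik
        omega
      · omega

end Compatibility

/-! ### Counting dimensions: multiplicative derivatives define the prolongation -/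

section DimensionCount

variable {n k : ℕ}

/-- A derivative of order k+1 is in exactly one way a derivative of order k shifted by a
multiplicative variable. -/
theorem card_ix_succ (n k : ℕ) :
    Nat.card (Ix n (k + 1)) = Nat.card (Ix n k) + Nat.card (MultPair n k) := by
  classical
  rw [← Nat.card_sum]
  refine (Nat.card_congr (Equiv.ofBijective
    (Sum.elim Ix.inc fun p : MultPair n k => p.1.1.shift p.1.2) ⟨?_, ?_⟩)).symm
  · rintro (a | p) (a' | p') h
    · exact congrArg Sum.inl (Ix.inc_injective h)
    · have h1 := congrArg Ix.deg h
      change a.inc.deg = (p'.1.1.shift p'.1.2).deg at h1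
      rw [Ix.deg_inc, Ix.deg_shift, p'.2.1] at h1
      have := a.deg_le
      omega
    · have h1 := congrArg Ix.deg h
      change (p.1.1.shift p.1.2).deg = a'.inc.deg at h1
      rw [Ix.deg_inc, Ix.deg_shift, p.2.1] at h1
      have := a'.deg_le
      omega
    · obtain ⟨h1, h2⟩ := shift_unique p.2.1 p'.2.1 p.2.2 p'.2.2 h
      exact congrArg Sum.inr (Subtype.ext (Prod.ext h1 h2))
  · intro c
    by_cases hc : c.1.1.degree ≤ k
    · exact ⟨Sum.inl (Ix.ofPos c.pos hc), rfl⟩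
    · have hck : c.1.1.degree ≤ k + 1 := c.deg_le
      have h0 : c.1.1 ≠ 0 := by
        intro h
        rw [h, map_zero] at hc
        omega
      obtain ⟨β, l, hβ, hl⟩ := exists_mult_add_single h0
      have hd : β.degree = k := by
        rw [hβ, degree_add_single] at hc hck
        omega
      refine ⟨Sum.inr ⟨(Ix.ofPos (β, c.2) hd.le, l), hd, hl⟩, ?_⟩
      exact Prod.ext (Subtype.ext hβ.symm) rfl

/-- The symbol of the prolongation of a system, at `x`. -/
noncomputable def topKer {P : Type*} (L : P → Ix n k → Sp n → ℝ) (x : Sp n) :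
    Submodule ℝ (Ix n (k + 1) → ℝ) where
  carrier := {t | (∀ b : Ix n k, t b.inc = 0) ∧ ∀ ρ j, eqnD (L ρ) j x t = 0}
  add_mem' := by
    rintro t t' ⟨h1, h2⟩ ⟨h1', h2'⟩
    refine ⟨fun b => ?_, fun ρ j => ?_⟩
    · rw [Pi.add_apply, h1, h1', add_zero]
    · rw [map_add, h2, h2', add_zero]
  zero_mem' := ⟨fun _ => rfl, fun _ _ => map_zero _⟩
  smul_mem' := by
    rintro c t ⟨h1, h2⟩
    refine ⟨fun b => ?_, fun ρ j => ?_⟩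
    · rw [Pi.smul_apply, h1, smul_zero]
    · rw [map_smul, h2, smul_zero]

/-- If the prolongation of a system is as large as Cartan's test predicts, then it is defined by the
equations and their multiplicative derivatives. -/
theorem eventually_ker_of_finrank {ν : (Fin n →₀ ℕ) →+ ℕ} {μ : Pos n → ℕ} (hw : IsWeight k ν μ)
    {Q : Set (Ix n k)} {G : Ix n k → Ix n k → Sp n → ℝ} (hG : ∀ a b, AnalyticAt ℝ (G a b) 0)
    (hG0 : ∀ a ∈ Q, ∀ b, tailCoef G a b 0 ≠ 0 → μ b.pos < μ a.pos)
    (hsurj : ∀ᶠ x in 𝓝 (0 : Sp n), ∀ u, (∀ a : Q, eqnL (G a) x u = 0) →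
      ∃ v : Ix n (k + 1) → ℝ, (∀ b, v b.inc = u b) ∧ ∀ (a : Q) j, eqnD (G a) j x v = 0)
    (hdim : ∀ᶠ x in 𝓝 (0 : Sp n), Nat.card {p : MultPair n k // p.1.1 ∉ Q}
      ≤ Module.finrank ℝ (topKer (fun a : Q => G a) x)) :
    ∀ᶠ x in 𝓝 (0 : Sp n), ∀ v, (∀ s, eqFun Q G s x v = 0) →
      ∀ a ∈ Q, ∀ j, eqnD (G a) j x v = 0 := by
  classical
  have hrank := eventually_finrank_iInf_ker (φ := eqFun Q G) (lp := leadIx Q)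
    (μ := fun i => μ i.pos) (fun s i => analyticAt_eqFun hG s _)
    (leadIx_injective Q) (eqFun_lead hG0) (eqFun_single hw hG0)
  filter_upwards [hsurj, hdim, hrank] with x hs hd hr
  set K := LinearMap.ker (LinearMap.pi fun s => eqFun Q G s x) with hK
  let Φ : (Ix n k → ℝ) →ₗ[ℝ] (Q → ℝ) := LinearMap.pi fun a : Q => eqnL (G a) x
  let Ψ : (Ix n (k + 1) → ℝ) →ₗ[ℝ] (Q × Fin n → ℝ) :=
    LinearMap.pi fun p : Q × Fin n => eqnD (G p.1) p.2 x
  let R : (Ix n (k + 1) → ℝ) →ₗ[ℝ] (Ix n k → ℝ) := LinearMap.funLeft ℝ ℝ Ix.inc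
  set D := LinearMap.ker (Φ ∘ₗ R) ⊓ LinearMap.ker Ψ with hD
  have memD : ∀ v, v ∈ D ↔ (∀ a : Q, eqnL (G a) x (R v) = 0) ∧
      ∀ (a : Q) j, eqnD (G a) j x v = 0 := by
    intro v
    rw [hD, Submodule.mem_inf, LinearMap.mem_ker, LinearMap.mem_ker, funext_iff, funext_iff]
    exact and_congr Iff.rfl ⟨fun h a j => h (a, j), fun h p => h p.1 p.2⟩
  have hDK : D ≤ K := by
    intro v hv
    obtain ⟨h1, h2⟩ := (memD v).mp hv
    rw [hK, LinearMap.mem_ker]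
    funext s
    rcases s with a | p
    · exact h1 a
    · exact h2 ⟨p.1.1.1, p.2⟩ p.1.1.2
  have hE : Fintype.card (Ix n k) ≤ Module.finrank ℝ (LinearMap.ker Φ) + Fintype.card Q := by
    have h1 := LinearMap.finrank_range_add_finrank_ker Φ
    have h2 := Submodule.finrank_le (LinearMap.range Φ)
    rw [Module.finrank_fintype_fun_eq_card] at h1 h2
    omega
  let f : D →ₗ[ℝ] (Ix n k → ℝ) := R ∘ₗ D.subtype
  have hf := LinearMap.finrank_range_add_finrank_ker f
  have hrange : Module.finrank ℝ (LinearMap.ker Φ) ≤ Module.finrank ℝ (LinearMap.range f) := by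
    refine Submodule.finrank_mono fun u hu => ?_
    obtain ⟨v, hv1, hv2⟩ := hs u fun a => congrFun hu a
    have hRv : R v = u := funext hv1
    refine ⟨⟨v, (memD v).mpr ⟨fun a => ?_, hv2⟩⟩, hRv⟩
    rw [hRv]
    exact congrFun hu a
  have hker : Module.finrank ℝ (topKer (fun a : Q => G a) x)
      ≤ Module.finrank ℝ (LinearMap.ker f) := by
    have hmem : ∀ t : topKer (fun a : Q => G a) x, t.1 ∈ D := fun t => by
      refine (memD _).mpr ⟨fun a => ?_, t.2.2⟩
      have : R t.1 = 0 := funext t.2.1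
      rw [this, map_zero]
    let g : topKer (fun a : Q => G a) x →ₗ[ℝ] LinearMap.ker f :=
      ((topKer (fun a : Q => G a) x).subtype.codRestrict D hmem).codRestrict (LinearMap.ker f)
        fun t => funext t.2.1
    refine LinearMap.finrank_le_finrank_of_injective (f := g) fun t t' h => Subtype.ext ?_
    exact congrArg (fun y : LinearMap.ker f => (y.1.1 : Ix n (k + 1) → ℝ)) h
  have hc := card_ix_succ n k
  have hc1 : Nat.card (MultPair n k) = Nat.card {p : MultPair n k // p.1.1 ∈ Q}
      + Nat.card {p : MultPair n k // p.1.1 ∉ Q} := by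
    rw [← Nat.card_sum]
    exact Nat.card_congr (Equiv.sumCompl fun p : MultPair n k => p.1.1 ∈ Q).symm
  rw [Fintype.card_sum] at hr
  rw [Nat.card_eq_fintype_card, Nat.card_eq_fintype_card] at hc
  have hc2 : Nat.card {p : MultPair n k // p.1.1 ∈ Q}
    = Fintype.card {p : MultPair n k // p.1.1 ∈ Q} := Nat.card_eq_fintype_card
  -- The functionals defining `K` are independent, so dim K = #Ix(k+1) − #Q − #(principal pairs).
  -- Fibring `D` over the k-jets gives dim D ≥ (#Ix(k) − #Q) + #(parametric pairs), the same number
  -- by `card_ix_succ`.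
  have hle : Module.finrank ℝ K ≤ Module.finrank ℝ D := by omega
  have hDK' := Submodule.eq_of_le_of_finrank_le hDK hle
  intro v hv a ha j
  have hvK : v ∈ K := by
    rw [hK, LinearMap.mem_ker]
    exact funext hv
  rw [← hDK'] at hvK
  exact ((memD v).mp hvK).2 ⟨a, ha⟩ j

end DimensionCount

/-! ### Normalization of a linear system -/

section Normalization

variable {n k : ℕ} {P : Type*} [Fintype P]

/-- The solutions at `x` of a linear system on jets. -/
noncomputable def solAt (L : P → Ix n k → Sp n → ℝ) (x : Sp n) : Submodule ℝ (Ix n k → ℝ) :=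
  LinearMap.ker (LinearMap.pi fun ρ => eqnL (L ρ) x)

/-- The derivatives that vanish on the part of class at least `i` of the symbol. -/
def belowClass (n k : ℕ) (i : Fin n) : Set (Ix n k) := {b | b.deg < k ∨ ¬ Mult b.1.1 i}

/-- `belowClass` is a lower set for the weight; this is the purpose of requiring weights to respect
order and class. -/
theorem finrank_class {ν : (Fin n →₀ ℕ) →+ ℕ} {μ : Pos n → ℕ} (hw : IsWeight k ν μ)
    (E : Submodule ℝ (Ix n k → ℝ)) (i : Fin n) :
    Module.finrank ℝ (E ⊓ vanishOn (belowClass n k i) : Submodule ℝ (Ix n k → ℝ))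
      = Nat.card {a : Ix n k // a ∈ pivots (fun b : Ix n k => μ b.pos) E ∧
          a ∉ belowClass n k i} := by
  have hμ : Function.Injective fun b : Ix n k => μ b.pos := fun a b h =>
    Ix.pos_injective (hw.inj _ _ a.deg_le b.deg_le h)
  refine finrank_inf_vanishOn hμ E _ fun a ha b hlt => ?_
  by_contra hb
  simp only [belowClass, Set.mem_ofPred_eq, not_or, not_not, not_lt] at hb ha
  have hbk : b.deg = k := le_antisymm b.deg_le hb.1
  by_cases hak : a.deg < k
  · have := hw.lt_of_degree_lt b.pos a.pos (by
      change a.deg < b.deg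
      omega) (b.deg_le.trans (Nat.le_succ k))
    omega
  · have hak' : a.deg = k := by
      have := a.deg_le
      omega
    have := hw.lt_of_mult b.pos a.pos i hbk hak' hb.2 (ha.resolve_left hak)
    omega

/-- Sorting the pairs by their multiplicative variable expresses the number of parametric pairs as
the sum occurring in Cartan's test. -/
theorem card_multPair {ν : (Fin n →₀ ℕ) →+ ℕ} {μ : Pos n → ℕ} (hw : IsWeight k ν μ)
    (E : Submodule ℝ (Ix n k → ℝ)) :
    Nat.card {p : MultPair n k // p.1.1 ∉ (pivots (fun b : Ix n k => μ b.pos) E)ᶜ}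
      = ∑ i, Module.finrank ℝ (E ⊓ vanishOn (belowClass n k i) : Submodule ℝ (Ix n k → ℝ)) := by
  classical
  simp only [finrank_class hw]
  rw [← Nat.card_sigma]
  refine Nat.card_congr
    { toFun := fun p => ⟨p.1.1.2, p.1.1.1, not_not.mp p.2, ?_⟩
      invFun := fun q => ⟨⟨(q.2.1, q.1), ?_⟩, not_not.mpr q.2.2.1⟩
      left_inv := fun p => rfl
      right_inv := fun q => rfl }
  · rintro (h | h)
    · exact absurd p.1.2.1 h.ne
    · exact h p.1.2.2
  · have h := q.2.2.2
    simp only [belowClass, Set.mem_ofPred_eq, not_or, not_not, not_lt] at h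
    exact ⟨le_antisymm q.2.1.deg_le h.1, h.2⟩

/-- The equations are recombined by the constant invertible matrix that brings them into echelon
form at 0. Being constant, it commutes with differentiation, so the system and its prolongation are
unchanged near 0; the condition on tails is only claimed at 0. -/
theorem exists_normal_system {ν : (Fin n →₀ ℕ) →+ ℕ} {μ : Pos n → ℕ} (hw : IsWeight k ν μ)
    {L : P → Ix n k → Sp n → ℝ} (hL : ∀ ρ b, AnalyticAt ℝ (L ρ b) 0)
    (h0 : Function.Surjective (LinearMap.pi fun ρ => eqnL (L ρ) 0 : (Ix n k → ℝ) →ₗ[ℝ] (P → ℝ))) :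
    ∃ (Q : Set (Ix n k)) (G : Ix n k → Ix n k → Sp n → ℝ),
      Q = (pivots (fun b : Ix n k => μ b.pos) (solAt L 0))ᶜ ∧
      (∀ a b, AnalyticAt ℝ (G a b) 0) ∧ (∀ a ∉ Q, ∀ b, G a b = fun _ => 0) ∧
      (∀ a ∈ Q, ∀ b, tailCoef G a b 0 ≠ 0 → μ b.pos < μ a.pos) ∧
      (∀ x u, (∀ a : Q, eqnL (G a) x u = 0) ↔ ∀ ρ, eqnL (L ρ) x u = 0) ∧
      ∀ᶠ x in 𝓝 (0 : Sp n), ∀ v,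
        (∀ (a : Q) j, eqnD (G a) j x v = 0) ↔ ∀ ρ j, eqnD (L ρ) j x v = 0 := by
  classical
  have hμ : Function.Injective fun b : Ix n k => μ b.pos := fun a b h =>
    Ix.pos_injective (hw.inj _ _ a.deg_le b.deg_le h)
  let Q : Set (Ix n k) := (pivots (fun b : Ix n k => μ b.pos) (solAt L 0))ᶜ
  obtain ⟨N, hN1, hN2⟩ : ∃ N : (P → ℝ) ≃ₗ[ℝ] (Q → ℝ),
      (∀ a b : Q, N ((LinearMap.pi fun ρ => eqnL (L ρ) 0 :
        (Ix n k → ℝ) →ₗ[ℝ] (P → ℝ)) (Pi.single b.1 1)) a = if a = b then 1 else 0) ∧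
      ∀ a : Q, ∀ b ∈ pivots (fun b : Ix n k => μ b.pos) (solAt L 0),
        N ((LinearMap.pi fun ρ => eqnL (L ρ) 0 :
          (Ix n k → ℝ) →ₗ[ℝ] (P → ℝ)) (Pi.single b 1)) a ≠ 0 → μ b.pos < μ a.1.pos :=
    exists_echelon hμ _ h0
  let c : Q → P → ℝ := fun a ρ => N (Pi.single ρ 1) a
  have hNc : ∀ (y : P → ℝ) (a : Q), N y a = ∑ ρ, c a ρ * y ρ := by
    intro y a
    have : y = ∑ ρ, y ρ • (Pi.single ρ 1 : P → ℝ) := (pi_eq_sum_univ' y)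
    conv_lhs => rw [this, map_sum]
    rw [Finset.sum_apply]
    refine Finset.sum_congr rfl fun ρ _ => ?_
    rw [map_smul, Pi.smul_apply, smul_eq_mul, mul_comm]
  let G : Ix n k → Ix n k → Sp n → ℝ := fun a b x =>
    if h : a ∈ Q then ∑ ρ, c ⟨a, h⟩ ρ * L ρ b x else 0
  have hGQ : ∀ (a : Q) b, G a b = fun x => ∑ ρ, c a ρ * L ρ b x := by
    intro a b
    funext x
    exact dif_pos a.2
  have hGQ' : ∀ a, a ∉ Q → ∀ b, G a b = fun _ => 0 := by
    intro a ha b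
    funext x
    exact dif_neg ha
  have hGan : ∀ {x : Sp n}, (∀ ρ b, AnalyticAt ℝ (L ρ b) x) → ∀ a b, AnalyticAt ℝ (G a b) x := by
    intro x hx a b
    by_cases ha : a ∈ Q
    · rw [hGQ ⟨a, ha⟩ b]
      exact Finset.analyticAt_fun_sum _ fun ρ _ => analyticAt_const.mul (hx ρ b)
    · rw [hGQ' a ha b]
      exact analyticAt_const
  have hNinj : ∀ y : P → ℝ, (∀ a : Q, ∑ ρ, c a ρ * y ρ = 0) ↔ ∀ ρ, y ρ = 0 := by
    intro y
    rw [← funext_iff (g := fun _ : P => (0 : ℝ))]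
    have h1 : N y = 0 ↔ y = 0 := N.map_eq_zero_iff
    refine Iff.trans ?_ h1
    rw [funext_iff]
    exact forall_congr' fun a => by rw [hNc]; rfl
  refine ⟨Q, G, rfl, hGan hL, hGQ', ?_, fun x u => ?_, ?_⟩
  · intro a ha b hne
    have hval : G a b 0 = N ((LinearMap.pi fun ρ => eqnL (L ρ) 0 :
        (Ix n k → ℝ) →ₗ[ℝ] (P → ℝ)) (Pi.single b 1)) ⟨a, ha⟩ := by
      rw [hNc, congrFun (hGQ ⟨a, ha⟩ b) 0]
      refine Finset.sum_congr rfl fun ρ _ => ?_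
      rw [LinearMap.pi_apply, eqnL_apply, Finset.sum_eq_single b]
      · rw [Pi.single_eq_same, mul_one]
      · intro b' _ hb'
        rw [Pi.single_eq_of_ne hb', mul_zero]
      · intro h
        exact absurd (Finset.mem_univ b) h
    have htail : tailCoef G a b 0 = G a b 0 - if a = b then 1 else 0 := by
      unfold tailCoef
      congr
    rw [htail, hval] at hne
    by_cases hb : b ∈ Q
    · have := hN1 ⟨a, ha⟩ ⟨b, hb⟩
      rw [this] at hne
      simp [Subtype.ext_iff] at hne
    · have hab : a ≠ b := fun h => hb (h ▸ ha)
      rw [if_neg hab, sub_zero] at hne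
      exact hN2 ⟨a, ha⟩ b (not_not.mp hb) hne
  · rw [← hNinj]
    refine forall_congr' fun a => ?_
    rw [eqnL_apply]
    have : ∑ b, G a b x * u b = ∑ ρ, c a ρ * eqnL (L ρ) x u := by
      simp only [hGQ, eqnL_apply, Finset.sum_mul, Finset.mul_sum]
      rw [Finset.sum_comm]
      exact Finset.sum_congr rfl fun _ _ => Finset.sum_congr rfl fun _ _ => by ring
    rw [this]
  · have hev : ∀ᶠ x in 𝓝 (0 : Sp n), ∀ ρ b, AnalyticAt ℝ (L ρ b) x := by
      rw [eventually_all]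
      intro a
      rw [eventually_all]
      exact fun b => (hL a b).eventually_analyticAt
    filter_upwards [hev] with x hx v
    have hdG : ∀ (a : Q) b j, dd1 j (G a b) x = ∑ ρ, c a ρ * dd1 j (L ρ b) x := by
      intro a b j
      have h1 : ∀ ρ ∈ (Finset.univ : Finset P), AnalyticAt ℝ (fun y => c a ρ * L ρ b y) x :=
        fun ρ _ => analyticAt_const.mul (hx ρ b)
      rw [hGQ, ← (dd_single j (Finset.analyticAt_fun_sum _ h1)).self_of_nhds,
        (dd_fun_sum _ _ h1).self_of_nhds]
      refine Finset.sum_congr rfl fun ρ _ => ?_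
      rw [(dd_const_mul _ _ (hx ρ b)).self_of_nhds]
      beta_reduce
      rw [(dd_single j (hx ρ b)).self_of_nhds]
    rw [forall_comm, forall_comm (α := P)]
    refine forall_congr' fun j => ?_
    rw [← hNinj]
    refine forall_congr' fun a => ?_
    have : eqnD (G a) j x v = ∑ ρ, c a ρ * eqnD (L ρ) j x v := by
      have hval : ∀ b, G a b x = ∑ ρ, c a ρ * L ρ b x := fun b => congrFun (hGQ a b) x
      simp only [eqnD_apply, hdG, hval, Finset.mul_sum, Finset.sum_mul]
      simp only [← Finset.sum_add_distrib]
      rw [Finset.sum_comm]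
      exact Finset.sum_congr rfl fun _ _ => Finset.sum_congr rfl fun _ _ => by ring
    rw [this]

end Normalization

/-! ### Solutions of involutive linear systems with prescribed parametric derivatives -/

section Solutions

variable {n k : ℕ} {P : Type*} [Fintype P]

theorem exists_analytic_arr_eq {U : Pos n → ℝ} {C s : ℝ}
    (hU : ∀ c, |U c| ≤ C * ((c.1.degree.factorial : ℝ) * s ^ c.1.degree)) (hC : 0 ≤ C)
    (hs : 0 ≤ s) : ∃ g : Sp n → Sp n, AnalyticAt ℝ g 0 ∧ arr g = U := by
  choose g hg hgU using fun i : Fin n =>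
    exists_analytic_dd_eq (U := fun α => U (α, i)) (C := C) (s := s) (fun α => by
      refine (hU (α, i)).trans (le_of_eq ?_)
      ring) hC hs
  have hG : AnalyticAt ℝ (fun x i => g i x : Sp n → Sp n) 0 := AnalyticAt.pi hg
  refine ⟨fun x i => g i x, hG, funext fun c => ?_⟩
  exact (dd_apply c.1 hG c.2).self_of_nhds.symm.trans (hgU c.2 c.1)

theorem exists_arr_bound {f : Sp n → Sp n} (hf : AnalyticAt ℝ f 0) (N : ℕ) :
    ∃ m : ℝ, 0 ≤ m ∧ ∀ a : Pos n, a.1.degree = N → |arr f a| ≤ m * (N.factorial : ℝ) := by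
  obtain ⟨C, σ, hC, hσ, h⟩ := exists_dd_bound hf
  refine ⟨C * σ ^ N, by positivity, ?_⟩
  rintro a rfl
  exact (norm_le_pi_norm (dd a.1 f 0) a.2).trans (h a.1)

/-- The solution operator of an involutive linear system: the Taylor coefficients of a solution
starting in degree `N` are determined, with bounds of geometric type, by those of degree `N`. -/
theorem exists_solution_operator {L : P → Ix n k → Sp n → ℝ}
    (hL : ∀ ρ b, AnalyticAt ℝ (L ρ b) 0)
    (h0 : Function.Surjective (LinearMap.pi fun ρ => eqnL (L ρ) 0 : (Ix n k → ℝ) →ₗ[ℝ] (P → ℝ)))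
    (hsurj : ∀ᶠ x in 𝓝 (0 : Sp n), ∀ u, (∀ ρ, eqnL (L ρ) x u = 0) →
      ∃ v : Ix n (k + 1) → ℝ, (∀ b, v b.inc = u b) ∧ ∀ ρ j, eqnD (L ρ) j x v = 0)
    (hdim : ∀ᶠ x in 𝓝 (0 : Sp n), Module.finrank ℝ (topKer L x)
      = ∑ i, Module.finrank ℝ
        (solAt L 0 ⊓ vanishOn (belowClass n k i) : Submodule ℝ (Ix n k → ℝ))) :
    ∃ s C : ℝ, 1 ≤ s ∧ 0 ≤ C ∧ ∀ N : ℕ, ∃ S : (Pos n → ℝ) →ₗ[ℝ] (Pos n → ℝ),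
      (∀ U, (∀ a : Pos n, a.1.degree = N → U a = 0) → S U = 0) ∧
      ∀ f : Sp n → Sp n, AnalyticAt ℝ f 0 →
        (∀ᶠ x in 𝓝 (0 : Sp n), ∀ ρ, eqnL (L ρ) x (jetIx k f x) = 0) →
        (∀ a : Pos n, a.1.degree < N → arr f a = 0) →
        (∃ g : Sp n → Sp n, AnalyticAt ℝ g 0 ∧
          (∀ᶠ x in 𝓝 (0 : Sp n), ∀ ρ, eqnL (L ρ) x (jetIx k g x) = 0) ∧ arr g = S (arr f)) ∧
        (∀ a : Pos n, a.1.degree ≤ N → S (arr f) a = arr f a) ∧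
        ∀ m : ℝ, 0 ≤ m → (∀ a : Pos n, a.1.degree = N → |arr f a| ≤ m * (N.factorial : ℝ)) →
          ∀ a : Pos n, |S (arr f) a| ≤ C * m * ((a.1.degree.factorial : ℝ) * s ^ a.1.degree) := by
  classical
  obtain ⟨ν, μ, hw⟩ := exists_isWeight n k
  obtain ⟨Q, G, hQ, hGan, hGQ, hG0, hsol, hprol⟩ := exists_normal_system hw hL h0
  have hker := eventually_ker_of_finrank hw hGan hG0 (by
    filter_upwards [hsurj, hprol] with x hx hp u hu
    obtain ⟨v, hv1, hv2⟩ := hx u ((hsol x u).mp hu)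
    exact ⟨v, hv1, (hp v).mpr hv2⟩) (by
    filter_upwards [hdim, hprol] with x hx hp
    have h1 : topKer (fun a : Q => G a) x = topKer L x := by
      ext t
      exact and_congr Iff.rfl (hp t)
    rw [h1, hx, hQ, card_multPair hw])
  obtain ⟨s₀, hs₀, hbound⟩ := exists_recAll_bound hw hGan hG0
  obtain ⟨D, hD⟩ := hw.exists_linear_bound
  obtain ⟨S, hS⟩ := exists_triangular_solution (T := recAll Q G) (μ := μ)
    fun c U hU => recAll_triangular hw hG0 c U fun c' h _ => hU c' h
  have hs₀0 : 0 ≤ s₀ := by linarith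
  have hest : ∀ (N : ℕ) (U : Pos n → ℝ) (m : ℝ), 0 ≤ m →
      (∀ a : Pos n, a.1.degree = N → |U a| ≤ m * (N.factorial : ℝ)) → ∀ a : Pos n,
        |S (paramData Q N U) a|
          ≤ 2 * s₀ ^ D * m * ((a.1.degree.factorial : ℝ) * (s₀ ^ D) ^ a.1.degree) := by
    intro N U m hm hU
    -- Induction on the weight with constant `2 * m`: the data contribute at most `m`, and the
    -- recursion halves `2 * m`.
    have key : ∀ (w : ℕ) (c : Pos n), μ c = w →
        |S (paramData Q N U) c| ≤ 2 * m * ((c.1.degree.factorial : ℝ) * s₀ ^ μ c) := by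
      intro w
      induction w using Nat.strong_induction_on with
      | _ w ih =>
        rintro c rfl
        have h1 := hbound c (S (paramData Q N U)) (2 * m) (by positivity)
          fun c' hc' => ih _ hc' c' rfl
        have h2 : |paramData Q N U c| ≤ m * ((c.1.degree.factorial : ℝ) * s₀ ^ μ c) := by
          by_cases hc : (∃ (a : Ix n k) (γ : Fin n →₀ ℕ), IsDec Q c a γ) ∨ c.1.degree ≠ N
          · rw [paramData_zero_of hc, abs_zero]
            positivity
          · rw [paramData_of hc]
            push Not at hc
            have h3 := hU c hc.2
            rw [← hc.2] at h3
            refine h3.trans ?_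
            have h4 : (1 : ℝ) ≤ s₀ ^ μ c := one_le_pow₀ hs₀
            gcongr
            exact le_mul_of_one_le_right (by positivity) h4
        rw [hS]
        refine (abs_add_le _ _).trans ?_
        linarith
    intro a
    refine (key _ a rfl).trans ?_
    have h1 : s₀ ^ μ a ≤ s₀ ^ (D * (a.1.degree + 1)) := pow_le_pow_right₀ hs₀ (hD a)
    calc 2 * m * ((a.1.degree.factorial : ℝ) * s₀ ^ μ a)
        ≤ 2 * m * ((a.1.degree.factorial : ℝ) * s₀ ^ (D * (a.1.degree + 1))) := by gcongr
      _ = _ := by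
        rw [pow_mul, pow_succ]
        ring
  -- From `s₀ ^ μ a ≤ s₀ ^ (D * (|a| + 1))`: the rate is `s₀ ^ D`, and the remaining power goes into
  -- the constant.
  refine ⟨s₀ ^ D, 2 * s₀ ^ D, one_le_pow₀ hs₀, by positivity, fun N =>
    ⟨S ∘ₗ paramData Q N, fun U hU => ?_, fun f hf hfL hf0 => ⟨?_, ?_, ?_⟩⟩⟩
  · have : paramData Q N U = 0 := by
      funext c
      by_cases hc : (∃ (a : Ix n k) (γ : Fin n →₀ ℕ), IsDec Q c a γ) ∨ c.1.degree ≠ N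
      · exact paramData_zero_of hc
      · rw [paramData_of hc]
        push Not at hc
        exact hU c hc.2
    rw [LinearMap.comp_apply, this, map_zero]
  · obtain ⟨m, hm, hmN⟩ := exists_arr_bound hf N
    obtain ⟨g, hg, hgU⟩ := exists_analytic_arr_eq (hest N (arr f) m hm hmN) (by positivity)
      (by positivity)
    refine ⟨g, hg, ?_, hgU⟩
    have han : ∀ a, AnalyticAt ℝ (fun x => eqnL (G a) x (jetIx k g x)) 0 :=
      fun a => analyticAt_eqnL (hGan a) hg
    have hres : ∀ a γ, dd γ (fun x => eqnL (G a) x (jetIx k g x)) 0 = 0 := by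
      refine residual_vanish hw han (fun a ha => ?_) (fun a ha γ h1 h2 => ?_)
        fun a ha j => exists_relation hw hGan hG0 hker hg a ha j
      · funext x
        rw [eqnL_apply]
        exact Finset.sum_eq_zero fun b _ => by rw [hGQ a ha b, zero_mul]
      -- Multiplicative derivatives of the residuals vanish by construction, because this is the
      -- recursion at a principal position, where the data are zero.
      · rw [dd_eqnL hGan a γ hg, hgU]
        have hdec : IsDec Q ((a.1.1 + γ, a.2) : Pos n) a γ := ⟨ha, rfl, h1, h2⟩
        rw [hS, recAll_of_isDec hdec, paramData_zero_of (Or.inl ⟨a, γ, hdec⟩), zero_add, sub_self]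
    have hev : ∀ᶠ x in 𝓝 (0 : Sp n), ∀ a, eqnL (G a) x (jetIx k g x) = 0 := by
      rw [eventually_all]
      exact fun a => eventually_eq_zero_of_dd (han a) (hres a)
    filter_upwards [hev] with x hx
    exact (hsol x _).mp fun a => hx a
  -- Through order N the given solution satisfies the same recursion with the same data, since its
  -- parametric derivatives of order below N vanish.
  · have hrec : ∀ c : Pos n, c.1.degree ≤ N →
        arr f c = paramData Q N (arr f) c + recAll Q G c (arr f) := by
      intro c hcN
      by_cases hc : ∃ (a : Ix n k) (γ : Fin n →₀ ℕ), IsDec Q c a γ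
      · rw [paramData_zero_of (Or.inl hc)]
        obtain ⟨a, γ, h⟩ := hc
        rw [recAll_of_isDec h]
        have h1 : (fun x => eqnL (G a) x (jetIx k f x)) =ᶠ[𝓝 0] fun _ => 0 := by
          filter_upwards [hfL] with x hx
          exact (hsol x _).mpr hx ⟨a, h.1⟩
        have h2 := dd_eqnL hGan a γ hf
        rw [(dd_congr γ h1).self_of_nhds, dd_fun_zero] at h2
        rw [h.2.1, zero_add]
        linarith
      · rw [recAll_of_not hc]
        by_cases hN : c.1.degree = N
        · rw [paramData_of (by
            rintro (h | h)
            · exact hc h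
            · exact h hN)]
          exact (add_zero _).symm
        · rw [paramData_zero_of (Or.inr hN), hf0 c (lt_of_le_of_ne hcN hN)]
          exact (add_zero _).symm
    have key : ∀ (w : ℕ) (c : Pos n), μ c = w → c.1.degree ≤ N →
        S (paramData Q N (arr f)) c = arr f c := by
      intro w
      induction w using Nat.strong_induction_on with
      | _ w ih =>
        rintro c rfl hcN
        have h1 : recAll Q G c (S (paramData Q N (arr f)) - arr f) = 0 :=
          recAll_triangular hw hG0 c _ fun c' h1 h2 =>
            sub_eq_zero.mpr (ih _ h1 c' rfl (h2.trans hcN))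
        rw [map_sub, sub_eq_zero] at h1
        rw [hS, h1, ← hrec c hcN]
    exact fun a ha => key _ a rfl ha
  · exact fun m hm hmN a => hest N (arr f) m hm hmN a

end Solutions

/-! ### Linear changes of coordinates -/

section Realisation

variable {n k : ℕ}

theorem dd_comp_sub (α : Fin n →₀ ℕ) (f : Sp n → Sp n) (x : Sp n) :
    dd α (fun z => f (z - x)) = fun z => dd α f (z - x) := by
  suffices ∀ l : List (Fin n), ddList l (fun z => f (z - x)) = fun z => ddList l f (z - x)
    from this _
  intro l
  induction l with
  | nil => rfl
  | cons i l ih =>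
    rw [ddList_cons, ih]
    funext z
    simp only [dd1, ddList_cons, fderiv_comp_sub]

/-- Extension of a jet by zero. -/
noncomputable def extIx (k : ℕ) : (Ix n k → ℝ) →ₗ[ℝ] (Pos n → ℝ) where
  toFun u c := if h : c.1.degree ≤ k then u (Ix.ofPos c h) else 0
  map_add' u v := by
    funext c
    simp only [Pi.add_apply]
    split_ifs <;> simp
  map_smul' r u := by
    funext c
    simp only [Pi.smul_apply, RingHom.id_apply]
    split_ifs <;> simp

theorem extIx_pos (u : Ix n k → ℝ) (b : Ix n k) : extIx k u b.pos = u b := dif_pos b.deg_le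

theorem extIx_of_le (u : Ix n k → ℝ) (c : Pos n) (h : c.1.degree ≤ k) :
    extIx k u c = u (Ix.ofPos c h) := dif_pos h

/-- Every jet is the jet of an analytic map. -/
theorem exists_jetIx_eq (x : Sp n) (u : Ix n k → ℝ) :
    ∃ f : Sp n → Sp n, AnalyticAt ℝ f x ∧ jetIx k f x = u := by
  obtain ⟨g, hg, hgU⟩ := exists_analytic_arr_eq (U := extIx k u) (C := ∑ b, |u b|) (s := 1)
    (fun c => by
      rw [one_pow, mul_one]
      have h1 : (1 : ℝ) ≤ (c.1.degree.factorial : ℝ) := by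
        exact_mod_cast Nat.factorial_pos _
      have h0 : 0 ≤ ∑ b, |u b| := Finset.sum_nonneg fun b _ => abs_nonneg _
      refine le_trans ?_ (le_mul_of_one_le_right h0 h1)
      by_cases hc : c.1.degree ≤ k
      · rw [extIx_of_le u c hc]
        exact Finset.single_le_sum (f := fun b => |u b|) (fun b _ => abs_nonneg _)
          (Finset.mem_univ _)
      · have : extIx k u c = 0 := dif_neg hc
        rw [this, abs_zero]
        exact h0) (Finset.sum_nonneg fun b _ => abs_nonneg _) zero_le_one
  refine ⟨fun z => g (z - x), ?_, ?_⟩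
  · refine AnalyticAt.comp (f := fun z => z - x) ?_ (analyticAt_id.sub analyticAt_const)
    rwa [sub_self]
  · funext b
    change dd b.1.1 (fun z => g (z - x)) x b.2 = _
    rw [dd_comp_sub]
    beta_reduce
    rw [sub_self, ← extIx_pos u b, ← hgU]
    rfl

end Realisation

/-! ### The chain rule on arrays of derivatives and on jets -/

section Change

variable {n k : ℕ} (B : Sp n ≃L[ℝ] Sp n)

/-- A sequence of directions with a given multi-index. -/
noncomputable def dirSeq (α : Fin n →₀ ℕ) : Fin α.degree → Fin n := (exists_seqIdx α).choose

theorem seqIdx_dirSeq (α : Fin n →₀ ℕ) : seqIdx (dirSeq α) = α := (exists_seqIdx α).choose_spec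

/-- The coefficients of the chain rule for `B`. -/
noncomputable def chgCoef (α : Fin n →₀ ℕ) (m : Fin α.degree → Fin n) : ℝ :=
  ∏ t, B (Pi.single (dirSeq α t) 1) (m t)

/-- The partial derivatives of `f ∘ B`, in terms of those of `f`. -/
noncomputable def chg : (Pos n → ℝ) →ₗ[ℝ] (Pos n → ℝ) :=
  LinearMap.pi fun c => ∑ m : Fin c.1.degree → Fin n,
    chgCoef B c.1 m • LinearMap.proj ((seqIdx m, c.2) : Pos n)

theorem chg_apply (U : Pos n → ℝ) (c : Pos n) :
    chg B U c = ∑ m : Fin c.1.degree → Fin n, chgCoef B c.1 m * U (seqIdx m, c.2) := by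
  simp [chg]

theorem iteratedFDeriv_comp_equiv (m : ℕ) (f : Sp n → Sp n) (y : Sp n) :
    iteratedFDeriv ℝ m (f ∘ B) y
      = (iteratedFDeriv ℝ m f (B y)).compContinuousLinearMap fun _ => (B : Sp n →L[ℝ] Sp n) := by
  simp only [← iteratedFDerivWithin_univ]
  exact B.iteratedFDerivWithin_comp_right f uniqueDiffOn_univ (Set.mem_univ _) m

theorem analyticAt_comp_equiv {f : Sp n → Sp n} {y : Sp n} (hf : AnalyticAt ℝ f (B y)) :
    AnalyticAt ℝ (f ∘ B) y :=
  hf.comp ((B : Sp n →L[ℝ] Sp n).analyticAt y)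

/-- Expand the m-linear derivative of `f`, evaluated on images of basis vectors under `B`, in
coordinates. -/
theorem dd_comp_equiv {f : Sp n → Sp n} {y : Sp n} (hf : AnalyticAt ℝ f (B y)) (c : Pos n) :
    dd c.1 (f ∘ B) y c.2 = chg B (fun c => dd c.1 f (B y) c.2) c := by
  have h1 : dd c.1 (f ∘ B) y = dd (seqIdx (dirSeq c.1)) (f ∘ B) y := by rw [seqIdx_dirSeq]
  rw [h1, dd_seqIdx _ (analyticAt_comp_equiv B hf), iteratedFDeriv_comp_equiv,
    ContinuousMultilinearMap.compContinuousLinearMap_apply]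
  have h2 : (fun t => (B : Sp n →L[ℝ] Sp n) (Pi.single (dirSeq c.1 t) 1))
      = fun t => ∑ l, B (Pi.single (dirSeq c.1 t) 1) l • (Pi.single l 1 : Sp n) := by
    funext t
    exact pi_eq_sum_univ' _
  rw [h2, ContinuousMultilinearMap.map_sum, Finset.sum_apply, chg_apply]
  refine Finset.sum_congr rfl fun m _ => ?_
  rw [ContinuousMultilinearMap.map_smul_univ, Pi.smul_apply, smul_eq_mul, ← dd_seqIdx m hf]
  rfl

theorem arr_comp_equiv {f : Sp n → Sp n} (hf : AnalyticAt ℝ f 0) :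
    arr (f ∘ B) = chg B (arr f) := by
  funext c
  have h0 : B 0 = 0 := map_zero B
  have := dd_comp_equiv B (f := f) (y := 0) (by rwa [h0]) c
  rw [h0] at this
  exact this

/-- The change of coordinates `B` on jets. -/
noncomputable def chgIx (k : ℕ) : (Ix n k → ℝ) →ₗ[ℝ] (Ix n k → ℝ) :=
  LinearMap.funLeft ℝ ℝ Ix.pos ∘ₗ chg B ∘ₗ extIx k

theorem jetIx_comp_equiv {f : Sp n → Sp n} {y : Sp n} (hf : AnalyticAt ℝ f (B y)) :
    jetIx k (f ∘ B) y = chgIx B k (jetIx k f (B y)) := by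
  funext b
  change dd b.1.1 (f ∘ B) y b.2 = chg B (extIx k (jetIx k f (B y))) b.pos
  refine (dd_comp_equiv B hf b.pos).trans ?_
  rw [chg_apply, chg_apply]
  refine Finset.sum_congr rfl fun m _ => ?_
  rw [extIx_of_le _ _ (by
    change (seqIdx m).degree ≤ k
    rw [seqIdx_degree]
    exact b.deg_le)]
  rfl

/-- Every jet is realised by an analytic map, and there the statement is composition with `B`
followed by its inverse. -/
theorem chgIx_symm_chgIx (u : Ix n k → ℝ) : chgIx B.symm k (chgIx B k u) = u := by
  obtain ⟨f, hf, rfl⟩ := exists_jetIx_eq (B 0) u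
  rw [← jetIx_comp_equiv B hf]
  have h1 : B.symm (B 0) = 0 := B.symm_apply_apply 0
  have h2 : AnalyticAt ℝ (f ∘ B) (B.symm (B 0)) := by
    rw [h1]
    exact analyticAt_comp_equiv B hf
  have h3 := jetIx_comp_equiv (k := k) B.symm h2
  rw [h1] at h3
  rw [← h3]
  congr 1
  funext z
  simp

theorem chgIx_chgIx_symm (u : Ix n k → ℝ) : chgIx B k (chgIx B.symm k u) = u := by
  have := chgIx_symm_chgIx (k := k) B.symm u
  rwa [ContinuousLinearEquiv.symm_symm] at this

theorem chgIx_refl (u : Ix n k → ℝ) : chgIx (ContinuousLinearEquiv.refl ℝ (Sp n)) k u = u := by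
  obtain ⟨f, hf, rfl⟩ := exists_jetIx_eq (0 : Sp n) u
  exact (jetIx_comp_equiv (k := k) (ContinuousLinearEquiv.refl ℝ (Sp n)) (y := 0) hf).symm

/-- The sum over sequences of products of matrix entries factors into a product of row sums, one for
each derivative. -/
theorem exists_chg_bound : ∃ β : ℝ, 1 ≤ β ∧ ∀ (U : Pos n → ℝ) (M : ℝ) (c : Pos n),
    (∀ a : Pos n, a.1.degree = c.1.degree → |U a| ≤ M) → |chg B U c| ≤ β ^ c.1.degree * M := by
  classical
  set β : ℝ := 1 + ∑ j, ∑ l, |B (Pi.single j 1) l| with hβ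
  refine ⟨β, ?_, fun U M c hU => ?_⟩
  · rw [hβ, le_add_iff_nonneg_right]
    exact Finset.sum_nonneg fun j _ => Finset.sum_nonneg fun l _ => abs_nonneg _
  · have hM : 0 ≤ M := (abs_nonneg _).trans (hU c rfl)
    rw [chg_apply]
    refine (Finset.abs_sum_le_sum_abs _ _).trans ?_
    calc ∑ m : Fin c.1.degree → Fin n, |chgCoef B c.1 m * U (seqIdx m, c.2)|
        ≤ ∑ m : Fin c.1.degree → Fin n,
            (∏ t, |B (Pi.single (dirSeq c.1 t) 1) (m t)|) * M := by
          refine Finset.sum_le_sum fun m _ => ?_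
          rw [abs_mul, chgCoef, Finset.abs_prod]
          exact mul_le_mul_of_nonneg_left (hU _ (seqIdx_degree m))
            (Finset.prod_nonneg fun t _ => abs_nonneg _)
      _ = (∏ t : Fin c.1.degree, ∑ l, |B (Pi.single (dirSeq c.1 t) 1) l|) * M := by
          rw [← Finset.sum_mul, Finset.prod_univ_sum, Fintype.piFinset_univ]
      _ ≤ β ^ c.1.degree * M := by
          refine mul_le_mul_of_nonneg_right ?_ hM
          refine (Finset.prod_le_prod (fun t _ => Finset.sum_nonneg fun l _ => abs_nonneg _)
            (fun t _ => ?_) (g := fun _ => β)).trans (le_of_eq (by simp))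
          have h1 : ∑ l, |B (Pi.single (dirSeq c.1 t) 1) l|
              ≤ ∑ j, ∑ l, |B (Pi.single j 1) l| :=
            Finset.single_le_sum (f := fun j => ∑ l, |B (Pi.single j 1) l|)
              (fun j _ => Finset.sum_nonneg fun l _ => abs_nonneg _) (Finset.mem_univ _)
          rw [hβ]
          linarith

/-! ### Linear equations in other coordinates -/

variable {P : Type*}

/-- The system `A` in the coordinates given by `B`. -/
noncomputable def chgSys (A : P → Ix n k → Sp n → ℝ) : P → Ix n k → Sp n → ℝ :=
  fun ρ b y => ∑ c, chgIx B.symm k (Pi.single b 1) c * A ρ c (B y)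

theorem analyticAt_chgSys {A : P → Ix n k → Sp n → ℝ} {y : Sp n}
    (hA : ∀ ρ b, AnalyticAt ℝ (A ρ b) (B y)) (ρ : P) (b : Ix n k) :
    AnalyticAt ℝ (chgSys B A ρ b) y :=
  Finset.analyticAt_fun_sum _ fun c _ => analyticAt_const.mul
    ((hA ρ c).comp ((B : Sp n →L[ℝ] Sp n).analyticAt y))

theorem eqnL_chgSys (A : P → Ix n k → Sp n → ℝ) (ρ : P) (y : Sp n) (u : Ix n k → ℝ) :
    eqnL (chgSys B A ρ) y u = eqnL (A ρ) (B y) (chgIx B.symm k u) := by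
  classical
  have hu : u = ∑ b, u b • (Pi.single b 1 : Ix n k → ℝ) := pi_eq_sum_univ' u
  rw [eqnL_apply, eqnL_apply]
  conv_rhs => rw [hu]
  simp only [map_sum, map_smul, Finset.sum_apply, Pi.smul_apply, smul_eq_mul, Finset.mul_sum,
    chgSys, Finset.sum_mul]
  rw [Finset.sum_comm]
  exact Finset.sum_congr rfl fun _ _ => Finset.sum_congr rfl fun _ _ => by ring

theorem eqnL_chgSys_jetIx (A : P → Ix n k → Sp n → ℝ) (ρ : P) {f : Sp n → Sp n} {y : Sp n}
    (hf : AnalyticAt ℝ f (B y)) :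
    eqnL (chgSys B A ρ) y (jetIx k (f ∘ B) y) = eqnL (A ρ) (B y) (jetIx k f (B y)) := by
  rw [eqnL_chgSys, jetIx_comp_equiv B hf, chgIx_symm_chgIx]

/-- After realising `v` as the jet of an analytic `f`, both sides are the derivative of the same
function along `B e_j`. -/
theorem eqnD_chgSys {A : P → Ix n k → Sp n → ℝ} {y : Sp n}
    (hA : ∀ ρ b, AnalyticAt ℝ (A ρ b) (B y)) (ρ : P) (j : Fin n) (v : Ix n (k + 1) → ℝ) :
    eqnD (chgSys B A ρ) j y (chgIx B (k + 1) v)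
      = ∑ l, B (Pi.single j 1) l * eqnD (A ρ) l (B y) v := by
  obtain ⟨f, hf, rfl⟩ := exists_jetIx_eq (B y) v
  rw [← jetIx_comp_equiv B hf, ← dd1_eqnL j (analyticAt_chgSys B hA ρ)
    (analyticAt_comp_equiv B hf)]
  have hev : (fun z => eqnL (chgSys B A ρ) z (jetIx k (f ∘ B) z))
      =ᶠ[𝓝 y] (fun x => eqnL (A ρ) x (jetIx k f x)) ∘ B := by
    filter_upwards [B.continuous.continuousAt.eventually hf.eventually_analyticAt] with z hz
    exact eqnL_chgSys_jetIx B A ρ hz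
  rw [(dd1_congr j hev).self_of_nhds]
  have hd : DifferentiableAt ℝ (fun x => eqnL (A ρ) x (jetIx k f x)) (B y) :=
    (analyticAt_eqnL (hA ρ) hf).differentiableAt
  have h1 : dd1 j ((fun x => eqnL (A ρ) x (jetIx k f x)) ∘ B) y
      = fderiv ℝ (fun x => eqnL (A ρ) x (jetIx k f x)) (B y) (B (Pi.single j 1)) := by
    rw [dd1, fderiv_comp y hd B.differentiableAt, ContinuousLinearMap.comp_apply,
      ContinuousLinearEquiv.fderiv]
    rfl
  have h2 : B (Pi.single j 1) = ∑ l, B (Pi.single j 1) l • (Pi.single l 1 : Sp n) :=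
    pi_eq_sum_univ' _
  rw [h1, h2, map_sum]
  refine Finset.sum_congr rfl fun l _ => ?_
  rw [map_smul, smul_eq_mul, ← dd1_eqnL l (hA ρ) hf, ← h2]
  rfl

end Change

/-! ### Polynomial vector fields and their jets -/

section Polynomials

variable {n : ℕ}

theorem hasFDerivAt_eval (p : MvPolynomial (Fin n) ℝ) (x : Sp n) :
    HasFDerivAt (fun y : Sp n => MvPolynomial.eval y p)
      (∑ l, MvPolynomial.eval x (MvPolynomial.pderiv l p) •
        (ContinuousLinearMap.proj l : Sp n →L[ℝ] ℝ)) x := by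
  classical
  induction p using MvPolynomial.induction_on with
  | C a => simpa using hasFDerivAt_const a x
  | add p q hp hq =>
    have := hp.add hq
    refine (this.congr_fderiv ?_).congr_of_eventuallyEq (Eventually.of_forall fun y => ?_)
    · simp only [map_add, add_smul, Finset.sum_add_distrib]
    · simp
  | mul_X p i hp =>
    have := hp.mul (ContinuousLinearMap.proj (R := ℝ) (φ := fun _ : Fin n => ℝ) i).hasFDerivAt
    refine (this.congr_fderiv ?_).congr_of_eventuallyEq (Eventually.of_forall fun y => ?_)
    · ext1 v
      simp only [add_apply, smul_apply, sum_apply, ContinuousLinearMap.proj_apply, smul_eq_mul,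
        Derivation.leibniz, MvPolynomial.pderiv_X, map_add, map_mul, MvPolynomial.eval_X,
        Finset.mul_sum, add_mul, Finset.sum_add_distrib]
      congr 1
      · rw [Finset.sum_eq_single i]
        · simp
        · intro l _ hl
          simp [Pi.single_eq_of_ne' hl]
        · simp
      · exact Finset.sum_congr rfl fun l _ => by ring
    · simp

/-- The map given by a polynomial vector field. -/
noncomputable def polyFun (w : Fin n → MvPolynomial (Fin n) ℝ) : Sp n → Sp n :=
  fun x i => MvPolynomial.eval x (w i)

theorem analyticAt_polyFun (w : Fin n → MvPolynomial (Fin n) ℝ) (x : Sp n) :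
    AnalyticAt ℝ (polyFun w) x := by
  refine AnalyticAt.pi fun i => ?_
  have h := AnalyticAt.aeval_mvPolynomial (𝕜 := ℝ) (f := fun x : Sp n => x) (z := x)
    (fun i => (ContinuousLinearMap.proj (R := ℝ) (φ := fun _ : Fin n => ℝ) i).analyticAt x) (w i)
  refine h.congr (Eventually.of_forall fun y => ?_)
  simp [polyFun]

theorem fderiv_polyFun (w : Fin n → MvPolynomial (Fin n) ℝ) (x v : Sp n) :
    fderiv ℝ (polyFun w) x v = polyFun (dirDeriv v w) x := by
  have h : HasFDerivAt (polyFun w) (ContinuousLinearMap.pi fun i =>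
      ∑ l, MvPolynomial.eval x (MvPolynomial.pderiv l (w i)) •
        (ContinuousLinearMap.proj l : Sp n →L[ℝ] ℝ)) x :=
    hasFDerivAt_pi.mpr fun i => hasFDerivAt_eval (w i) x
  rw [h.fderiv]
  funext i
  simp [polyFun, dirDeriv, mul_comm]

theorem dirDeriv_single (j : Fin n) (w : Fin n → MvPolynomial (Fin n) ℝ) (i : Fin n) :
    dirDeriv (Pi.single j 1) w i = MvPolynomial.pderiv j (w i) := by
  classical
  simp only [dirDeriv, LinearMap.pi_apply, LinearMap.comp_apply, LinearMap.proj_apply,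
    LinearMap.sum_apply, LinearMap.smul_apply]
  rw [Finset.sum_eq_single j]
  · simp
  · intro l _ hl
    rw [Pi.single_eq_of_ne hl, zero_smul]
  · simp

theorem arr_polyFun (w : Fin n → MvPolynomial (Fin n) ℝ) (c : Pos n) :
    arr (polyFun w) c = (mfact c.1 : ℝ) * MvPolynomial.coeff c.1 (w c.2) := by
  suffices ∀ (m : ℕ) (w : Fin n → MvPolynomial (Fin n) ℝ) (c : Pos n), c.1.degree = m →
    arr (polyFun w) c = (mfact c.1 : ℝ) * MvPolynomial.coeff c.1 (w c.2) from this _ w c rfl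
  clear w c
  intro m
  induction m with
  | zero =>
    rintro w ⟨α, i⟩ hc
    have h0 : α = 0 := (Finsupp.degree_eq_zero_iff α).mp hc
    subst h0
    have h1 : (mfact (0 : Fin n →₀ ℕ) : ℝ) = 1 := by simp [mfact]
    rw [h1, one_mul, arr]
    rw [dd_zero]
    change MvPolynomial.eval 0 (w i) = _
    rw [← MvPolynomial.constantCoeff_eq, ← MvPolynomial.eval_zero]
  | succ m ih =>
    rintro w ⟨α, i⟩ hc
    have h0 : α ≠ 0 := by
      rintro rfl
      simp at hc
    obtain ⟨β, j, rfl⟩ := exists_eq_add_single h0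
    have hβ : β.degree = m := by
      rw [degree_add_single] at hc
      omega
    have h1 : dd1 j (polyFun w) = polyFun (dirDeriv (Pi.single j 1) w) :=
      funext fun x => fderiv_polyFun w x _
    have h2 := ih (dirDeriv (Pi.single j 1) w) (β, i) hβ
    rw [arr] at h2 ⊢
    rw [(dd_add_single' β j (analyticAt_polyFun w 0)).self_of_nhds, h1, h2, dirDeriv_single,
      MvPolynomial.coeff_pderiv, mfact_add_single]
    push_cast
    ring

theorem eq_zero_of_arr_polyFun {w : Fin n → MvPolynomial (Fin n) ℝ}
    (h : arr (polyFun w) = 0) : w = 0 := by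
  funext i
  ext α
  have h1 := arr_polyFun w (α, i)
  rw [h] at h1
  have := (mul_eq_zero.mp h1.symm).resolve_left (mfact_ne_zero α)
  rw [this]
  simp

theorem mem_HomVF {m : ℕ} {w : Fin n → MvPolynomial (Fin n) ℝ} :
    w ∈ HomVF n m ↔ ∀ i, (w i).IsHomogeneous m := by
  simp [HomVF, Submodule.mem_pi, MvPolynomial.mem_homogeneousSubmodule]

theorem arr_polyFun_of_ne {m : ℕ} {w : Fin n → MvPolynomial (Fin n) ℝ} (hw : w ∈ HomVF n m)
    {c : Pos n} (hc : c.1.degree ≠ m) : arr (polyFun w) c = 0 := by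
  rw [arr_polyFun, (mem_HomVF.mp hw c.2).coeff_eq_zero hc, mul_zero]

theorem dirDeriv_mem_HomVF {m : ℕ} {w : Fin n → MvPolynomial (Fin n) ℝ} (hw : w ∈ HomVF n (m + 1))
    (v : Sp n) : dirDeriv v w ∈ HomVF n m := by
  rw [mem_HomVF] at hw ⊢
  intro i
  simp only [dirDeriv, LinearMap.pi_apply, LinearMap.comp_apply, LinearMap.proj_apply,
    LinearMap.sum_apply, LinearMap.smul_apply]
  refine MvPolynomial.IsHomogeneous.sum _ _ _ fun l _ => ?_
  exact (MvPolynomial.homogeneousSubmodule (Fin n) ℝ m).smul_mem _ (hw i).pderiv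

/-- The derivatives of order at most `k` at the origin of a polynomial vector field. -/
noncomputable def polyIx (k : ℕ) : (Fin n → MvPolynomial (Fin n) ℝ) →ₗ[ℝ] (Ix n k → ℝ) :=
  LinearMap.pi fun b => LinearMap.proj b.2 ∘ₗ LinearMap.proj b.1 ∘ₗ polyJet k

theorem polyIx_apply (k : ℕ) (w : Fin n → MvPolynomial (Fin n) ℝ) (b : Ix n k) :
    polyIx k w b = arr (polyFun w) b.pos := (arr_polyFun w b.pos).symm

theorem jetIx_polyFun (k : ℕ) (w : Fin n → MvPolynomial (Fin n) ℝ) :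
    jetIx k (polyFun w) 0 = polyIx k w := funext fun b => (polyIx_apply k w b).symm

/-- Every homogeneous jet is the jet of a homogeneous polynomial vector field. -/
theorem exists_HomVF {m : ℕ} (t : Ix n m → ℝ) (ht : ∀ b : Ix n m, b.deg ≠ m → t b = 0) :
    ∃ w ∈ HomVF n m, polyIx m w = t := by
  classical
  refine ⟨fun i => ∑ α : ↥(idxLE n m), MvPolynomial.monomial α.1 (t (α, i) / mfact α.1), ?_, ?_⟩
  · rw [mem_HomVF]
    intro i
    refine MvPolynomial.IsHomogeneous.sum _ _ _ fun α _ => ?_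
    by_cases hα : α.1.degree = m
    · exact MvPolynomial.isHomogeneous_monomial _ hα
    · rw [ht (α, i) hα, zero_div, map_zero]
      exact MvPolynomial.isHomogeneous_zero _ _ _
  · funext b
    change (mfact b.1.1 : ℝ) * MvPolynomial.coeff b.1.1 (∑ α : ↥(idxLE n m),
      MvPolynomial.monomial α.1 (t (α, b.2) / mfact α.1)) = t b
    rw [MvPolynomial.coeff_sum, Finset.sum_eq_single b.1]
    · rw [MvPolynomial.coeff_monomial, if_pos rfl, mul_div_cancel₀ _ (mfact_ne_zero _)]
    · intro α _ hα
      rw [MvPolynomial.coeff_monomial, if_neg fun h => hα (Subtype.ext h)]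
    · simp

end Polynomials

/-! ### Symbols in adapted coordinates -/

section Symbols

variable {n k : ℕ}

theorem finrank_eq_of_bijOn {V W : Type*} [AddCommGroup V] [Module ℝ V] [AddCommGroup W]
    [Module ℝ W] {p : Submodule ℝ V} {q : Submodule ℝ W} (f : V →ₗ[ℝ] W)
    (h : ∀ x ∈ p, f x ∈ q) (hinj : ∀ x ∈ p, f x = 0 → x = 0)
    (hsurj : ∀ y ∈ q, ∃ x ∈ p, f x = y) : Module.finrank ℝ p = Module.finrank ℝ q := by
  refine (LinearEquiv.ofBijective (f.restrict h) ⟨?_, ?_⟩).finrank_eq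
  · rw [← LinearMap.ker_eq_bot, LinearMap.ker_eq_bot']
    intro x hx
    exact Subtype.ext (hinj x.1 x.2 (congrArg Subtype.val hx))
  · rintro ⟨y, hy⟩
    obtain ⟨x, hx, hxy⟩ := hsurj y hy
    exact ⟨⟨x, hx⟩, Subtype.ext hxy⟩

/-- The symbol of the linear equation `E` on jets. -/
noncomputable def symbOf (E : Submodule ℝ (Ix n k → ℝ)) :
    Submodule ℝ (Fin n → MvPolynomial (Fin n) ℝ) := HomVF n k ⊓ E.comap (polyIx k)

/-- The prolonged symbol. -/
noncomputable def prolOf (E : Submodule ℝ (Ix n k → ℝ)) :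
    Submodule ℝ (Fin n → MvPolynomial (Fin n) ℝ) :=
  HomVF n (k + 1) ⊓ ⨅ v : Sp n, (symbOf E).comap (dirDeriv v)

/-- The elements of the symbol killed by the derivatives along `b j`, `j < i`. -/
noncomputable def classOf (E : Submodule ℝ (Ix n k → ℝ)) (b : Fin n → Sp n) (i : Fin n) :
    Submodule ℝ (Fin n → MvPolynomial (Fin n) ℝ) :=
  symbOf E ⊓ ⨅ j : {j : Fin n // j < i}, LinearMap.ker (dirDeriv (b j.1))

/-- The prolonged symbol as a space of jets. -/
noncomputable def prolIx (E : Submodule ℝ (Ix n k → ℝ)) : Submodule ℝ (Ix n (k + 1) → ℝ) where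
  carrier := {t | (∀ b : Ix n k, t b.inc = 0) ∧ ∀ j, (fun b : Ix n k => t (b.shift j)) ∈ E}
  add_mem' := by
    rintro t t' ⟨h1, h2⟩ ⟨h1', h2'⟩
    exact ⟨fun b => by rw [Pi.add_apply, h1, h1', add_zero], fun j => E.add_mem (h2 j) (h2' j)⟩
  zero_mem' := ⟨fun _ => rfl, fun _ => E.zero_mem⟩
  smul_mem' := by
    rintro c t ⟨h1, h2⟩
    exact ⟨fun b => by rw [Pi.smul_apply, h1, smul_zero], fun j => E.smul_mem c (h2 j)⟩

/-- On jets without part of order at most k, the terms with differentiated coefficients drop out of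
the prolonged equations. -/
theorem topKer_eq_prolIx {P : Type*} (L : P → Ix n k → Sp n → ℝ) (x : Sp n) :
    topKer L x = prolIx (LinearMap.ker (LinearMap.pi fun ρ => eqnL (L ρ) x)) := by
  ext t
  refine and_congr_right fun ht => ?_
  have h : ∀ ρ j, eqnD (L ρ) j x t = eqnL (L ρ) x fun b => t (b.shift j) := by
    intro ρ j
    rw [eqnD_apply, eqnL_apply]
    exact Finset.sum_congr rfl fun b _ => by rw [ht, mul_zero, zero_add]
  simp only [h, LinearMap.mem_ker, funext_iff, LinearMap.pi_apply, Pi.zero_apply]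
  exact forall_comm

variable (B : Sp n ≃L[ℝ] Sp n)

theorem arr_polyFun_comp_add_single (w : Fin n → MvPolynomial (Fin n) ℝ) (β : Fin n →₀ ℕ)
    (j i : Fin n) : arr (polyFun w ∘ B) (β + Finsupp.single j 1, i)
      = arr (polyFun (dirDeriv (B (Pi.single j 1)) w) ∘ B) (β, i) := by
  have h1 : dd1 j (polyFun w ∘ B) = polyFun (dirDeriv (B (Pi.single j 1)) w) ∘ B := by
    funext y
    rw [dd1, fderiv_comp y (analyticAt_polyFun w _).differentiableAt B.differentiableAt,
      ContinuousLinearMap.comp_apply, ContinuousLinearEquiv.fderiv]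
    exact fderiv_polyFun w (B y) _
  rw [arr, arr]
  rw [(dd_add_single' β j (analyticAt_comp_equiv B (analyticAt_polyFun w _))).self_of_nhds, h1]

theorem arr_polyFun_comp_of_ne {m : ℕ} {w : Fin n → MvPolynomial (Fin n) ℝ} (hw : w ∈ HomVF n m)
    {c : Pos n} (hc : c.1.degree ≠ m) : arr (polyFun w ∘ B) c = 0 := by
  rw [arr_comp_equiv B (analyticAt_polyFun w 0), chg_apply]
  refine Finset.sum_eq_zero fun j _ => ?_
  rw [arr_polyFun_of_ne hw (by
    change (seqIdx j).degree ≠ m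
    rwa [seqIdx_degree]), mul_zero]

theorem eq_zero_of_arr_polyFun_comp {w : Fin n → MvPolynomial (Fin n) ℝ}
    (h : arr (polyFun w ∘ B) = 0) : w = 0 := by
  refine eq_zero_of_arr_polyFun ?_
  have h0 : B 0 = 0 := map_zero B
  have h1 := arr_comp_equiv B.symm (analyticAt_comp_equiv B (y := 0) (analyticAt_polyFun w _))
  rw [h, map_zero] at h1
  rw [← h1]
  congr 1
  funext z
  simp

theorem chgIx_polyIx (m : ℕ) (w : Fin n → MvPolynomial (Fin n) ℝ) (b : Ix n m) :
    chgIx B m (polyIx m w) b = arr (polyFun w ∘ B) b.pos := by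
  have h0 : B 0 = 0 := map_zero B
  have h1 := jetIx_comp_equiv (k := m) B (y := 0) (analyticAt_polyFun w _)
  rw [h0, jetIx_polyFun] at h1
  rw [← h1]
  rfl

theorem chgIx_eq_zero {m : ℕ} {t : Ix n m → ℝ} (ht : ∀ b : Ix n m, b.deg ≠ m → t b = 0)
    (b : Ix n m) (hb : b.deg ≠ m) : chgIx B m t b = 0 := by
  obtain ⟨w, hw, rfl⟩ := exists_HomVF t ht
  rw [chgIx_polyIx]
  exact arr_polyFun_comp_of_ne B hw hb

theorem eq_zero_of_chgIx_polyIx {m : ℕ} {w : Fin n → MvPolynomial (Fin n) ℝ} (hw : w ∈ HomVF n m)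
    (h : chgIx B m (polyIx m w) = 0) : w = 0 := by
  refine eq_zero_of_arr_polyFun_comp B (funext fun c => ?_)
  by_cases hc : c.1.degree = m
  · have h1 := congrFun h (Ix.ofPos c hc.le)
    rw [chgIx_polyIx] at h1
    exact h1
  · exact arr_polyFun_comp_of_ne B hw hc

theorem exists_HomVF_chgIx {m : ℕ} {t : Ix n m → ℝ} (ht : ∀ b : Ix n m, b.deg ≠ m → t b = 0) :
    ∃ w ∈ HomVF n m, chgIx B m (polyIx m w) = t := by
  obtain ⟨w, hw, hwt⟩ := exists_HomVF (chgIx B.symm m t) (chgIx_eq_zero B.symm ht)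
  exact ⟨w, hw, by rw [hwt, chgIx_chgIx_symm]⟩

/-- Membership of all directional derivatives can be checked on a basis. -/
theorem dirDeriv_mem_of_basis {S : Submodule ℝ (Fin n → MvPolynomial (Fin n) ℝ)}
    {w : Fin n → MvPolynomial (Fin n) ℝ} (h : ∀ j, dirDeriv (B (Pi.single j 1)) w ∈ S) (v : Sp n) :
    dirDeriv v w ∈ S := by
  have hv : v = ∑ j, B.symm v j • B (Pi.single j 1) := by
    have h1 : B.symm v = ∑ j, B.symm v j • (Pi.single j 1 : Sp n) := pi_eq_sum_univ' _
    have h2 := congrArg B h1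
    rw [B.apply_symm_apply, map_sum] at h2
    rw [h2]
    refine Finset.sum_congr rfl fun j _ => ?_
    rw [map_smul, ← h2]
  have hd : dirDeriv v w = ∑ j, B.symm v j • dirDeriv (B (Pi.single j 1)) w := by
    funext i
    conv_lhs => rw [hv]
    simp only [dirDeriv, LinearMap.pi_apply, LinearMap.comp_apply, LinearMap.proj_apply,
      LinearMap.sum_apply, LinearMap.smul_apply, Finset.sum_apply, Pi.smul_apply, smul_eq_mul,
      Finset.sum_smul, Finset.smul_sum, mul_smul]
    rw [Finset.sum_comm]
  rw [hd]
  exact S.sum_mem fun j _ => S.smul_mem _ (h j)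

/-- In the coordinates of `B`, differentiating a polynomial field along `B e_j` is a shift by `j` of
its jet. The case of the identity translates the polynomial definition of the prolonged symbol into
jets. -/
theorem finrank_prolOf (E : Submodule ℝ (Ix n k → ℝ)) :
    Module.finrank ℝ (prolOf E) = Module.finrank ℝ (prolIx (E.comap (chgIx B.symm k))) := by
  have hshift : ∀ (w : Fin n → MvPolynomial (Fin n) ℝ) (j : Fin n),
      (fun b : Ix n k => chgIx B (k + 1) (polyIx (k + 1) w) (b.shift j))
        = chgIx B k (polyIx k (dirDeriv (B (Pi.single j 1)) w)) := by
    intro w j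
    funext b
    rw [chgIx_polyIx, chgIx_polyIx]
    exact arr_polyFun_comp_add_single B w b.1.1 j b.2
  refine finrank_eq_of_bijOn (chgIx B (k + 1) ∘ₗ polyIx (k + 1)) ?_ ?_ ?_
  · rintro w ⟨hw, hwE⟩
    refine ⟨fun b => ?_, fun j => ?_⟩
    · rw [LinearMap.comp_apply, chgIx_polyIx]
      refine arr_polyFun_comp_of_ne B hw ?_
      have := b.deg_le
      change b.deg ≠ k + 1
      omega
    · have h1 := ((Submodule.mem_iInf _).mp hwE (B (Pi.single j 1))).2
      change (fun b : Ix n k => chgIx B (k + 1) (polyIx (k + 1) w) (b.shift j)) ∈ _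
      rw [hshift, Submodule.mem_comap, chgIx_symm_chgIx]
      exact h1
  · rintro w ⟨hw, -⟩ h
    exact eq_zero_of_chgIx_polyIx B hw h
  · rintro t ⟨ht, htE⟩
    obtain ⟨w, hw, rfl⟩ := exists_HomVF_chgIx B (t := t) fun b hb => by
      have h1 : b.1.1.degree ≤ k := by
        have := b.deg_le
        change b.deg ≤ k
        omega
      exact ht (Ix.ofPos b.pos h1)
    refine ⟨w, ⟨hw, (Submodule.mem_iInf _).mpr fun v => ?_⟩, rfl⟩
    refine dirDeriv_mem_of_basis B (S := symbOf E) (fun j => ?_) v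
    refine ⟨dirDeriv_mem_HomVF hw _, ?_⟩
    have h1 := htE j
    rw [hshift, Submodule.mem_comap, chgIx_symm_chgIx] at h1
    exact h1

/-- A polynomial field is killed by the derivative along `B e_j` exactly when, in the coordinates of
`B`, no coefficient whose multi-index involves `j` survives. -/
theorem finrank_classOf (E : Submodule ℝ (Ix n k → ℝ)) (i : Fin n) :
    Module.finrank ℝ (classOf E (fun j => B (Pi.single j 1)) i)
      = Module.finrank ℝ (E.comap (chgIx B.symm k) ⊓ vanishOn (belowClass n k i) :
        Submodule ℝ (Ix n k → ℝ)) := by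
  refine finrank_eq_of_bijOn (chgIx B k ∘ₗ polyIx k) ?_ ?_ ?_
  · rintro w ⟨⟨hw, hwE⟩, hwi⟩
    refine ⟨?_, ?_⟩
    · rw [LinearMap.comp_apply]
      change chgIx B.symm k (chgIx B k (polyIx k w)) ∈ E
      rw [chgIx_symm_chgIx]
      exact hwE
    · rintro b (hb | hb)
      · rw [LinearMap.comp_apply, chgIx_polyIx]
        exact arr_polyFun_comp_of_ne B hw hb.ne
      · unfold Mult at hb
        push Not at hb
        obtain ⟨j, hji, hj⟩ := hb
        obtain ⟨β, hβ⟩ : ∃ β : Fin n →₀ ℕ, b.1.1 = β + Finsupp.single j 1 := by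
          refine ⟨b.1.1 - Finsupp.single j 1, ?_⟩
          rw [tsub_add_cancel_of_le]
          rw [Finsupp.single_le_iff]
          exact Nat.one_le_iff_ne_zero.mpr hj
        have h1 := (Submodule.mem_iInf _).mp hwi ⟨j, hji⟩
        rw [LinearMap.comp_apply, chgIx_polyIx]
        change arr (polyFun w ∘ B) (b.1.1, b.2) = 0
        rw [hβ, arr_polyFun_comp_add_single, LinearMap.mem_ker.mp h1,
          arr_polyFun_comp_of_ne (m := β.degree + 1) B (Submodule.zero_mem _) (by
            change β.degree ≠ β.degree + 1
            omega)]
  · rintro w ⟨⟨hw, -⟩, -⟩ h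
    exact eq_zero_of_chgIx_polyIx B hw h
  · rintro t ⟨htE, htv⟩
    obtain ⟨w, hw, rfl⟩ := exists_HomVF_chgIx B (t := t) fun b hb =>
      htv b (Or.inl (lt_of_le_of_ne b.deg_le hb))
    change chgIx B.symm k (chgIx B k (polyIx k w)) ∈ E at htE
    rw [chgIx_symm_chgIx] at htE
    refine ⟨w, ⟨⟨hw, htE⟩, (Submodule.mem_iInf _).mpr fun j => ?_⟩, rfl⟩
    rw [LinearMap.mem_ker]
    refine eq_zero_of_arr_polyFun_comp B (funext fun c => ?_)
    change arr (polyFun (dirDeriv (B (Pi.single j.1 1)) w) ∘ B) (c.1, c.2) = 0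
    rw [← arr_polyFun_comp_add_single]
    by_cases hc : (c.1 + Finsupp.single j.1 1).degree = k
    · have h1 := htv (Ix.ofPos (c.1 + Finsupp.single j.1 1, c.2) hc.le) (Or.inr fun h => by
        have h2 := h j.1 j.2
        change (c.1 + Finsupp.single j.1 1 : Fin n →₀ ℕ) j.1 = 0 at h2
        simp at h2)
      rw [chgIx_polyIx] at h1
      exact h1
    · exact arr_polyFun_comp_of_ne B hw hc

end Symbols

/-! ### The solution operator in coordinates adapted to Cartan's test -/

section Adapted

variable {n k : ℕ}

theorem chg_congr (B : Sp n ≃L[ℝ] Sp n) {U V : Pos n → ℝ} {c : Pos n}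
    (h : ∀ a : Pos n, a.1.degree = c.1.degree → U a = V a) : chg B U c = chg B V c := by
  rw [chg_apply, chg_apply]
  exact Finset.sum_congr rfl fun m _ => by rw [h _ (seqIdx_degree m)]

theorem chg_symm_arr (B : Sp n ≃L[ℝ] Sp n) {f : Sp n → Sp n} (hf : AnalyticAt ℝ f 0) :
    chg B.symm (chg B (arr f)) = arr f := by
  have h0 : B 0 = 0 := map_zero B
  rw [← arr_comp_equiv B hf, ← arr_comp_equiv B.symm (analyticAt_comp_equiv B (by rwa [h0]))]
  congr 1
  funext z
  simp

theorem chgIx_inc (B : Sp n ≃L[ℝ] Sp n) (v : Ix n (k + 1) → ℝ) (b : Ix n k) :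
    chgIx B (k + 1) v b.inc = chgIx B k (fun b => v b.inc) b := by
  obtain ⟨f, hf, rfl⟩ := exists_jetIx_eq (B 0) v
  have h : (fun b : Ix n k => jetIx (k + 1) f (B 0) b.inc) = jetIx k f (B 0) := rfl
  rw [h, ← jetIx_comp_equiv B hf, ← jetIx_comp_equiv B hf]
  rfl

theorem solAt_chgSys {P : Type*} (B : Sp n ≃L[ℝ] Sp n) (A : P → Ix n k → Sp n → ℝ) (y : Sp n) :
    solAt (chgSys B A) y = (solAt A (B y)).comap (chgIx B.symm k) := by
  ext u
  simp only [solAt, LinearMap.mem_ker, Submodule.mem_comap, funext_iff, LinearMap.pi_apply,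
    eqnL_chgSys]

/-- The solution operator, for a system whose symbol satisfies Cartan's test in the basis `e`. -/
theorem exists_solution_operator_of_cartan {P : Type*} [Fintype P] {A : P → Ix n k → Sp n → ℝ}
    (hA : ∀ ρ b, AnalyticAt ℝ (A ρ b) 0)
    (h0 : Function.Surjective (LinearMap.pi fun ρ => eqnL (A ρ) 0 : (Ix n k → ℝ) →ₗ[ℝ] (P → ℝ)))
    (hsurj : ∀ᶠ x in 𝓝 (0 : Sp n), ∀ u, (∀ ρ, eqnL (A ρ) x u = 0) →
      ∃ v : Ix n (k + 1) → ℝ, (∀ b, v b.inc = u b) ∧ ∀ ρ j, eqnD (A ρ) j x v = 0)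
    (e : Module.Basis (Fin n) ℝ (Sp n))
    (hdim : ∀ᶠ x in 𝓝 (0 : Sp n), Module.finrank ℝ (prolOf (solAt A x))
      = ∑ i, Module.finrank ℝ (classOf (solAt A 0) e i)) :
    ∃ s C : ℝ, 1 ≤ s ∧ 0 ≤ C ∧ ∀ N : ℕ, ∃ S : (Pos n → ℝ) →ₗ[ℝ] (Pos n → ℝ),
      (∀ U, (∀ a : Pos n, a.1.degree = N → U a = 0) → S U = 0) ∧
      ∀ f : Sp n → Sp n, AnalyticAt ℝ f 0 →
        (∀ᶠ x in 𝓝 (0 : Sp n), ∀ ρ, eqnL (A ρ) x (jetIx k f x) = 0) →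
        (∀ a : Pos n, a.1.degree < N → arr f a = 0) →
        (∃ g : Sp n → Sp n, AnalyticAt ℝ g 0 ∧
          (∀ᶠ x in 𝓝 (0 : Sp n), ∀ ρ, eqnL (A ρ) x (jetIx k g x) = 0) ∧ arr g = S (arr f)) ∧
        (∀ a : Pos n, a.1.degree ≤ N → S (arr f) a = arr f a) ∧
        ∀ m : ℝ, 0 ≤ m → (∀ a : Pos n, a.1.degree = N → |arr f a| ≤ m * (N.factorial : ℝ)) →
          ∀ a : Pos n, |S (arr f) a| ≤ C * m * ((a.1.degree.factorial : ℝ) * s ^ a.1.degree) := by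
  -- `B` carries the standard basis to `e`, so the class filtration of the new coordinates is the
  -- one in Cartan's test.
  set B : Sp n ≃L[ℝ] Sp n := e.equivFun.symm.toContinuousLinearEquiv with hB
  have hBe : (fun j => B (Pi.single j 1)) = e := by
    funext j
    simp [hB]
  have hB0 : B 0 = 0 := map_zero B
  have hBt : Tendsto B (𝓝 0) (𝓝 0) := by
    have := B.continuous.tendsto 0
    rwa [hB0] at this
  have hBst : Tendsto B.symm (𝓝 0) (𝓝 0) := by
    have := B.symm.continuous.tendsto 0
    rwa [map_zero] at this
  obtain ⟨s, C, hs, hC, hop⟩ := exists_solution_operator (L := chgSys B A)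
    (analyticAt_chgSys B (by rwa [hB0])) (fun z => by
      obtain ⟨u, hu⟩ := h0 z
      refine ⟨chgIx B k u, ?_⟩
      rw [← hu]
      funext ρ
      rw [LinearMap.pi_apply, LinearMap.pi_apply, eqnL_chgSys, chgIx_symm_chgIx, hB0]) (by
    have hev : ∀ᶠ x in 𝓝 (0 : Sp n), ∀ ρ b, AnalyticAt ℝ (A ρ b) x := by
      rw [eventually_all]
      intro a
      rw [eventually_all]
      exact fun b => (hA a b).eventually_analyticAt
    filter_upwards [hBt.eventually hev, hBt.eventually hsurj] with y hy1 hy2 u hu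
    obtain ⟨v, hv1, hv2⟩ := hy2 (chgIx B.symm k u) fun ρ => by
      rw [← eqnL_chgSys]
      exact hu ρ
    refine ⟨chgIx B (k + 1) v, fun b => ?_, fun ρ j => ?_⟩
    · have : (fun b : Ix n k => v b.inc) = chgIx B.symm k u := funext hv1
      rw [chgIx_inc, this, chgIx_chgIx_symm]
    · rw [eqnD_chgSys B hy1]
      exact Finset.sum_eq_zero fun l _ => by rw [hv2, mul_zero]) (by
    filter_upwards [hBt.eventually hdim] with y hy
    have h1 : topKer (chgSys B A) y = prolIx ((solAt A (B y)).comap (chgIx B.symm k)) := by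
      rw [topKer_eq_prolIx, ← solAt_chgSys]
      rfl
    rw [h1, ← finrank_prolOf, hy, ← hBe]
    refine Finset.sum_congr rfl fun i _ => ?_
    rw [finrank_classOf, solAt_chgSys, hB0])
  obtain ⟨β, hβ, hβb⟩ := exists_chg_bound B
  obtain ⟨β', hβ', hβb'⟩ := exists_chg_bound B.symm
  have hβ0 : 0 ≤ β := by linarith
  have hβ0' : 0 ≤ β' := by linarith
  have hs0 : 0 ≤ s := by linarith
  -- Transforming the data costs β^N and transforming back costs β' to the order. Only orders at
  -- least N matter, so β^N also goes into the rate and `C` stays independent of N.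
  refine ⟨β * β' * s, C, ?_, hC, fun N => ?_⟩
  · exact one_le_mul_of_one_le_of_one_le (one_le_mul_of_one_le_of_one_le hβ hβ') hs
  obtain ⟨S, hS0, hS⟩ := hop N
  refine ⟨chg B.symm ∘ₗ S ∘ₗ chg B, fun U hU => ?_, fun f hf hfA hf0 => ?_⟩
  · rw [LinearMap.comp_apply, LinearMap.comp_apply, hS0 _ fun a ha => ?_, map_zero]
    rw [chg_congr B (V := 0) fun c hc => hU c (hc.trans ha), map_zero]
    rfl
  have hfB : AnalyticAt ℝ (f ∘ B) 0 := analyticAt_comp_equiv B (by rwa [hB0])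
  have harr : chg B (arr f) = arr (f ∘ B) := (arr_comp_equiv B hf).symm
  obtain ⟨⟨g, hg, hgL, hgS⟩, hagree, hbd⟩ := hS (f ∘ B) hfB (by
    filter_upwards [hBt.eventually hfA, hBt.eventually hf.eventually_analyticAt] with y hy1 hy2 ρ
    rw [eqnL_chgSys_jetIx B A ρ hy2]
    exact hy1 ρ) fun a ha => by
      rw [← harr, chg_congr B (V := 0) fun c hc => hf0 c (hc.trans_lt ha), map_zero]
      rfl
  have hlow : ∀ a : Pos n, a.1.degree ≤ N →
      (chg B.symm ∘ₗ S ∘ₗ chg B) (arr f) a = arr f a := by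
    intro a ha
    rw [LinearMap.comp_apply, LinearMap.comp_apply, harr,
      chg_congr B.symm fun c hc => hagree c (hc.trans_le ha), ← harr, chg_symm_arr B hf]
  refine ⟨⟨g ∘ B.symm, analyticAt_comp_equiv B.symm (by rwa [map_zero]), ?_, ?_⟩, hlow, ?_⟩
  · filter_upwards [hBst.eventually hgL, hBst.eventually hg.eventually_analyticAt]
      with x hx1 hx2 ρ
    have h1 : AnalyticAt ℝ (g ∘ B.symm) (B (B.symm x)) := by
      rw [B.apply_symm_apply]
      exact analyticAt_comp_equiv B.symm hx2
    have h2 := eqnL_chgSys_jetIx B A ρ h1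
    have h3 : (g ∘ B.symm) ∘ B = g := by
      funext z
      simp
    rw [h3, hx1 ρ, B.apply_symm_apply] at h2
    exact h2.symm
  · rw [arr_comp_equiv B.symm hg, hgS, LinearMap.comp_apply, LinearMap.comp_apply, harr]
  · intro m hm hmN a
    rcases lt_or_ge a.1.degree N with ha | ha
    · rw [hlow a ha.le, hf0 a ha, abs_zero]
      positivity
    · have h1 := hbd (β ^ N * m) (by positivity) fun c hc => by
        rw [← harr]
        refine (hβb (arr f) (m * (N.factorial : ℝ)) c fun c' hc' =>
          hmN c' (hc'.trans hc)).trans (le_of_eq ?_)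
        rw [hc]
        ring
      rw [LinearMap.comp_apply, LinearMap.comp_apply, harr]
      refine (hβb' _ (C * (β ^ N * m) * ((a.1.degree.factorial : ℝ) * s ^ a.1.degree)) a
        fun c hc => by
          rw [← hc]
          exact h1 c).trans ?_
      have h2 : β ^ N ≤ β ^ a.1.degree := pow_le_pow_right₀ hβ ha
      calc β' ^ a.1.degree * (C * (β ^ N * m) * ((a.1.degree.factorial : ℝ) * s ^ a.1.degree))
          ≤ β' ^ a.1.degree
            * (C * (β ^ a.1.degree * m) * ((a.1.degree.factorial : ℝ) * s ^ a.1.degree)) := by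
            gcongr
        _ = _ := by
            rw [mul_pow, mul_pow]
            ring

end Adapted

/-! ### Functions vanishing on a submanifold, and families of constant rank -/

section ConstantRank

/-- Being constant on the level set, `φ` has a constrained extremum at `q`. Lagrange multipliers
give a relation between `φ'` and `f'`, and the coefficient of `φ'` is nonzero because `f'` is onto.
-/
theorem apply_eq_zero_of_vanish {E F : Type*} [NormedAddCommGroup E] [NormedSpace ℝ E]
    [CompleteSpace E] [NormedAddCommGroup F] [NormedSpace ℝ F] [CompleteSpace F] {f : E → F}
    {f' : E →L[ℝ] F} {φ : E → ℝ} {φ' : E →L[ℝ] ℝ} {q : E} (hf : HasStrictFDerivAt f f' q)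
    (hφ : HasStrictFDerivAt φ φ' q) (hsurj : Function.Surjective f')
    (h : ∀ᶠ p in 𝓝 q, f p = f q → φ p = φ q) {w : E} (hw : f' w = 0) : φ' w = 0 := by
  have hext : IsLocalExtrOn φ {p | f p = f q} q :=
    Or.inl (eventually_nhdsWithin_iff.mpr (h.mono fun p hp hps => (hp hps).ge))
  obtain ⟨Λ, Λ₀, hne, hΛ⟩ := hext.exists_linear_map_of_hasStrictFDerivAt hf hφ
  have h0 : Λ₀ ≠ 0 := by
    rintro rfl
    apply hne
    rw [Prod.mk_eq_zero]
    refine ⟨LinearMap.ext fun y => ?_, rfl⟩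
    obtain ⟨x, rfl⟩ := hsurj y
    have := hΛ x
    rwa [zero_smul, add_zero] at this
  have := hΛ w
  rw [hw, map_zero, zero_add] at this
  exact (smul_eq_zero.mp this).resolve_left h0

/-- A right inverse onto the range composed with a projection to the range satisfies the first
identity; sandwiching `M` between two copies of it yields both. -/
theorem exists_generalized_inverse {X Y : Type*} [AddCommGroup X] [Module ℝ X] [AddCommGroup Y]
    [Module ℝ Y] (M : X →ₗ[ℝ] Y) :
    ∃ S : Y →ₗ[ℝ] X, (∀ x, M (S (M x)) = M x) ∧ ∀ y, S (M (S y)) = S y := by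
  obtain ⟨r, hr⟩ := M.rangeRestrict.exists_rightInverse_of_surjective M.range_rangeRestrict
  obtain ⟨p, hp⟩ := (LinearMap.range M).subtype.exists_leftInverse_of_injective
    (LinearMap.range M).ker_subtype
  have h1 : ∀ x, M (r (p (M x))) = M x := by
    intro x
    have h2 : p (M x) = M.rangeRestrict x := LinearMap.congr_fun hp (M.rangeRestrict x)
    have h3 := LinearMap.congr_fun hr (M.rangeRestrict x)
    rw [h2]
    exact congrArg Subtype.val h3
  refine ⟨r ∘ₗ p ∘ₗ M ∘ₗ r ∘ₗ p, fun x => ?_, fun y => ?_⟩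
  · simp only [LinearMap.comp_apply, h1]
  · simp only [LinearMap.comp_apply, h1]

variable {Z X Y : Type*} [NormedAddCommGroup Z] [NormedSpace ℝ Z] [NormedAddCommGroup X]
  [NormedSpace ℝ X] [FiniteDimensional ℝ X] [NormedAddCommGroup Y] [NormedSpace ℝ Y]
  [FiniteDimensional ℝ Y]

/-- Equations for the ranges of a family of linear maps, at the points where the rank is
constant. -/
theorem exists_range_equation {M : Z → X →L[ℝ] Y} {c : Z → Y} {q : Z} (hM : ContDiffAt ℝ 1 M q)
    (hc : ContDiffAt ℝ 1 c q) (hcq : c q = 0) (l : Y →L[ℝ] ℝ) (hl : ∀ x, l (M q x) = 0) :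
    ∃ φ : Z → ℝ, φ q = 0 ∧ HasStrictFDerivAt φ (l ∘L fderiv ℝ c q) q ∧
      ∀ᶠ p in 𝓝 q, Module.finrank ℝ (LinearMap.ker (M p : X →ₗ[ℝ] Y))
        = Module.finrank ℝ (LinearMap.ker (M q : X →ₗ[ℝ] Y)) →
        (∃ x, M p x = c p) → φ p = 0 := by
  have : CompleteSpace X := FiniteDimensional.complete ℝ X
  obtain ⟨S', hS1', hS2'⟩ := exists_generalized_inverse (M q : X →ₗ[ℝ] Y)
  set S : Y →L[ℝ] X := LinearMap.toContinuousLinearMap S' with hS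
  have hS1 : ∀ x, M q (S (M q x)) = M q x := hS1'
  have hS2 : ∀ y, S (M q (S y)) = S y := hS2'
  clear_value S
  clear hS1' hS2'
  set T : Z → X →L[ℝ] X := fun p => 1 + S ∘L (M p - M q) with hT
  have hTq : T q = ((1 : (X →L[ℝ] X)ˣ) : X →L[ℝ] X) := by
    simp [hT]
  have hTc : ContDiffAt ℝ 1 T q :=
    contDiffAt_const.add (contDiffAt_const.clm_comp (hM.sub contDiffAt_const))
  have hinv : ContDiffAt ℝ 1 (fun p => Ring.inverse (T p)) q := by
    refine ContDiffAt.comp (g := Ring.inverse) q ?_ hTc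
    rw [hTq]
    exact contDiffAt_ringInverse ℝ _
  have hK : ContDiffAt ℝ 1 (fun p => (M p) ∘L ((Ring.inverse (T p)) ∘L S)) q :=
    hM.clm_comp (hinv.clm_comp contDiffAt_const)
  have hφ : ContDiffAt ℝ 1 (fun p => l (c p) - l ((M p ∘L (Ring.inverse (T p) ∘L S)) (c p))) q :=
    (l.contDiff.contDiffAt.comp q hc).sub (l.contDiff.contDiffAt.comp q (hK.clm_apply hc))
  have hφ' : HasFDerivAt (fun p => l (c p) - l ((M p ∘L (Ring.inverse (T p) ∘L S)) (c p)))
      (l ∘L fderiv ℝ c q) q := by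
    -- The subtracted term has zero derivative at q: its operator part multiplies `c q = 0`, and `l`
    -- annihilates the range of `M q`.
    have h1 := (hc.differentiableAt one_ne_zero).hasFDerivAt
    have h2 := (hK.differentiableAt one_ne_zero).hasFDerivAt.clm_apply h1
    refine ((l.hasFDerivAt.comp q h1).sub (l.hasFDerivAt.comp q h2)).congr_fderiv ?_
    ext w
    simp [hcq, hl]
  refine ⟨fun p => l (c p) - l ((M p ∘L (Ring.inverse (T p) ∘L S)) (c p)), ?_, ?_, ?_⟩
  · simp [hcq]
  · rw [← hφ'.fderiv]
    exact hφ.hasStrictFDerivAt one_ne_zero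
  · have hunit : ∀ᶠ p in 𝓝 q, IsUnit (T p) := by
      refine hTc.continuousAt.eventually (Units.isOpen.mem_nhds ?_)
      rw [hTq]
      exact Units.isUnit _
    filter_upwards [hunit] with p hp hrank hx
    obtain ⟨x, hx⟩ := hx
    obtain ⟨u, hu⟩ := hp
    have hSM : ∀ x, S (M p x) = S (M q (T p x)) := by
      intro x
      simp [hT, hS2]
    -- Constancy of the rank enters here: T(p) embeds ker S M(p) into ker M(q), whose dimension is
    -- that of ker M(p).
    have hker : LinearMap.ker (M p : X →ₗ[ℝ] Y)
        = LinearMap.ker ((S ∘L M p : X →L[ℝ] X) : X →ₗ[ℝ] X) := by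
      refine Submodule.eq_of_le_of_finrank_le (fun x hx => ?_) ?_
      · have hx' : M p x = 0 := hx
        change S (M p x) = 0
        rw [hx', map_zero]
      · rw [hrank]
        have hmem : ∀ x ∈ LinearMap.ker ((S ∘L M p : X →L[ℝ] X) : X →ₗ[ℝ] X),
            (T p : X →ₗ[ℝ] X) x ∈ LinearMap.ker (M q : X →ₗ[ℝ] Y) := by
          intro x hx
          have hx' : S (M p x) = 0 := hx
          change M q (T p x) = 0
          rw [← hS1, ← hSM, hx', map_zero]
        refine LinearMap.finrank_le_finrank_of_injective
          (f := (T p : X →ₗ[ℝ] X).restrict hmem) fun x y hxy => Subtype.ext ?_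
        have h1 : T p x.1 = T p y.1 := congrArg Subtype.val hxy
        have h2 : ∀ z, (↑u⁻¹ : X →L[ℝ] X) (T p z) = z := by
          intro z
          rw [← hu, ← mul_apply_eq_comp, Units.inv_mul]
          rfl
        rw [← h2 x.1, h1, h2]
    have hTinv : ∀ z, T p (Ring.inverse (T p) z) = z := by
      intro z
      rw [← hu, Ring.inverse_unit, ← mul_apply_eq_comp, Units.mul_inv]
      rfl
    have hmem : x - Ring.inverse (T p) (S (M p x)) ∈ LinearMap.ker (M p : X →ₗ[ℝ] Y) := by
      rw [hker]
      change S (M p (x - Ring.inverse (T p) (S (M p x)))) = 0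
      rw [map_sub, map_sub, hSM (Ring.inverse (T p) _), hTinv, hS2, sub_self]
    have hz : M p x - M p (Ring.inverse (T p) (S (M p x))) = 0 := by
      rw [← map_sub]
      exact hmem
    change l (c p) - l (M p (Ring.inverse (T p) (S (c p)))) = 0
    rw [← hx, ← map_sub, hz, map_zero]

end ConstantRank

/-! ### The linearization of an involutive system -/

section Geometry

variable {n k : ℕ}

/-- Vertical tangent vectors of the jet space. -/
noncomputable def vert : (Ix n k → ℝ) →L[ℝ] Jet n k :=
  LinearMap.toContinuousLinearMap
    ((LinearMap.inr ℝ (Sp n) (JetFib n k)) ∘ₗ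
      (LinearEquiv.curry ℝ ℝ ↥(idxLE n k) (Fin n)).toLinearMap)

theorem vert_apply (u : Ix n k → ℝ) : vert u = (0, fun α i => u (α, i)) := rfl

/-- The vertical tangent space, in coordinates. -/
noncomputable def tanIx (R : Set (Jet n k)) (p : Jet n k) : Submodule ℝ (Ix n k → ℝ) :=
  (vertTangent R p).comap (LinearEquiv.curry ℝ ℝ ↥(idxLE n k) (Fin n)).toLinearMap

theorem symbProl_eq (R : Set (Jet n k)) (p : Jet n k) : symbProl R p = prolOf (tanIx R p) := rfl

variable {R : Set (Jet n k)} {r : ℕ} {W : Set (Jet n k)} {Φ : Jet n k → (Fin r → ℝ)}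

theorem IsLocalEq.surjective_vert (h : IsLocalEq R W Φ) {p : Jet n k} (hW : p ∈ W) (hR : p ∈ R)
    (z : Fin r → ℝ) : ∃ u : Ix n k → ℝ, fderiv ℝ Φ p (vert u) = z := by
  obtain ⟨u, hu⟩ := h.onto p hW hR z
  exact ⟨fun b => u b.1 b.2, hu⟩

theorem IsLocalEq.hasStrictFDerivAt (h : IsLocalEq R W Φ) {p : Jet n k} (hW : p ∈ W) :
    HasStrictFDerivAt Φ (fderiv ℝ Φ p) p := (h.analytic p hW).hasStrictFDerivAt

theorem IsLocalEq.surjective (h : IsLocalEq R W Φ) {p : Jet n k} (hW : p ∈ W) (hR : p ∈ R) :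
    Function.Surjective (fderiv ℝ Φ p) := fun z => by
  obtain ⟨u, hu⟩ := h.onto p hW hR z
  exact ⟨_, hu⟩

/-- The vertical tangent space is the kernel of the vertical derivative of any local equations. -/
theorem IsLocalEq.mem_tanIx (h : IsLocalEq R W Φ) {p : Jet n k} (hW : p ∈ W) (hR : p ∈ R)
    (u : Ix n k → ℝ) : u ∈ tanIx R p ↔ fderiv ℝ Φ p (vert u) = 0 := by
  refine ⟨fun hu => hu r W Φ hW h, fun hu r' W' Φ' hW' h' => ?_⟩
  funext ρ
  have hs := (h'.hasStrictFDerivAt hW')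
  have hsρ := hasStrictFDerivAt_pi'.mp hs ρ
  refine apply_eq_zero_of_vanish (h.hasStrictFDerivAt hW) hsρ (h.surjective hW hR) ?_ hu
  filter_upwards [h.isOpen.mem_nhds hW, h'.isOpen.mem_nhds hW'] with q hq hq' hΦ
  have h1 : q ∈ R := by
    rw [h.eq_zero q hq, hΦ, ← h.eq_zero p hW]
    exact hR
  rw [(h'.eq_zero q hq').mp h1, (h'.eq_zero p hW').mp hR]

theorem hasFDerivAt_jet {f : Sp n → Sp n} {x : Sp n} (hf : AnalyticAt ℝ f x) :
    ∃ J : Sp n →L[ℝ] Jet n k, HasFDerivAt (jet k f) J x ∧ ∀ l, J (Pi.single l 1)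
      = (Pi.single l 1, 0) + vert fun b => jetIx (k + 1) f x (b.shift l) := by
  have h1 : ∀ α : ↥(idxLE n k), HasFDerivAt (dd α.1 f) (fderiv ℝ (dd α.1 f) x) x :=
    fun α => (dd_analytic α.1 hf).differentiableAt.hasFDerivAt
  refine ⟨(ContinuousLinearMap.id ℝ (Sp n)).prod
    (ContinuousLinearMap.pi fun α : ↥(idxLE n k) => fderiv ℝ (dd α.1 f) x),
    (hasFDerivAt_id x).prodMk (hasFDerivAt_pi.mpr h1), fun l => ?_⟩
  rw [vert_apply, Prod.mk_add_mk, add_zero, zero_add]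
  refine Prod.ext rfl (funext fun α => ?_)
  exact (dd_add_single α.1 l hf).self_of_nhds.symm

theorem analyticAt_jet {f : Sp n → Sp n} {x : Sp n} (hf : AnalyticAt ℝ f x) :
    AnalyticAt ℝ (jet k f) x :=
  analyticAt_id.prod (AnalyticAt.pi fun α : ↥(idxLE n k) => dd_analytic α.1 hf)

/-- The equations of the prolongation, at jets of solutions to first order. -/
theorem IsLocalEq.prolong_eq (h : IsLocalEq R W Φ) {f : Sp n → Sp n} {x : Sp n}
    (hf : AnalyticAt ℝ f x) (hW : jet k f x ∈ W) (hd : fderiv ℝ (fun y => Φ (jet k f y)) x = 0)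
    (l : Fin n) : fderiv ℝ Φ (jet k f x)
      ((Pi.single l 1, 0) + vert fun b => jetIx (k + 1) f x (b.shift l)) = 0 := by
  obtain ⟨J, hJ, hJl⟩ := hasFDerivAt_jet (k := k) hf
  have h1 := ((h.hasStrictFDerivAt hW).hasFDerivAt.comp x hJ).fderiv
  have h2 : fderiv ℝ (fun y => Φ (jet k f y)) x = (fderiv ℝ Φ (jet k f x)).comp J := h1
  rw [hd] at h2
  have := congrArg (fun D : Sp n →L[ℝ] (Fin r → ℝ) => D (Pi.single l 1)) h2
  simp only [ContinuousLinearMap.comp_apply, hJl] at this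
  exact this.symm

/-- The restriction of a jet to smaller order. -/
noncomputable def resIx : (Ix n (k + 1) → ℝ) →L[ℝ] (Ix n k → ℝ) :=
  LinearMap.toContinuousLinearMap (LinearMap.funLeft ℝ ℝ Ix.inc)

/-- The derivative along `l` of a jet. -/
noncomputable def shiftIx (l : Fin n) : (Ix n (k + 1) → ℝ) →L[ℝ] (Ix n k → ℝ) :=
  LinearMap.toContinuousLinearMap (LinearMap.funLeft ℝ ℝ fun b : Ix n k => b.shift l)

/-- The linear part of the equations of the prolongation. -/
noncomputable def prolMap (Φ : Jet n k → (Fin r → ℝ)) (p : Jet n k) :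
    (Ix n (k + 1) → ℝ) →L[ℝ] (Ix n k → ℝ) × (Fin n → Fin r → ℝ) :=
  resIx.prod (ContinuousLinearMap.pi fun l => (fderiv ℝ Φ p).comp (vert.comp (shiftIx l)))

theorem contDiffAt_prolMap (h : IsLocalEq R W Φ) {p : Jet n k} (hW : p ∈ W) :
    ContDiffAt ℝ 1 (prolMap Φ) p := by
  let Ψ : (Jet n k →L[ℝ] (Fin r → ℝ)) →ₗ[ℝ]
      ((Ix n (k + 1) → ℝ) →L[ℝ] (Ix n k → ℝ) × (Fin n → Fin r → ℝ)) :=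
    { toFun := fun D => (0 : (Ix n (k + 1) → ℝ) →L[ℝ] (Ix n k → ℝ)).prod
        (ContinuousLinearMap.pi fun l => D.comp (vert.comp (shiftIx l)))
      map_add' := fun D D' => by
        ext v <;> simp
      map_smul' := fun t D => by
        ext v <;> simp }
  have h1 : prolMap Φ = fun p => resIx.prod 0 + LinearMap.toContinuousLinearMap Ψ (fderiv ℝ Φ p) := by
    funext p
    ext v <;> simp [prolMap, Ψ]
  rw [h1]
  exact contDiffAt_const.add ((LinearMap.toContinuousLinearMap Ψ).contDiff.contDiffAt.comp p
    (h.analytic p hW).fderiv.contDiffAt)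

/-- It converts constancy of the rank of the prolonged symbol into the constant-rank hypothesis of
`exists_range_equation`. -/
theorem finrank_ker_prolMap (h : IsLocalEq R W Φ) {p : Jet n k} (hW : p ∈ W) (hR : p ∈ R) :
    Module.finrank ℝ (LinearMap.ker (prolMap Φ p).toLinearMap)
      = Module.finrank ℝ (symbProl R p) := by
  have h1 := finrank_prolOf (ContinuousLinearEquiv.refl ℝ (Sp n)) (tanIx R p)
  have h2 : (tanIx R p).comap (chgIx (ContinuousLinearEquiv.refl ℝ (Sp n)).symm k) = tanIx R p := by
    ext u
    rw [Submodule.mem_comap, ContinuousLinearEquiv.refl_symm, chgIx_refl]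
  rw [symbProl_eq, h1, h2]
  have h3 : LinearMap.ker (prolMap Φ p).toLinearMap = prolIx (tanIx R p) := by
    ext v
    have e1 : v ∈ LinearMap.ker (prolMap Φ p).toLinearMap ↔
        resIx v = 0 ∧ (fun l => fderiv ℝ Φ p (vert (shiftIx l v))) = 0 := Prod.mk_eq_zero
    have e2 : v ∈ prolIx (tanIx R p) ↔
        (∀ b : Ix n k, v b.inc = 0) ∧ ∀ l, shiftIx l v ∈ tanIx R p := Iff.rfl
    rw [e1, e2, funext_iff, funext_iff]
    exact and_congr Iff.rfl (forall_congr' fun l => (h.mem_tanIx hW hR _).symm)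
  rw [h3]

/-- The vertical coordinates of a jet. -/
noncomputable def fibIx : Jet n k →L[ℝ] (Ix n k → ℝ) :=
  LinearMap.toContinuousLinearMap
    ((LinearEquiv.curry ℝ ℝ ↥(idxLE n k) (Fin n)).symm.toLinearMap ∘ₗ
      LinearMap.snd ℝ (Sp n) (JetFib n k))

/-- The first prolongation of an involutive system, linearized along a solution, projects onto the
linearized system. -/
theorem IsInvolutive.exists_prolongation (hinv : IsInvolutive R) (h : IsLocalEq R W Φ)
    {f : Sp n → Sp n} {x : Sp n} (hf : AnalyticAt ℝ f x) (hW : jet k f x ∈ W)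
    (hR : ∀ᶠ y in 𝓝 x, jet k f y ∈ R) {u : Ix n k → ℝ} (hu : u ∈ tanIx R (jet k f x)) :
    ∃ v : Ix n (k + 1) → ℝ, resIx v = u ∧ ∀ l, fderiv ℝ Φ (jet k f x) (vert (shiftIx l v))
      + fderiv ℝ (fderiv ℝ Φ) (jet k f x)
        ((Pi.single l 1, 0) + vert (shiftIx l (jetIx (k + 1) f x))) (vert u) = 0 := by
  set q := jet k f x with hq
  have hRq : q ∈ R := hR.self_of_nhds
  set w : Fin n → Jet n k := fun l => (Pi.single l 1, 0) + vert (shiftIx l (jetIx (k + 1) f x))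
    with hw
  have hfx : fderiv ℝ (fun y => Φ (jet k f y)) x = 0 := by
    have hev : (fun y => Φ (jet k f y)) =ᶠ[𝓝 x] fun _ => 0 := by
      have hWev := (analyticAt_jet (k := k) hf).continuousAt.eventually (h.isOpen.mem_nhds hW)
      filter_upwards [hR, hWev] with y hy hyW
      exact (h.eq_zero _ hyW).mp hy
    rw [hev.fderiv_eq]
    exact fderiv_const_apply 0
  -- Written relative to the jet of `f`, the jets in the prolongation over `p` are the solutions of
  -- the linear equation with operator `prolMap Φ p` and right-hand side `c p`.
  let c : Jet n k → (Ix n k → ℝ) × (Fin n → Fin r → ℝ) := fun p =>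
    (fibIx p - jetIx k f x, fun l => -fderiv ℝ Φ p (w l))
  have hD : HasFDerivAt (fderiv ℝ Φ) (fderiv ℝ (fderiv ℝ Φ) q) q :=
    (h.analytic q hW).fderiv.differentiableAt.hasFDerivAt
  have hc' : HasFDerivAt c (fibIx.prod (ContinuousLinearMap.pi fun l =>
      -(fderiv ℝ (fderiv ℝ Φ) q).flip (w l))) q := by
    refine HasFDerivAt.prodMk (fibIx.hasFDerivAt.sub_const _) (hasFDerivAt_pi.mpr fun l => ?_)
    refine HasFDerivAt.neg ?_
    refine (hD.clm_apply (hasFDerivAt_const (w l) q)).congr_fderiv ?_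
    rw [ContinuousLinearMap.comp_zero, zero_add]
  have hcc : ContDiffAt ℝ 1 c q := by
    refine ContDiffAt.prodMk (fibIx.contDiff.contDiffAt.sub contDiffAt_const)
      (contDiffAt_pi.mpr fun l => ?_)
    exact ((h.analytic q hW).fderiv.contDiffAt.clm_apply contDiffAt_const).neg
  have hcq : c q = 0 := by
    refine Prod.ext (sub_self _) (funext fun l => ?_)
    exact neg_eq_zero.mpr (h.prolong_eq hf hW hfx l)
  by_contra hcon
  -- The vector sought is a preimage of the derivative of `c` along `u`. If there is none, a
  -- functional killing the range separates them, and the equation `φ` built from it vanishes on R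
  -- with nonzero derivative along the tangent vector `u`.
  have hnot : fderiv ℝ c q (vert u) ∉ LinearMap.range (prolMap Φ q).toLinearMap := by
    rintro ⟨v, hv⟩
    rw [hc'.fderiv] at hv
    refine hcon ⟨v, congrArg Prod.fst hv, fun l => ?_⟩
    have h1 : fderiv ℝ Φ q (vert (shiftIx l v)) = -fderiv ℝ (fderiv ℝ Φ) q (vert u) (w l) :=
      congrFun (congrArg Prod.snd hv) l
    have hsymm : fderiv ℝ (fderiv ℝ Φ) q (w l) (vert u)
        = fderiv ℝ (fderiv ℝ Φ) q (vert u) (w l) :=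
      (ContDiffAt.isSymmSndFDerivAt_of_omega (h.analytic q hW).contDiffAt).eq _ _
    rw [h1, hsymm, neg_add_cancel]
  obtain ⟨l₀, hl₀, hker⟩ := Submodule.exists_le_ker_of_notMem hnot
  obtain ⟨φ, hφq, hφ', hφ⟩ := exists_range_equation (contDiffAt_prolMap h hW) hcc hcq
    (LinearMap.toContinuousLinearMap l₀) fun v => hker ⟨v, rfl⟩
  have hvan := apply_eq_zero_of_vanish (h.hasStrictFDerivAt hW) hφ' (h.surjective hW hRq) (by
    have hrank := eventually_nhdsWithin_iff.mp (hinv.rank_const q hRq)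
    filter_upwards [hφ, hrank, h.isOpen.mem_nhds hW] with p hp hrp hpW hΦ
    have hpR : p ∈ R := by
      rw [h.eq_zero p hpW, hΦ, ← h.eq_zero q hW]
      exact hRq
    rw [hφq]
    refine hp ?_ ?_
    · rw [finrank_ker_prolMap h hpW hpR, finrank_ker_prolMap h hW hRq]
      exact hrp hpR
    -- Surjectivity of the nonlinear prolongation says that `c p` lies in the range of `prolMap Φ p`
    -- for every `p` in R.
    · obtain ⟨g, hg, hgp, -, hgd⟩ := hinv.surj p hpR
      have hpr := fun l => h.prolong_eq hg (by rwa [hgp])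
        (hgd r W Φ (by rwa [hgp]) h) l
      rw [hgp] at hpr
      refine ⟨jetIx (k + 1) g p.1 - jetIx (k + 1) f x, Prod.ext ?_ (funext fun l => ?_)⟩
      · change resIx (jetIx (k + 1) g p.1 - jetIx (k + 1) f x) = fibIx p - jetIx k f x
        rw [map_sub]
        conv_rhs => rw [← hgp]
        rfl
      · change fderiv ℝ Φ p (vert (shiftIx l (jetIx (k + 1) g p.1 - jetIx (k + 1) f x)))
          = -fderiv ℝ Φ p (w l)
        have h1 := hpr l
        have h2 : (fun b : Ix n k => jetIx (k + 1) g p.1 (b.shift l))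
          = shiftIx l (jetIx (k + 1) g p.1) := rfl
        rw [h2, map_add] at h1
        rw [map_sub, map_sub, map_sub, hw]
        beta_reduce
        rw [map_add, eq_neg_of_add_eq_zero_right h1]
        abel) ((h.mem_tanIx hW hRq u).mp hu)
  exact hl₀ hvan

end Geometry

/-! ### The infinitesimal equations of a Lie pseudogroup -/

section Infinitesimal

variable {n : ℕ}

theorem LiePseudogroup.jet_id_mem (Γ : LiePseudogroup n) {x : Sp n} (hx : x ∈ Γ.dom) :
    jet Γ.order id x ∈ Γ.system :=
  (Γ.mem_iff _ (Γ.analytic _ Γ.id_mem)).mp Γ.id_mem x hx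

/-- The solution operator of the infinitesimal equations of a Lie pseudogroup. -/
theorem LiePseudogroup.exists_operator (Γ : LiePseudogroup n) :
    ∃ s C : ℝ, 1 ≤ s ∧ 0 ≤ C ∧ ∀ N : ℕ, ∃ S : (Pos n → ℝ) →ₗ[ℝ] (Pos n → ℝ),
      (∀ U, (∀ a : Pos n, a.1.degree = N → U a = 0) → S U = 0) ∧
      ∀ f : Sp n → Sp n, AnalyticAt ℝ f 0 →
        (∀ᶠ x in 𝓝 (0 : Sp n), jetIx Γ.order f x ∈ tanIx Γ.system (jet Γ.order id x)) →
        (∀ a : Pos n, a.1.degree < N → arr f a = 0) →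
        (∃ g : Sp n → Sp n, AnalyticAt ℝ g 0 ∧
          (∀ᶠ x in 𝓝 (0 : Sp n), jetIx Γ.order g x ∈ tanIx Γ.system (jet Γ.order id x)) ∧
          arr g = S (arr f)) ∧
        (∀ a : Pos n, a.1.degree ≤ N → S (arr f) a = arr f a) ∧
        ∀ m : ℝ, 0 ≤ m → (∀ a : Pos n, a.1.degree = N → |arr f a| ≤ m * (N.factorial : ℝ)) →
          ∀ a : Pos n, |S (arr f) a| ≤ C * m * ((a.1.degree.factorial : ℝ) * s ^ a.1.degree) := by
  classical
  set k := Γ.order with hk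
  set p : Sp n → Jet n k := jet k id with hp
  have hp0 : p 0 ∈ Γ.system := Γ.jet_id_mem Γ.zero_mem_dom
  obtain ⟨r, W, Φ, hW, h⟩ := Γ.involutive.fibred (p 0) hp0
  have hid : ∀ x, AnalyticAt ℝ (id : Sp n → Sp n) x := fun x => analyticAt_id
  have hpan : ∀ x, AnalyticAt ℝ p x := fun x => analyticAt_jet (hid x)
  have hWev : ∀ᶠ x in 𝓝 (0 : Sp n), p x ∈ W :=
    (hpan 0).continuousAt.eventually (h.isOpen.mem_nhds hW)
  have hRev : ∀ᶠ x in 𝓝 (0 : Sp n), p x ∈ Γ.system := by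
    filter_upwards [Γ.isOpen_dom.mem_nhds Γ.zero_mem_dom] with x hx
    exact Γ.jet_id_mem hx
  -- The linearization along the identity: the vertical Jacobian of the local equations at the jets
  -- of the identity.
  set A : Fin r → Ix n k → Sp n → ℝ := fun ρ b x =>
    fderiv ℝ Φ (p x) (vert (Pi.single b 1)) ρ with hA
  have hfd : ∀ {x}, p x ∈ W → AnalyticAt ℝ (fun x => fderiv ℝ Φ (p x)) x :=
    fun {x} hx => (h.analytic _ hx).fderiv.comp (hpan x)
  have hAan : ∀ {x}, p x ∈ W → ∀ ρ b, AnalyticAt ℝ (A ρ b) x := fun {x} hx ρ b =>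
    ((ContinuousLinearMap.proj (R := ℝ) (φ := fun _ : Fin r => ℝ) ρ).comp
      (ContinuousLinearMap.apply ℝ (Fin r → ℝ) (vert (Pi.single b 1) : Jet n k))).analyticAt _
        |>.comp (hfd hx)
  have hsum : ∀ u : Ix n k → ℝ, (vert u : Jet n k) = ∑ b, u b • vert (Pi.single b 1) := by
    intro u
    conv_lhs => rw [pi_eq_sum_univ' u]
    rw [map_sum]
    exact Finset.sum_congr rfl fun b _ => map_smul _ _ _
  have hAL : ∀ ρ x u, eqnL (A ρ) x u = fderiv ℝ Φ (p x) (vert u) ρ := by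
    intro ρ x u
    rw [eqnL_apply, hsum, map_sum, Finset.sum_apply]
    refine Finset.sum_congr rfl fun b _ => ?_
    rw [map_smul, Pi.smul_apply, smul_eq_mul, mul_comm]
  have hsol : ∀ᶠ x in 𝓝 (0 : Sp n), solAt A x = tanIx Γ.system (p x) := by
    filter_upwards [hWev, hRev] with x hx1 hx2
    ext u
    rw [h.mem_tanIx hx1 hx2, solAt, LinearMap.mem_ker, funext_iff, funext_iff]
    exact forall_congr' fun ρ => by rw [LinearMap.pi_apply, hAL]
  have hmem : ∀ f : Sp n → Sp n,
      (∀ᶠ x in 𝓝 (0 : Sp n), ∀ ρ, eqnL (A ρ) x (jetIx k f x) = 0) ↔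
        ∀ᶠ x in 𝓝 (0 : Sp n), jetIx k f x ∈ tanIx Γ.system (p x) := by
    intro f
    refine eventually_congr ?_
    filter_upwards [hsol] with x hx
    rw [← hx, solAt, LinearMap.mem_ker, funext_iff]
    rfl
  have hAD : ∀ {x}, p x ∈ W → ∀ ρ l v, eqnD (A ρ) l x v =
      (fderiv ℝ Φ (p x) (vert (shiftIx l v)) + fderiv ℝ (fderiv ℝ Φ) (p x)
        ((Pi.single l 1, 0) + vert (shiftIx l (jetIx (k + 1) id x))) (vert (resIx v))) ρ := by
    intro x hx ρ l v
    obtain ⟨J, hJ, hJl⟩ := hasFDerivAt_jet (k := k) (hid x)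
    have hdA : ∀ b, dd1 l (A ρ b) x = fderiv ℝ (fderiv ℝ Φ) (p x)
        ((Pi.single l 1, 0) + vert (shiftIx l (jetIx (k + 1) id x))) (vert (Pi.single b 1)) ρ := by
      intro b
      have h1 : HasFDerivAt (fderiv ℝ Φ) (fderiv ℝ (fderiv ℝ Φ) (p x)) (p x) :=
        (h.analytic _ hx).fderiv.differentiableAt.hasFDerivAt
      have h2 := ((ContinuousLinearMap.proj (R := ℝ) (φ := fun _ : Fin r => ℝ) ρ).comp
        (ContinuousLinearMap.apply ℝ (Fin r → ℝ)
          (vert (Pi.single b 1) : Jet n k))).hasFDerivAt.comp x (h1.comp x hJ)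
      have h3 : fderiv ℝ (A ρ b) x = _ := h2.fderiv
      rw [dd1, h3]
      simp only [ContinuousLinearMap.comp_apply, hJl]
      rfl
    rw [eqnD_apply, Pi.add_apply, hsum (shiftIx l v), hsum (resIx v), map_sum, map_sum,
      Finset.sum_apply, Finset.sum_apply, ← Finset.sum_add_distrib]
    refine Finset.sum_congr rfl fun b _ => ?_
    rw [hdA, map_smul, map_smul, Pi.smul_apply, Pi.smul_apply, smul_eq_mul, smul_eq_mul, add_comm,
      mul_comm (A ρ b x), mul_comm _ (v b.inc)]
    rfl
  obtain ⟨e, he⟩ := Γ.involutive.symb_involutive (p 0) hp0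
  obtain ⟨s, C, hs, hC, hop⟩ := exists_solution_operator_of_cartan (A := A) (hAan hW)
    (fun z => by
      obtain ⟨u, hu⟩ := h.surjective_vert hW hp0 z
      refine ⟨u, funext fun ρ => ?_⟩
      rw [LinearMap.pi_apply, hAL, hu]) (by
    filter_upwards [hWev, hRev.eventually_nhds, hsol] with x hx1 hx2 hx3 u hu
    have hu' : u ∈ tanIx Γ.system (p x) := by
      rw [← hx3, solAt, LinearMap.mem_ker]
      exact funext hu
    obtain ⟨v, hv1, hv2⟩ := Γ.involutive.exists_prolongation h (hid x) hx1 hx2 hu'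
    refine ⟨v, fun b => congrFun hv1 b, fun ρ l => ?_⟩
    rw [hAD hx1, hv1]
    exact congrFun (hv2 l) ρ) e (by
    -- Cartan's test is used only at the origin; constancy of the rank spreads the dimension of the
    -- prolonged symbol to nearby points.
    have hrank := eventually_nhdsWithin_iff.mp (Γ.involutive.rank_const (p 0) hp0)
    filter_upwards [(hpan 0).continuousAt.eventually hrank, hRev, hsol] with x hx1 hx2 hx3
    rw [hx3, hsol.self_of_nhds]
    exact (hx1 hx2).trans he)
  refine ⟨s, C, hs, hC, fun N => ?_⟩
  obtain ⟨S, hS0, hS⟩ := hop N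
  refine ⟨S, hS0, fun f hf hfA hf0 => ?_⟩
  obtain ⟨⟨g, hg, hgA, hgS⟩, h2, h3⟩ := hS f hf ((hmem f).mpr hfA) hf0
  exact ⟨⟨g, hg, (hmem g).mp hgA, hgS⟩, h2, h3⟩

end Infinitesimal

/-! ### Formal vector fields and arrays of derivatives -/

section Formal

variable {n : ℕ}

/-- The derivatives at the origin of a formal vector field. -/
noncomputable def toArr : FormalVF n →ₗ[ℝ] (Pos n → ℝ) where
  toFun V c := (mfact c.1 : ℝ) * MvPowerSeries.coeff c.1 (V c.2)
  map_add' V W := by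
    funext c
    simp [mul_add]
  map_smul' t V := by
    funext c
    simp [mul_left_comm]

/-- The formal vector field with given derivatives at the origin. -/
noncomputable def ofArr : (Pos n → ℝ) →ₗ[ℝ] FormalVF n where
  toFun U i := (fun α => U (α, i) / (mfact α : ℝ) : (Fin n →₀ ℕ) → ℝ)
  map_add' U V := by
    funext i α
    exact add_div _ _ _
  map_smul' t U := by
    funext i α
    exact mul_div_assoc _ _ _

theorem coeff_ofArr (U : Pos n → ℝ) (α : Fin n →₀ ℕ) (i : Fin n) :
    MvPowerSeries.coeff α (ofArr U i) = U (α, i) / (mfact α : ℝ) := rfl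

theorem taylor_eq_ofArr (f : Sp n → Sp n) : taylor f = ofArr (arr f) := rfl

theorem toArr_taylor (f : Sp n → Sp n) : toArr (taylor f) = arr f := by
  funext c
  change (mfact c.1 : ℝ) * (arr f (c.1, c.2) / (mfact c.1 : ℝ)) = arr f c
  rw [mul_div_cancel₀ _ (mfact_ne_zero _)]

/-- In the basis (|α|!/α!) x^α the coefficients are ∂^α divided by |α|!, so the norm in degree N is
the largest derivative of order N over N!. -/
theorem abs_arr_le_homNorm (f : Sp n → Sp n) {N : ℕ} (a : Pos n) (ha : a.1.degree = N) :
    |arr f a| ≤ homNorm N (taylor f) * (N.factorial : ℝ) := by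
  have h0 : (0 : ℝ) < (N.factorial : ℝ) := by positivity
  have h1 := Finset.le_sup (f := fun p : (Fin n →₀ ℕ) × Fin n =>
    ‖(mfact p.1 : ℝ) / (N.factorial : ℝ) * MvPowerSeries.coeff p.1 (taylor f p.2)‖₊)
    (Finset.mk_mem_product (mem_idxEq.mpr ha) (Finset.mem_univ a.2))
  have h2 : ‖(mfact a.1 : ℝ) / (N.factorial : ℝ) * MvPowerSeries.coeff a.1 (taylor f a.2)‖
      ≤ homNorm N (taylor f) := NNReal.coe_le_coe.mpr h1
  rw [taylor_eq_ofArr, coeff_ofArr, div_mul_div_cancel₀' (mfact_ne_zero _), norm_div,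
    Real.norm_of_nonneg h0.le, div_le_iff₀ h0] at h2
  exact h2

theorem homNorm_ofArr_le {U : Pos n → ℝ} {N : ℕ} {X : ℝ} (hX : 0 ≤ X)
    (h : ∀ a : Pos n, a.1.degree = N → |U a| ≤ X * (N.factorial : ℝ)) :
    homNorm N (ofArr U) ≤ X := by
  have h0 : (0 : ℝ) < (N.factorial : ℝ) := by positivity
  lift X to NNReal using hX
  unfold homNorm
  rw [NNReal.coe_le_coe]
  refine Finset.sup_le fun a ha => ?_
  rw [← NNReal.coe_le_coe, coe_nnnorm, coeff_ofArr, div_mul_div_cancel₀' (mfact_ne_zero _),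
    norm_div, Real.norm_of_nonneg h0.le, div_le_iff₀ h0]
  exact h a (mem_idxEq.mp (Finset.mem_product.mp ha).1)

end Formal

end LiePG

/-- The section `S q` is the section of `𝓛_q^ω(Γ) → 𝓛_q^ω(Γ) / 𝓛_{q+1}^ω(Γ)`, for `q = 0, 1, 2, …`.
The norm of the class of `V` in the quotient is the norm of its homogeneous part of
degree `q + 1`. -/
theorem lemma1 {n : ℕ} (Γ : LiePG.LiePseudogroup n) :
    ∃ ρ₀ : ℝ, 0 < ρ₀ ∧ ∃ S : ∀ q : ℕ, LiePG.Gr Γ q →ₗ[ℝ] LiePG.filt Γ q,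
      (∀ (q : ℕ) (w : LiePG.Gr Γ q), Submodule.Quotient.mk (S q w) = w) ∧
      (∀ (q : ℕ) (w : LiePG.Gr Γ q), (S q w : LiePG.FormalVF n) ∈ LiePG.banachSub Γ ρ₀) ∧
      ∃ C : ℝ, ∀ (q : ℕ) (V : LiePG.filt Γ q),
        LiePG.rhoNorm ρ₀ (S q (Submodule.Quotient.mk V) : LiePG.FormalVF n)
          ≤ C * LiePG.homNorm (q + 1) (V : LiePG.FormalVF n) := by
  open LiePG in
  obtain ⟨s, C, hs, hC, hop⟩ := Γ.exists_operator
  choose T hT0 hT using hop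
  have hs0 : 0 < s := by linarith
  have hrep : ∀ (q : ℕ) (V : FormalVF n), V ∈ filt Γ q → ∃ f : Sp n → Sp n,
      AnalyticAt ℝ f 0 ∧ V = taylor f ∧
      (∀ᶠ x in 𝓝 (0 : Sp n), jetIx Γ.order f x ∈ tanIx Γ.system (jet Γ.order id x)) ∧
      ∀ a : Pos n, a.1.degree < q + 1 → arr f a = 0 := by
    rintro q V ⟨⟨f, hf, rfl, hfR⟩, hV⟩
    refine ⟨f, hf, rfl, hfR, fun a ha => ?_⟩
    rw [← toArr_taylor]
    exact mul_eq_zero_of_right _ (hV a.2 a.1 (by omega))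
  have hchi : ∀ (q : ℕ) (U : Pos n → ℝ), (∀ a : Pos n, a.1.degree ≤ q → U a = 0) →
      ofArr U ∈ chi n q := by
    intro q U hU i α hα
    rw [coeff_ofArr, hU (α, i) hα, zero_div]
  -- The lowest possibly nonzero degree on `filt Γ q` is q+1, which is therefore the starting order
  -- of the operator.
  let F : ∀ q : ℕ, FormalVF n →ₗ[ℝ] FormalVF n := fun q => ofArr ∘ₗ T (q + 1) ∘ₗ toArr
  have hFt : ∀ (q : ℕ) (f : Sp n → Sp n), F q (taylor f) = ofArr (T (q + 1) (arr f)) := by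
    intro q f
    change ofArr (T (q + 1) (toArr (taylor f))) = _
    rw [toArr_taylor]
  have hFlie : ∀ (q : ℕ), ∀ V ∈ filt Γ q, F q V ∈ lieAlg Γ := by
    intro q V hV
    obtain ⟨f, hf, rfl, hfR, hf0⟩ := hrep q V hV
    obtain ⟨⟨g, hg, hgR, hgT⟩, -, -⟩ := hT (q + 1) f hf hfR hf0
    exact ⟨g, hg, by rw [hFt, ← hgT, taylor_eq_ofArr], hgR⟩
  have hFchi : ∀ (q : ℕ), ∀ V ∈ filt Γ q, F q V ∈ chi n q := by
    intro q V hV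
    obtain ⟨f, hf, rfl, hfR, hf0⟩ := hrep q V hV
    obtain ⟨-, hlow, -⟩ := hT (q + 1) f hf hfR hf0
    rw [hFt]
    refine hchi q _ fun a ha => ?_
    rw [hlow a (by omega), hf0 a (by omega)]
  -- Agreement through degree q+1 is the section property.
  have hFsub : ∀ (q : ℕ), ∀ V ∈ filt Γ q, F q V - V ∈ filt Γ (q + 1) := by
    intro q V hV
    refine ⟨Submodule.sub_mem _ (hFlie q V hV) hV.1, ?_⟩
    obtain ⟨f, hf, rfl, hfR, hf0⟩ := hrep q V hV
    obtain ⟨-, hlow, -⟩ := hT (q + 1) f hf hfR hf0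
    rw [hFt, taylor_eq_ofArr, ← map_sub]
    refine hchi (q + 1) _ fun a ha => ?_
    rw [Pi.sub_apply, hlow a ha, sub_self]
  -- The operator reads only the derivatives of order q+1, so it descends to the quotient.
  have hFzero : ∀ (q : ℕ), ∀ V ∈ filt Γ (q + 1), F q V = 0 := by
    intro q V hV
    change ofArr (T (q + 1) (toArr V)) = 0
    rw [hT0 (q + 1) (toArr V) fun a ha => mul_eq_zero_of_right _ (hV.2 a.2 a.1 ha.le), map_zero]
  have hFbd : ∀ (q : ℕ), ∀ V ∈ filt Γ q, ∀ j, homNorm j (F q V)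
      ≤ C * homNorm (q + 1) V * s ^ j := by
    intro q V hV j
    obtain ⟨f, hf, rfl, hfR, hf0⟩ := hrep q V hV
    obtain ⟨-, -, hbd⟩ := hT (q + 1) f hf hfR hf0
    have hm := homNorm_nonneg (q + 1) (taylor f)
    rw [hFt]
    refine homNorm_ofArr_le (by positivity) fun a ha => ?_
    refine (hbd _ hm (fun a ha => abs_arr_le_homNorm f a ha) a).trans (le_of_eq ?_)
    rw [ha]
    ring
  let G : ∀ q : ℕ, filt Γ q →ₗ[ℝ] filt Γ q := fun q =>
    (F q).restrict fun V hV => ⟨hFlie q V hV, hFchi q V hV⟩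
  have hGker : ∀ q, (filt Γ (q + 1)).submoduleOf (filt Γ q) ≤ LinearMap.ker (G q) := by
    intro q V hV
    exact Subtype.ext (hFzero q V.1 hV)
  -- The extra factor in the constant `C * s` comes from the exponent k − 1, instead of k, in the
  -- norm.
  refine ⟨s, hs0, fun q => Submodule.liftQ _ (G q) (hGker q), fun q w => ?_, fun q w => ?_,
    C * s, fun q V => ?_⟩
  · obtain ⟨V, rfl⟩ := Submodule.Quotient.mk_surjective _ w
    rw [Submodule.liftQ_apply, Submodule.Quotient.eq]
    exact hFsub q V.1 V.2
  · obtain ⟨V, rfl⟩ := Submodule.Quotient.mk_surjective _ w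
    rw [Submodule.liftQ_apply]
    exact ⟨hFlie q V.1 V.2, _, hFbd q V.1 V.2⟩
  · rw [Submodule.liftQ_apply]
    refine ciSup_le fun j => ?_
    rw [div_le_iff₀ (zpow_pos hs0 _)]
    refine (hFbd q V.1 V.2 j).trans (le_of_eq ?_)
    rw [zpow_sub₀ hs0.ne', zpow_natCast, zpow_one]
    field_simp
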